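/- Let $G=(V,E)$ be a finite simple undirected graph with $n$ vertices and $m$ edges, and let $c$ be a partial colouring of $V$ with two colours $1,2$ (any set of vertices may be left uncoloured). For a total colouring $c'\colon V\to\{1,2\}$, an edge is called happy if its two endpoints have the same colour. The 2-MHE (Maximum Happy Edges) problem asks, given $(G,c)$, for a total colouring $c'$ that extends $c$ and has the largest number of happy edges among all total colourings extending $c$. **Theorem.** There is a word-RAM program, with words of $\log_2(n+m+1)+O(1)$ bits and unit-cost addition, subtraction, comparison and memory access, which, given any such $G$ (by adjacency lists) and $c$, outputs an optimal solution $c'$ of the 2-MHE problem. If $G$ is non-empty and has no isolated vertex, its running time is $$O\bigl(\min\{n^{2/3}m,\ m^{3/2}\}\bigr).$$ For arbitrary $G$ its running time is $O\bigl(n+1+\min\{n^{2/3}m,\ m^{3/2}\}\bigr)$. -/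

import Mathlib

/-! ### The Maximum Happy Edges problem -/

namespace HappyEdges

variable {V C : Type*}

/-- The happy edges of `G` under the total vertex colouring `f`: those edges whose two endpoints
have the same colour. -/
def happyEdges (G : SimpleGraph V) (f : V → C) : Set (Sym2 V) :=
  {e | e ∈ G.edgeSet ∧ ∀ u ∈ e, ∀ v ∈ e, f u = f v}

/-- The total colouring `f` extends the partial colouring `c`, where `c v = none` means that the
vertex `v` has no prescribed colour. -/
def Extends (c : V → Option C) (f : V → C) : Prop :=
  ∀ v i, c v = some i → f v = i

/-- `f` is a solution of the instance `(G, c)` of the Maximum Happy Edges problem with colour set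
`C`: it extends `c`, and no extension of `c` has more happy edges. -/
def IsMHESolution (G : SimpleGraph V) (c : V → Option C) (f : V → C) : Prop :=
  Extends c f ∧ ∀ g : V → C, Extends c g → (happyEdges G g).ncard ≤ (happyEdges G f).ncard

/-- The number of edges of a graph. -/
noncomputable def numEdges (G : SimpleGraph V) : ℕ := G.edgeSet.ncard

end HappyEdges

/-! ### A word RAM with structured programs

The machine has registers `0, 1, 2, …` (a program mentions only finitely many of them) and a
random-access memory, both holding natural numbers of at most a given size `W`, the largest number
that fits into a machine word. Memory addresses are words too, so they are bounded by `W` as well.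
The only arithmetic operations are addition and truncated subtraction. -/

namespace WordRAM

/-- The state of the machine: the contents of the registers and of the memory. -/
structure State where
  reg : ℕ → ℕ
  mem : ℕ → ℕ

/-- Comparisons of the contents of two registers. -/
inductive Test where
  | lt (a b : ℕ)
  | eq (a b : ℕ)
  | ne (a b : ℕ)

/-- Truth of a comparison in a state. -/
def Test.Holds : Test → State → Prop
  | .lt a b, σ => σ.reg a < σ.reg b
  | .eq a b, σ => σ.reg a = σ.reg b
  | .ne a b, σ => σ.reg a ≠ σ.reg b

/-- Programs. -/
inductive Prog where
  /-- do nothing -/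
  | skip
  /-- `r_d := k` -/
  | const (d k : ℕ)
  /-- `r_d := r_a` -/
  | move (d a : ℕ)
  /-- `r_d := r_a + r_b` -/
  | add (d a b : ℕ)
  /-- `r_d := r_a - r_b`, or `0` if `r_a < r_b` -/
  | sub (d a b : ℕ)
  /-- `r_d := mem[r_a]` -/
  | load (d a : ℕ)
  /-- `mem[r_a] := r_b` -/
  | store (a b : ℕ)
  /-- first `p`, then `q` -/
  | seq (p q : Prog)
  /-- if the test holds then `p`, else `q` -/
  | branch (t : Test) (p q : Prog)
  /-- while the test holds, do `p` -/
  | loop (t : Test) (p : Prog)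

/-- Write the word `x` into register `d`. -/
def State.setReg (σ : State) (d x : ℕ) : State :=
  { σ with reg := Function.update σ.reg d x }

/-- Write the word `x` into the memory cell with address `a`. -/
def State.setMem (σ : State) (a x : ℕ) : State :=
  { σ with mem := Function.update σ.mem a x }

/-- `Runs W p σ t τ`: on a machine whose words hold the numbers `0, …, W`, the program `p`, started
in the state `σ`, halts after exactly `t` steps in the state `τ`. Every elementary operation and
every evaluation of a test is one step. There is no rule for an operation whose result or whose
memory address exceeds `W`: such a computation is stuck and does not halt. -/
inductive Runs (W : ℕ) : Prog → State → ℕ → State → Prop where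
  | skip (σ : State) : Runs W .skip σ 1 σ
  | const (σ : State) (d k : ℕ) (h : k ≤ W) :
      Runs W (.const d k) σ 1 (σ.setReg d k)
  | move (σ : State) (d a : ℕ) (h : σ.reg a ≤ W) :
      Runs W (.move d a) σ 1 (σ.setReg d (σ.reg a))
  | add (σ : State) (d a b : ℕ) (h : σ.reg a + σ.reg b ≤ W) :
      Runs W (.add d a b) σ 1 (σ.setReg d (σ.reg a + σ.reg b))
  | sub (σ : State) (d a b : ℕ) (h : σ.reg a - σ.reg b ≤ W) :
      Runs W (.sub d a b) σ 1 (σ.setReg d (σ.reg a - σ.reg b))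
  | load (σ : State) (d a : ℕ) (ha : σ.reg a ≤ W) (h : σ.mem (σ.reg a) ≤ W) :
      Runs W (.load d a) σ 1 (σ.setReg d (σ.mem (σ.reg a)))
  | store (σ : State) (a b : ℕ) (ha : σ.reg a ≤ W) (h : σ.reg b ≤ W) :
      Runs W (.store a b) σ 1 (σ.setMem (σ.reg a) (σ.reg b))
  | seq {p q : Prog} {σ₁ σ₂ σ₃ : State} {t₁ t₂ : ℕ}
      (hp : Runs W p σ₁ t₁ σ₂) (hq : Runs W q σ₂ t₂ σ₃) :
      Runs W (.seq p q) σ₁ (t₁ + t₂) σ₃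
  | branch_true {c : Test} {p q : Prog} {σ τ : State} {t : ℕ}
      (hc : c.Holds σ) (hp : Runs W p σ t τ) :
      Runs W (.branch c p q) σ (1 + t) τ
  | branch_false {c : Test} {p q : Prog} {σ τ : State} {t : ℕ}
      (hc : ¬ c.Holds σ) (hq : Runs W q σ t τ) :
      Runs W (.branch c p q) σ (1 + t) τ
  | loop_done {c : Test} {p : Prog} {σ : State} (hc : ¬ c.Holds σ) :
      Runs W (.loop c p) σ 1 σ
  | loop_step {c : Test} {p : Prog} {σ₁ σ₂ σ₃ : State} {t₁ t₂ : ℕ}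
      (hc : c.Holds σ₁) (hp : Runs W p σ₁ t₁ σ₂) (hl : Runs W (.loop c p) σ₂ t₂ σ₃) :
      Runs W (.loop c p) σ₁ (1 + t₁ + t₂) σ₃

/-- The initial state on an input word sequence: the input occupies the memory cells `0, 1, …`, all
other memory cells and all registers contain `0`. -/
def initialState (input : List ℕ) : State where
  reg := fun _ => 0
  mem := fun a => input.getD a 0

end WordRAM

/-! ### Instances of 2-MHE as inputs of the word RAM -/

namespace HappyEdges

/-- `adj` is a representation of `G` by adjacency lists: `adj v` lists the neighbours of `v`, in any
order and without repetition. -/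
structure IsAdjacencyLists {n : ℕ} (G : SimpleGraph (Fin n)) (adj : Fin n → List (Fin n)) :
    Prop where
  nodup : ∀ v, (adj v).Nodup
  mem_iff : ∀ v w, w ∈ adj v ↔ G.Adj v w

/-- The word for an entry of a partial 2-colouring: `0` for an uncoloured vertex, and `1`, `2` for
the two colours. -/
def colourWord : Option (Fin 2) → ℕ
  | none => 0
  | some i => i.val + 1

/-- The input for the graph `G` on the vertices `0, …, n - 1`, given by adjacency lists, with the
partial 2-colouring `c`: the number of vertices, the number of edges, the `n` colour words, the `n`
lengths of the adjacency lists, and the adjacency lists of `0, …, n - 1` one after the other. -/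
noncomputable def encodeInstance {n : ℕ} (G : SimpleGraph (Fin n)) (c : Fin n → Option (Fin 2))
    (adj : Fin n → List (Fin n)) : List ℕ :=
  n :: numEdges G ::
    (List.ofFn (fun v => colourWord (c v)) ++
      List.ofFn (fun v => (adj v).length) ++
      (List.ofFn adj).flatten.map Fin.val)

/-- In the state `τ` the memory cells `0, …, n - 1` contain the colours (`1` or `2`) of the vertices
under the total 2-colouring `f`. -/
def OutputsColouring {n : ℕ} (τ : WordRAM.State) (f : Fin n → Fin 2) : Prop :=
  ∀ v : Fin n, τ.mem v.val = colourWord (some (f v))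

/-- The quantity `min {n^(2/3) m, m^(3/2)}`. -/
noncomputable def timeBound (n m : ℕ) : ℝ :=
  min ((n : ℝ) ^ (2 / 3 : ℝ) * (m : ℝ)) ((m : ℝ) ^ (3 / 2 : ℝ))

end HappyEdges

/-! Let the vertices of colour 1 be sources and those of colour 2 sinks. A total colouring that
extends `c` amounts to a set `U`, its class of colour 1, that contains all sources and no sink, and
the unhappy edges are exactly those that leave `U`. Maximizing happy edges is therefore computing a
minimum cut in an undirected unit-capacity network (`Built.ncard_add_cut`), which the program does
by Dinic's method of blocking flows.

No flow is represented, only residual capacities. The two arcs of an edge start with capacity 1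
each, and their sum stays 2. Pushing one unit along an arc changes the residual capacity of a cut
exactly by whether the unit enters or leaves `U` (`WF.cut_push`). Hence, for every separating `U` at
once, the residual cut plus the number of units delivered to sinks is the original cut. If a phase
delivers nothing, the vertices that cannot reach a sink form a separating set with residual cut 0,
and this set is a minimum cut; no max-flow min-cut theorem is needed.

A phase takes time linear in the number of arcs. A backward breadth-first search from the sinks
computes distance labels; then a depth-first search moves units from the sources along arcs that
decrease the label, until the scan pointers of all sources are exhausted. This forces the distance
from sources to sinks to grow (`Dfs.le_label`). Once that distance is at least `D`, averaging over
the `D` lowest layers gives a cut of residual capacity at most `2 M / D`, and also one of at most `8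
n ^ 2 / D ^ 2` (`exists_cut_le_arcs`, `exists_cut_le_vertices`). This bounds the units still to be
delivered, and hence the remaining phases, as each except the last delivers a unit. With `D` about
`m ^ (1/2)` or `n ^ (2/3)` there are `O(D)` phases.

The algorithm is written in a small language with eleven arrays, whose compilation to the word RAM
costs a constant factor (`Exec.compile_runs`). Correctness and running time are proved together by
weakest preconditions that carry a clock. -/

/-! ### A small language with arrays, compiled to the word RAM -/

namespace ArrayLang

open WordRAM

/-- A state: the values of the variables and of the cells of the arrays. -/
structure St where
  v : ℕ → ℕ
  a : ℕ → ℕ → ℕ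

/-- Assign `y` to the variable `x`. -/
def St.setv (σ : St) (x y : ℕ) : St := { σ with v := Function.update σ.v x y }

/-- Assign `y` to the cell `i` of the array `k`. -/
def St.seta (σ : St) (k i y : ℕ) : St :=
  { σ with a := Function.update σ.a k (Function.update (σ.a k) i y) }

@[simp] theorem St.setv_v (σ : St) (x y z : ℕ) :
    (σ.setv x y).v z = if z = x then y else σ.v z := by
  simp [St.setv, Function.update_apply]

@[simp] theorem St.setv_a (σ : St) (x y : ℕ) : (σ.setv x y).a = σ.a := rfl

@[simp] theorem St.seta_v (σ : St) (k i y : ℕ) : (σ.seta k i y).v = σ.v := rfl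

@[simp] theorem St.seta_a (σ : St) (k i y l : ℕ) :
    (σ.seta k i y).a l = if l = k then Function.update (σ.a k) i y else σ.a l := by
  simp [St.seta, Function.update_apply]

/-- Expressions. -/
inductive Exp where
  | const (k : ℕ)
  | var (x : ℕ)
  | arr (k : ℕ) (e : Exp)
  | add (e f : Exp)
  | sub (e f : Exp)

namespace Exp

/-- The value of an expression. -/
def eval (σ : St) : Exp → ℕ
  | const k => k
  | var x => σ.v x
  | arr k e => σ.a k (e.eval σ)
  | add e f => e.eval σ + f.eval σ
  | sub e f => e.eval σ - f.eval σ

/-- All intermediate results fit into a word and all accesses are within one of `A` arrays of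
length `N`. -/
def Ok (A N W : ℕ) (σ : St) : Exp → Prop
  | const k => k ≤ W
  | var _ => True
  | arr k e => e.Ok A N W σ ∧ k < A ∧ e.eval σ < N
  | add e f => e.Ok A N W σ ∧ f.Ok A N W σ ∧ e.eval σ + f.eval σ ≤ W
  | sub e f => e.Ok A N W σ ∧ f.Ok A N W σ

/-- The number of machine instructions that evaluate an expression. -/
def cost : Exp → ℕ
  | const _ => 1
  | var _ => 1
  | arr _ e => e.cost + 2
  | add e f => e.cost + (f.cost + 1)
  | sub e f => e.cost + (f.cost + 1)

/-- Machine code that evaluates an expression into the `j`-th temporary register, register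
`3 j + 2`. The variable `x` is kept in register `3 x`, the address of the array `k` in register
`3 k + 1`. -/
def compile : Exp → ℕ → Prog
  | const k, j => .const (3 * j + 2) k
  | var x, j => .move (3 * j + 2) (3 * x)
  | arr k e, j => .seq (e.compile j)
      (.seq (.add (3 * j + 2) (3 * k + 1) (3 * j + 2)) (.load (3 * j + 2) (3 * j + 2)))
  | add e f, j => .seq (e.compile j)
      (.seq (f.compile (j + 1)) (.add (3 * j + 2) (3 * j + 2) (3 * (j + 1) + 2)))
  | sub e f, j => .seq (e.compile j)
      (.seq (f.compile (j + 1)) (.sub (3 * j + 2) (3 * j + 2) (3 * (j + 1) + 2)))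

end Exp

/-- The machine state `s` represents `σ`, with `A` arrays of length `N` stored one after the
other. -/
structure Sim (A N W : ℕ) (σ : St) (s : State) : Prop where
  var : ∀ x, s.reg (3 * x) = σ.v x
  var_le : ∀ x, σ.v x ≤ W
  base : ∀ k < A, s.reg (3 * k + 1) = k * N
  arr : ∀ k < A, ∀ i < N, s.mem (k * N + i) = σ.a k i
  arr_le : ∀ k < A, ∀ i < N, σ.a k i ≤ W

variable {A N W : ℕ}

theorem Sim.setTemp {σ : St} {s : State} (h : Sim A N W σ s) (j y : ℕ) :
    Sim A N W σ (s.setReg (3 * j + 2) y) where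
  var x := by
    have : 3 * x ≠ 3 * j + 2 := by omega
    simp [State.setReg, Function.update_of_ne this, h.var]
  var_le := h.var_le
  base k hk := by
    have : 3 * k + 1 ≠ 3 * j + 2 := by omega
    simp [State.setReg, Function.update_of_ne this, h.base k hk]
  arr := h.arr
  arr_le := h.arr_le

theorem index_lt {k i : ℕ} (hk : k < A) (hi : i < N) : k * N + i < A * N := by
  calc k * N + i < k * N + N := by omega
    _ = (k + 1) * N := by ring
    _ ≤ A * N := Nat.mul_le_mul_right N hk

theorem Exp.eval_le {σ : St} {s : State} (h : Sim A N W σ s) :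
    ∀ {e : Exp}, e.Ok A N W σ → e.eval σ ≤ W
  | .const _, hk => hk
  | .var x, _ => h.var_le x
  | .arr k _, ⟨_, hk, hi⟩ => h.arr_le k hk _ hi
  | .add _ _, ⟨_, _, hs⟩ => hs
  | .sub _ _, ⟨he, _⟩ => (Nat.sub_le _ _).trans (Exp.eval_le h he)

/-- The operands of a sum or difference are evaluated into the temporaries `j` and `j + 1`.
Preservation of the temporaries below the target is what keeps the left operand alive while the
right one is evaluated. -/
theorem Exp.compile_runs (hW : A * N ≤ W) {σ : St} : ∀ (e : Exp) (j : ℕ) (s : State),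
    Sim A N W σ s → e.Ok A N W σ → ∃ s', Runs W (e.compile j) s e.cost s' ∧ Sim A N W σ s' ∧
      s'.reg (3 * j + 2) = e.eval σ ∧ ∀ i < j, s'.reg (3 * i + 2) = s.reg (3 * i + 2)
  | .const k, j, s, h, hk => by
    refine ⟨_, Runs.const s _ k hk, h.setTemp j k, by simp [State.setReg, Exp.eval], ?_⟩
    intro i hi
    have : 3 * i + 2 ≠ 3 * j + 2 := by omega
    simp [State.setReg, Function.update_of_ne this]
  | .var x, j, s, h, _ => by
    refine ⟨_, Runs.move s _ _ (by rw [h.var]; exact h.var_le x), h.setTemp j _,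
      by simp [State.setReg, Exp.eval, h.var], ?_⟩
    intro i hi
    have : 3 * i + 2 ≠ 3 * j + 2 := by omega
    simp [State.setReg, Function.update_of_ne this]
  | .arr k e, j, s, h, ⟨he, hk, hi⟩ => by
    obtain ⟨s₁, r₁, h₁, v₁, k₁⟩ := Exp.compile_runs hW e j s h he
    have hlt := index_lt hk hi
    have hb : s₁.reg (3 * k + 1) + s₁.reg (3 * j + 2) = k * N + e.eval σ := by
      rw [h₁.base k hk, v₁]
    have r₂ := Runs.add (W := W) s₁ (3 * j + 2) (3 * k + 1) (3 * j + 2) (by omega)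
    rw [hb] at r₂
    have h₂ := h₁.setTemp j (k * N + e.eval σ)
    set s₂ := s₁.setReg (3 * j + 2) (k * N + e.eval σ) with hs₂
    have v₂ : s₂.reg (3 * j + 2) = k * N + e.eval σ := by simp [hs₂, State.setReg]
    have m₂ : s₂.mem (s₂.reg (3 * j + 2)) = σ.a k (e.eval σ) := by
      rw [v₂]; exact h₂.arr k hk _ hi
    have r₃ := Runs.load (W := W) s₂ (3 * j + 2) (3 * j + 2) (by omega)
      (by rw [m₂]; exact h.arr_le k hk _ hi)
    rw [m₂] at r₃
    refine ⟨_, Runs.seq r₁ (Runs.seq r₂ r₃), h₂.setTemp j _, by simp [State.setReg, Exp.eval], ?_⟩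
    intro i hij
    have : 3 * i + 2 ≠ 3 * j + 2 := by omega
    simp [State.setReg, Function.update_of_ne this, hs₂, k₁ i hij]
  | .add e f, j, s, h, ⟨he, hf, hs⟩ => by
    obtain ⟨s₁, r₁, h₁, v₁, k₁⟩ := Exp.compile_runs hW e j s h he
    obtain ⟨s₂, r₂, h₂, v₂, k₂⟩ := Exp.compile_runs hW f (j + 1) s₁ h₁ hf
    have hb : s₂.reg (3 * j + 2) + s₂.reg (3 * (j + 1) + 2) = e.eval σ + f.eval σ := by
      rw [v₂, k₂ j (by omega), v₁]
    have r₃ := Runs.add (W := W) s₂ (3 * j + 2) (3 * j + 2) (3 * (j + 1) + 2) (by omega)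
    rw [hb] at r₃
    refine ⟨_, Runs.seq r₁ (Runs.seq r₂ r₃),
      h₂.setTemp j _, by simp [State.setReg, Exp.eval], ?_⟩
    intro i hij
    have : 3 * i + 2 ≠ 3 * j + 2 := by omega
    simp [State.setReg, Function.update_of_ne this, k₁ i hij, k₂ i (by omega)]
  | .sub e f, j, s, h, ⟨he, hf⟩ => by
    obtain ⟨s₁, r₁, h₁, v₁, k₁⟩ := Exp.compile_runs hW e j s h he
    obtain ⟨s₂, r₂, h₂, v₂, k₂⟩ := Exp.compile_runs hW f (j + 1) s₁ h₁ hf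
    have hb : s₂.reg (3 * j + 2) - s₂.reg (3 * (j + 1) + 2) = e.eval σ - f.eval σ := by
      rw [v₂, k₂ j (by omega), v₁]
    have hle := Exp.eval_le h he
    have r₃ := Runs.sub (W := W) s₂ (3 * j + 2) (3 * j + 2) (3 * (j + 1) + 2) (by omega)
    rw [hb] at r₃
    refine ⟨_, Runs.seq r₁ (Runs.seq r₂ r₃),
      h₂.setTemp j _, by simp [State.setReg, Exp.eval], ?_⟩
    intro i hij
    have : 3 * i + 2 ≠ 3 * j + 2 := by omega
    simp [State.setReg, Function.update_of_ne this, k₁ i hij, k₂ i (by omega)]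

/-- Comparisons of the values of two expressions. -/
inductive Cond where
  | lt (e f : Exp)
  | eq (e f : Exp)
  | ne (e f : Exp)

namespace Cond

/-- The left side of a comparison. -/
def left : Cond → Exp
  | lt e _ => e
  | eq e _ => e
  | ne e _ => e

/-- The right side of a comparison. -/
def right : Cond → Exp
  | lt _ f => f
  | eq _ f => f
  | ne _ f => f

/-- Truth of a comparison in a state. -/
def Holds (σ : St) : Cond → Prop
  | lt e f => e.eval σ < f.eval σ
  | eq e f => e.eval σ = f.eval σ
  | ne e f => e.eval σ ≠ f.eval σ

/-- Both sides can be evaluated. -/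
def Ok (A N W : ℕ) (σ : St) (b : Cond) : Prop := b.left.Ok A N W σ ∧ b.right.Ok A N W σ

/-- The number of machine instructions that evaluate both sides. -/
def cost (b : Cond) : ℕ := b.left.cost + b.right.cost

/-- Code for the evaluation of both sides into the temporary registers `0` and `1`. -/
def prepare (b : Cond) : Prog := .seq (b.left.compile 0) (b.right.compile 1)

/-- The comparison of the temporary registers `0` and `1`. -/
def test : Cond → Test
  | lt _ _ => .lt 2 5
  | eq _ _ => .eq 2 5
  | ne _ _ => .ne 2 5

theorem prepare_runs (hW : A * N ≤ W) {σ : St} {s : State} (h : Sim A N W σ s) {b : Cond}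
    (hb : b.Ok A N W σ) : ∃ s', Runs W b.prepare s b.cost s' ∧ Sim A N W σ s' ∧
      (b.test.Holds s' ↔ b.Holds σ) := by
  obtain ⟨s₁, r₁, h₁, v₁, -⟩ := Exp.compile_runs hW b.left 0 s h hb.1
  obtain ⟨s₂, r₂, h₂, v₂, k₂⟩ := Exp.compile_runs hW b.right 1 s₁ h₁ hb.2
  refine ⟨s₂, Runs.seq r₁ r₂, h₂, ?_⟩
  have e₁ := k₂ 0 (by omega)
  norm_num at e₁ v₁ v₂
  rw [v₁] at e₁
  cases b <;> simp only [Cond.test, Test.Holds, Cond.Holds, e₁, v₂] <;> rfl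

end Cond

/-- Commands. -/
inductive Cmd where
  | set (x : ℕ) (e : Exp)
  | put (k : ℕ) (i e : Exp)
  | seq (p q : Cmd)
  | ite (b : Cond) (p q : Cmd)
  | whl (b : Cond) (p : Cmd)

/-- The command `p` started in `σ` halts after `t` steps in `τ`. -/
inductive Exec (A N W : ℕ) : Cmd → St → ℕ → St → Prop where
  | set {σ : St} {x : ℕ} {e : Exp} (he : e.Ok A N W σ) :
      Exec A N W (.set x e) σ 1 (σ.setv x (e.eval σ))
  | put {σ : St} {k : ℕ} {i e : Exp} (hk : k < A) (hi : i.Ok A N W σ) (hN : i.eval σ < N)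
      (he : e.Ok A N W σ) : Exec A N W (.put k i e) σ 1 (σ.seta k (i.eval σ) (e.eval σ))
  | seq {p q : Cmd} {σ₁ σ₂ σ₃ : St} {t₁ t₂ : ℕ} (hp : Exec A N W p σ₁ t₁ σ₂)
      (hq : Exec A N W q σ₂ t₂ σ₃) : Exec A N W (.seq p q) σ₁ (t₁ + t₂) σ₃
  | ite_true {b : Cond} {p q : Cmd} {σ τ : St} {t : ℕ} (hb : b.Ok A N W σ) (hc : b.Holds σ)
      (hp : Exec A N W p σ t τ) : Exec A N W (.ite b p q) σ (1 + t) τ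
  | ite_false {b : Cond} {p q : Cmd} {σ τ : St} {t : ℕ} (hb : b.Ok A N W σ) (hc : ¬ b.Holds σ)
      (hq : Exec A N W q σ t τ) : Exec A N W (.ite b p q) σ (1 + t) τ
  | whl_done {b : Cond} {p : Cmd} {σ : St} (hb : b.Ok A N W σ) (hc : ¬ b.Holds σ) :
      Exec A N W (.whl b p) σ 1 σ
  | whl_step {b : Cond} {p : Cmd} {σ₁ σ₂ σ₃ : St} {t₁ t₂ : ℕ} (hb : b.Ok A N W σ₁)
      (hc : b.Holds σ₁) (hp : Exec A N W p σ₁ t₁ σ₂) (hl : Exec A N W (.whl b p) σ₂ t₂ σ₃) :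
      Exec A N W (.whl b p) σ₁ (1 + t₁ + t₂) σ₃

namespace Cmd

/-- Machine code for a command. -/
def compile : Cmd → Prog
  | set x e => .seq (e.compile 0) (.move (3 * x) 2)
  | put k i e => .seq (i.compile 0) (.seq (e.compile 1) (.seq (.add 2 (3 * k + 1) 2) (.store 2 5)))
  | seq p q => .seq p.compile q.compile
  | ite b p q => .seq b.prepare (.branch b.test p.compile q.compile)
  | whl b p => .seq b.prepare (.loop b.test (.seq p.compile b.prepare))

/-- The largest number of machine instructions for one step of a command. -/
def width : Cmd → ℕ
  | set _ e => e.cost + 1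
  | put _ i e => i.cost + e.cost + 2
  | seq p q => max p.width q.width
  | ite b p q => max (b.cost + 1) (max p.width q.width)
  | whl b p => max (b.cost + b.cost + 1) p.width

end Cmd

theorem Sim.setVar {σ : St} {s : State} (h : Sim A N W σ s) {x y : ℕ} (hy : y ≤ W) :
    Sim A N W (σ.setv x y) (s.setReg (3 * x) y) where
  var z := by
    by_cases hz : z = x
    · simp [hz, State.setReg]
    · have : 3 * z ≠ 3 * x := by omega
      simp [hz, State.setReg, h.var]
  var_le z := by
    by_cases hz : z = x
    · simpa [hz]
    · simpa [hz] using h.var_le z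
  base k hk := by
    have : 3 * k + 1 ≠ 3 * x := by omega
    simp [State.setReg, Function.update_of_ne this, h.base k hk]
  arr := h.arr
  arr_le := h.arr_le

/-- Array number and index are quotient and remainder of the address modulo `N`, so different cells
of the arrays never share an address. -/
theorem index_inj {k l i j : ℕ} (hi : i < N) (hj : j < N) (h : k * N + i = l * N + j) :
    k = l ∧ i = j := by
  have hN : 0 < N := by omega
  have hk : k = l := by
    have h1 : (i + N * k) / N = k := by rw [Nat.add_mul_div_left _ _ hN, Nat.div_eq_of_lt hi]; simp
    have h2 : (j + N * l) / N = l := by rw [Nat.add_mul_div_left _ _ hN, Nat.div_eq_of_lt hj]; simp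
    rw [← h1, ← h2]
    congr 1
    rw [mul_comm N k, mul_comm N l]
    omega
  subst hk
  exact ⟨rfl, by omega⟩

theorem Sim.setArr {σ : St} {s : State} (h : Sim A N W σ s) {k i y : ℕ} (hi : i < N)
    (hy : y ≤ W) : Sim A N W (σ.seta k i y) (s.setMem (k * N + i) y) where
  var := h.var
  var_le := h.var_le
  base := h.base
  arr l hl j hj := by
    by_cases hjl : l = k ∧ j = i
    · obtain ⟨rfl, rfl⟩ := hjl
      simp [State.setMem]
    · have : l * N + j ≠ k * N + i := fun e => hjl (index_inj hj hi e)
      change Function.update s.mem _ _ _ = _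
      rw [Function.update_of_ne this, h.arr l hl j hj]
      by_cases hlk : l = k
      · subst hlk
        have : j ≠ i := fun e => hjl ⟨rfl, e⟩
        simp [Function.update_of_ne this]
      · simp [hlk]
  arr_le l hl j hj := by
    by_cases hlk : l = k
    · subst hlk
      by_cases hji : j = i
      · simpa [hji]
      · simpa [Function.update_of_ne hji] using h.arr_le l hl j hj
    · simpa [hlk] using h.arr_le l hl j hj

/-- A compiled command takes at most `B` machine steps for each of its own steps. -/
theorem Exec.compile_runs (hW : A * N ≤ W) {B : ℕ} {p : Cmd} {σ τ : St} {t : ℕ}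
    (h : Exec A N W p σ t τ) : p.width ≤ B → ∀ s, Sim A N W σ s →
      ∃ s' t', Runs W p.compile s t' s' ∧ Sim A N W τ s' ∧ t' ≤ B * t := by
  induction h with
  | @set σ x e he =>
    intro hB s hs
    obtain ⟨s₁, r₁, h₁, v₁, -⟩ := e.compile_runs hW 0 s hs he
    have hle := Exp.eval_le hs he
    have v₁' : s₁.reg 2 = e.eval σ := v₁
    have r₂ := Runs.move (W := W) s₁ (3 * x) 2 (by omega)
    rw [v₁'] at r₂
    exact ⟨_, _, Runs.seq r₁ r₂, h₁.setVar hle, by simpa [Cmd.width] using hB⟩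
  | @put σ k i e hk hi hN he =>
    intro hB s hs
    obtain ⟨s₁, r₁, h₁, v₁, -⟩ := i.compile_runs hW 0 s hs hi
    obtain ⟨s₂, r₂, h₂, v₂, k₂⟩ := e.compile_runs hW 1 s₁ h₁ he
    have hle := Exp.eval_le hs he
    have hlt := index_lt hk hN
    have v₁' : s₂.reg 2 = i.eval σ := (k₂ 0 (by omega)).trans v₁
    have v₂' : s₂.reg 5 = e.eval σ := v₂
    have hb : s₂.reg (3 * k + 1) + s₂.reg 2 = k * N + i.eval σ := by rw [h₂.base k hk, v₁']
    have r₃ := Runs.add (W := W) s₂ 2 (3 * k + 1) 2 (by omega)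
    rw [hb] at r₃
    have h₃ := h₂.setTemp 0 (k * N + i.eval σ)
    change Sim A N W σ (s₂.setReg 2 (k * N + i.eval σ)) at h₃
    set s₃ := s₂.setReg 2 (k * N + i.eval σ) with hs₃
    have w₁ : s₃.reg 2 = k * N + i.eval σ := by simp [hs₃, State.setReg]
    have w₂ : s₃.reg 5 = e.eval σ := by simp [hs₃, State.setReg, v₂']
    have r₄ := Runs.store (W := W) s₃ 2 5 (by omega) (by omega)
    rw [w₁, w₂] at r₄
    refine ⟨_, _, Runs.seq r₁ (Runs.seq r₂ (Runs.seq r₃ r₄)), h₃.setArr hN hle, ?_⟩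
    simp only [Cmd.width] at hB
    omega
  | seq _ _ ih₁ ih₂ =>
    intro hB s hs
    simp only [Cmd.width, max_le_iff] at hB
    obtain ⟨s₁, t₁, r₁, h₁, le₁⟩ := ih₁ hB.1 s hs
    obtain ⟨s₂, t₂, r₂, h₂, le₂⟩ := ih₂ hB.2 s₁ h₁
    exact ⟨_, _, Runs.seq r₁ r₂, h₂, by rw [mul_add]; omega⟩
  | ite_true hb hc _ ih =>
    intro hB s hs
    simp only [Cmd.width, max_le_iff] at hB
    obtain ⟨s₁, r₁, h₁, hh⟩ := Cond.prepare_runs hW hs hb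
    obtain ⟨s₂, t₂, r₂, h₂, le₂⟩ := ih hB.2.1 s₁ h₁
    exact ⟨_, _, Runs.seq r₁ (Runs.branch_true (hh.2 hc) r₂), h₂, by rw [mul_add]; omega⟩
  | ite_false hb hc _ ih =>
    intro hB s hs
    simp only [Cmd.width, max_le_iff] at hB
    obtain ⟨s₁, r₁, h₁, hh⟩ := Cond.prepare_runs hW hs hb
    obtain ⟨s₂, t₂, r₂, h₂, le₂⟩ := ih hB.2.2 s₁ h₁
    exact ⟨_, _, Runs.seq r₁ (Runs.branch_false (fun h => hc (hh.1 h)) r₂), h₂,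
      by rw [mul_add]; omega⟩
  | whl_done hb hc =>
    intro hB s hs
    simp only [Cmd.width, max_le_iff] at hB
    obtain ⟨s₁, r₁, h₁, hh⟩ := Cond.prepare_runs hW hs hb
    exact ⟨_, _, Runs.seq r₁ (Runs.loop_done (fun h => hc (hh.1 h))), h₁, by omega⟩
  | whl_step hb hc _ _ ih₁ ih₂ =>
    intro hB s hs
    have hB' := hB
    simp only [Cmd.width, max_le_iff] at hB'
    obtain ⟨s₁, r₁, h₁, hh⟩ := Cond.prepare_runs hW hs hb
    obtain ⟨s₂, t₂, r₂, h₂, le₂⟩ := ih₁ hB'.2 s₁ h₁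
    obtain ⟨s₃, t₃, r₃, h₃, le₃⟩ := ih₂ hB s₂ h₂
    -- The compiled remaining loop starts by evaluating the condition. That piece becomes the end of
    -- the current loop body, and the rest is the remaining machine loop.
    cases r₃ with
    | seq q₁ q₂ =>
      refine ⟨_, _, Runs.seq r₁ (Runs.loop_step (hh.2 hc) (Runs.seq r₂ q₁) q₂), h₃, ?_⟩
      rw [mul_add, mul_add]
      omega

/-! ### Weakest preconditions with a clock -/

/-- Started in `σ` at time `t`, the command `p` halts, at a time and in a state that satisfy
`Q`. -/
def WP (A N W : ℕ) (p : Cmd) (σ : St) (t : ℕ) (Q : ℕ → St → Prop) : Prop :=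
  ∃ s τ, Exec A N W p σ s τ ∧ Q (t + s) τ

theorem WP.mono {p : Cmd} {σ : St} {t : ℕ} {Q Q' : ℕ → St → Prop} (h : WP A N W p σ t Q)
    (hQ : ∀ s τ, Q s τ → Q' s τ) : WP A N W p σ t Q' := by
  obtain ⟨s, τ, he, hq⟩ := h
  exact ⟨s, τ, he, hQ _ _ hq⟩

-- This rule and those for the other loop-free commands are equivalences, so `simp` can execute such
-- code symbolically.
@[simp] theorem WP_set {x : ℕ} {e : Exp} {σ : St} {t : ℕ} {Q : ℕ → St → Prop} :
    WP A N W (.set x e) σ t Q ↔ e.Ok A N W σ ∧ Q (t + 1) (σ.setv x (e.eval σ)) := by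
  constructor
  · rintro ⟨s, τ, h, hQ⟩
    cases h with | set he => exact ⟨he, hQ⟩
  · rintro ⟨he, hQ⟩
    exact ⟨1, _, .set he, hQ⟩

@[simp] theorem WP_put {k : ℕ} {i e : Exp} {σ : St} {t : ℕ} {Q : ℕ → St → Prop} :
    WP A N W (.put k i e) σ t Q ↔ k < A ∧ i.Ok A N W σ ∧ i.eval σ < N ∧ e.Ok A N W σ ∧
      Q (t + 1) (σ.seta k (i.eval σ) (e.eval σ)) := by
  constructor
  · rintro ⟨s, τ, h, hQ⟩
    cases h with | put hk hi hN he => exact ⟨hk, hi, hN, he, hQ⟩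
  · rintro ⟨hk, hi, hN, he, hQ⟩
    exact ⟨1, _, .put hk hi hN he, hQ⟩

@[simp] theorem WP_seq {p q : Cmd} {σ : St} {t : ℕ} {Q : ℕ → St → Prop} :
    WP A N W (.seq p q) σ t Q ↔ WP A N W p σ t (fun s τ => WP A N W q τ s Q) := by
  constructor
  · rintro ⟨s, τ, h, hQ⟩
    cases h with | seq h₁ h₂ => exact ⟨_, _, h₁, _, _, h₂, by rwa [Nat.add_assoc]⟩
  · rintro ⟨s₁, τ₁, h₁, s₂, τ₂, h₂, hQ⟩
    exact ⟨_, _, .seq h₁ h₂, by rwa [← Nat.add_assoc]⟩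

@[simp] theorem WP_ite {b : Cond} {p q : Cmd} {σ : St} {t : ℕ} {Q : ℕ → St → Prop} :
    WP A N W (.ite b p q) σ t Q ↔ b.Ok A N W σ ∧ (b.Holds σ → WP A N W p σ (t + 1) Q) ∧
      (¬ b.Holds σ → WP A N W q σ (t + 1) Q) := by
  constructor
  · rintro ⟨s, τ, h, hQ⟩
    cases h with
    | ite_true hb hc hp => exact ⟨hb, fun _ => ⟨_, _, hp, by rwa [Nat.add_assoc]⟩, fun h => absurd hc h⟩
    | ite_false hb hc hp => exact ⟨hb, fun h => absurd h hc, fun _ => ⟨_, _, hp, by rwa [Nat.add_assoc]⟩⟩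
  · rintro ⟨hb, h₁, h₂⟩
    by_cases hc : b.Holds σ
    · obtain ⟨s, τ, h, hQ⟩ := h₁ hc
      exact ⟨_, _, .ite_true hb hc h, by rwa [← Nat.add_assoc]⟩
    · obtain ⟨s, τ, h, hQ⟩ := h₂ hc
      exact ⟨_, _, .ite_false hb hc h, by rwa [← Nat.add_assoc]⟩

/-- A loop with the invariant `I`, whose first argument bounds the remaining running time. -/
theorem WP_whl (I : ℕ → St → Prop) (φ : ℕ) {b : Cond} {p : Cmd} {σ : St} {t : ℕ}
    {Q : ℕ → St → Prop} (h₀ : I φ σ) (hok : ∀ φ σ, I φ σ → b.Ok A N W σ)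
    (step : ∀ φ σ, I φ σ → b.Holds σ →
      WP A N W p σ 1 (fun s τ => ∃ ψ, I ψ τ ∧ ψ + s ≤ φ))
    (post : ∀ ψ s τ, I ψ τ → ¬ b.Holds τ → s + ψ ≤ t + φ + 1 → Q s τ) :
    WP A N W (.whl b p) σ t Q := by
  have key : ∀ φ σ, I φ σ → ∃ s τ ψ, Exec A N W (.whl b p) σ s τ ∧ I ψ τ ∧ ¬ b.Holds τ ∧
      s + ψ ≤ φ + 1 := by
    intro φ
    induction φ using Nat.strong_induction_on with
    | _ φ ih =>
      intro σ hI
      by_cases hc : b.Holds σ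
      · obtain ⟨s, τ, he, ψ, hψ, hle⟩ := step φ σ hI hc
        -- The clock of the body starts at 1, for the test, so `ψ < φ` and the induction applies.
        obtain ⟨s', τ', ψ', he', hI', hc', hle'⟩ := ih ψ (by omega) τ hψ
        exact ⟨_, τ', ψ', .whl_step (hok _ _ hI) hc he he', hI', hc', by omega⟩
      · exact ⟨1, σ, φ, .whl_done (hok _ _ hI) hc, hI, hc, by omega⟩
  obtain ⟨s, τ, ψ, he, hI, hc, hle⟩ := key φ σ h₀
  exact ⟨s, τ, he, post ψ _ τ hI hc (by omega)⟩

end ArrayLang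

/-! ### Memory layout and the initial state -/

namespace ArrayLang

open WordRAM

/-- Compute the addresses of the arrays `0, …, k` of length `r_2`. -/
def bases : ℕ → Prog
  | 0 => .const 1 0
  | k + 1 => .seq (bases k) (.add (3 * (k + 1) + 1) (3 * k + 1) 2)

/-- Set up `k + 1` arrays of length `2 (n + m) + 2`, where `n` and `m` are the first two words of
the input. -/
def setup (k : ℕ) : Prog :=
  .seq (.const 2 0) (.seq (.load 2 2) (.seq (.const 5 1) (.seq (.load 5 5)
    (.seq (.add 2 2 5) (.seq (.add 2 2 2) (.seq (.const 5 2) (.seq (.add 2 2 5) (bases k))))))))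

/-- The state in which the array `0` holds the input. -/
def inputState (input : List ℕ) : St where
  v := fun _ => 0
  a := fun k i => if k = 0 then input.getD i 0 else 0

theorem bases_runs {W N k : ℕ} (hW : (k + 1) * N ≤ W) (s : State) (hs : s.reg 2 = N) :
    ∃ s', Runs W (bases k) s (k + 1) s' ∧ s'.mem = s.mem ∧ s'.reg 2 = N ∧
      (∀ x, s'.reg (3 * x) = s.reg (3 * x)) ∧ ∀ l ≤ k, s'.reg (3 * l + 1) = l * N := by
  induction k with
  | zero =>
    refine ⟨_, Runs.const s 1 0 (Nat.zero_le _), rfl, by simp [State.setReg, hs], ?_, ?_⟩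
    · intro x
      have : 3 * x ≠ 1 := by omega
      simp [State.setReg, this]
    · intro l hl
      obtain rfl : l = 0 := by omega
      simp [State.setReg]
  | succ k ih =>
    have hk : (k + 1) * N ≤ W := le_trans (Nat.mul_le_mul_right N (by omega)) hW
    obtain ⟨s₁, r₁, m₁, n₁, v₁, b₁⟩ := ih hk
    have hb : s₁.reg (3 * k + 1) + s₁.reg 2 = (k + 1) * N := by
      rw [b₁ k le_rfl, n₁]; ring
    have r₂ := Runs.add (W := W) s₁ (3 * (k + 1) + 1) (3 * k + 1) 2 (by omega)
    rw [hb] at r₂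
    refine ⟨_, Runs.seq r₁ r₂, m₁, ?_, ?_, ?_⟩
    · have : 2 ≠ 3 * (k + 1) + 1 := by omega
      simp [State.setReg, n₁]
    · intro x
      have : 3 * x ≠ 3 * (k + 1) + 1 := by omega
      simp [State.setReg, Function.update_of_ne this, v₁]
    · intro l hl
      by_cases hlk : l = k + 1
      · subst hlk
        simp [State.setReg]
      · have : 3 * l + 1 ≠ 3 * (k + 1) + 1 := by omega
        simp only [State.setReg, Function.update_of_ne this]
        exact b₁ l (by omega)

theorem setup_runs {W n m k : ℕ} {input : List ℕ} (h₀ : input.getD 0 0 = n)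
    (h₁ : input.getD 1 0 = m) (hlen : input.length ≤ 2 * (n + m) + 2)
    (hin : ∀ i, input.getD i 0 ≤ W) (hW : (k + 1) * (2 * (n + m) + 2) ≤ W) :
    ∃ s', Runs W (setup k) (initialState input) (k + 9) s' ∧
      Sim (k + 1) (2 * (n + m) + 2) W (inputState input) s' := by
  have hW' : 2 * (n + m) + 2 ≤ W := le_trans (Nat.le_mul_of_pos_left _ (Nat.succ_pos k)) hW
  have hn := hin 0
  have hm := hin 1
  rw [h₀] at hn
  rw [h₁] at hm
  let s₀ := initialState input
  let s₁ := s₀.setReg 2 0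
  let s₂ := s₁.setReg 2 n
  let s₃ := s₂.setReg 5 1
  let s₄ := s₃.setReg 5 m
  let s₅ := s₄.setReg 2 (n + m)
  let s₆ := s₅.setReg 2 (n + m + (n + m))
  let s₇ := s₆.setReg 5 2
  let s₈ := s₇.setReg 2 (n + m + (n + m) + 2)
  have r₁ : Runs W (.const 2 0) s₀ 1 s₁ := Runs.const _ _ _ (Nat.zero_le _)
  have r₂ : Runs W (.load 2 2) s₁ 1 s₂ := by
    have := Runs.load (W := W) s₁ 2 2 (by simp [s₁, State.setReg])
      (by simpa [s₁, s₀, State.setReg, initialState] using hin 0)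
    simpa [s₂, s₁, s₀, State.setReg, initialState, ← h₀] using this
  have r₃ : Runs W (.const 5 1) s₂ 1 s₃ := Runs.const _ _ _ (by omega)
  have r₄ : Runs W (.load 5 5) s₃ 1 s₄ := by
    have := Runs.load (W := W) s₃ 5 5 (by simp [s₃, State.setReg]; omega)
      (by simpa [s₃, s₂, s₁, s₀, State.setReg, initialState] using hin 1)
    simpa [s₄, s₃, s₂, s₁, s₀, State.setReg, initialState, ← h₁] using this
  have r₅ : Runs W (.add 2 2 5) s₄ 1 s₅ := by
    have := Runs.add (W := W) s₄ 2 2 5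
      (by simp [s₄, s₃, s₂, State.setReg]; omega)
    simpa [s₅, s₄, s₃, s₂, State.setReg, Function.update_apply] using this
  have r₆ : Runs W (.add 2 2 2) s₅ 1 s₆ := by
    have := Runs.add (W := W) s₅ 2 2 2 (by simp [s₅, State.setReg]; omega)
    simpa [s₆, s₅, State.setReg] using this
  have r₇ : Runs W (.const 5 2) s₆ 1 s₇ := Runs.const _ _ _ (by omega)
  have r₈ : Runs W (.add 2 2 5) s₇ 1 s₈ := by
    have := Runs.add (W := W) s₇ 2 2 5
      (by simp [s₇, s₆, State.setReg]; omega)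
    simpa [s₈, s₇, s₆, State.setReg, Function.update_apply] using this
  obtain ⟨s, r, hm, -, hv, hb⟩ := bases_runs (N := 2 * (n + m) + 2) hW s₈
    (by simp [s₈, State.setReg]; ring)
  refine ⟨s, ?_, ?_, ?_, ?_, ?_, ?_⟩
  · rw [show k + 9 = 1 + (1 + (1 + (1 + (1 + (1 + (1 + (1 + (k + 1)))))))) by omega]
    exact Runs.seq r₁ (Runs.seq r₂ (Runs.seq r₃ (Runs.seq r₄ (Runs.seq r₅ (Runs.seq r₆
      (Runs.seq r₇ (Runs.seq r₈ r)))))))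
  · intro x
    have e₂ : 3 * x ≠ 2 := by omega
    have e₅ : 3 * x ≠ 5 := by omega
    simp [hv, s₈, s₇, s₆, s₅, s₄, s₃, s₂, s₁, s₀, State.setReg, Function.update_of_ne e₂,
      Function.update_of_ne e₅, initialState, inputState]
  · intro x
    simp [inputState]
  · intro l hl
    exact hb l (by omega)
  · intro l _ i hi
    rw [hm]
    change input.getD (l * (2 * (n + m) + 2) + i) 0 = _
    -- Array 0 starts at address 0, so the input is already in place; the other arrays lie behind
    -- the input and hold zeros.
    rcases Nat.eq_zero_or_pos l with rfl | hl
    · simp [inputState]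
    · have : 2 * (n + m) + 2 ≤ l * (2 * (n + m) + 2) := Nat.le_mul_of_pos_left _ hl
      rw [List.getD_eq_default _ _ (by omega)]
      simp [inputState, hl.ne']
  · intro l _ i _
    simp only [inputState]
    split
    · exact hin i
    · exact Nat.zero_le _

end ArrayLang

/-! ### Undirected unit-capacity networks, cuts and layers -/

-- Averaging: some term is at most the mean.
open Finset in
theorem Finset.exists_card_mul_le_sum {D S : ℕ} (hD : 1 ≤ D) (f : ℕ → ℕ)
    (h : ∑ j ∈ Icc 1 D, f j ≤ S) : ∃ j ∈ Icc 1 D, D * f j ≤ S := by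
  apply exists_le_of_sum_le (s := Icc 1 D) ⟨1, by simp [hD]⟩
  rw [← mul_sum]
  simpa using Nat.mul_le_mul_left D h

-- Double counting: `g h` is the only `j` for which `h` can be counted.
open Finset in
theorem Finset.sum_card_filter_le {D : ℕ} (s : Finset ℕ) (p : ℕ → ℕ → Prop)
    [∀ j, DecidablePred (p j)] (g : ℕ → ℕ) (hg : ∀ j h, p j h → g h = j) :
    ∑ j ∈ Icc 1 D, #{h ∈ s | p j h} ≤ #s := by
  simp_rw [card_filter]
  rw [sum_comm, card_eq_sum_ones]
  refine sum_le_sum fun h _ => ?_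
  calc ∑ j ∈ Icc 1 D, (if p j h then 1 else 0)
      ≤ ∑ j ∈ Icc 1 D, (if g h = j then 1 else 0) := by
        refine sum_le_sum fun j _ => ?_
        by_cases hp : p j h
        · simp [hp, hg j h hp]
        · simp [hp]
    _ ≤ 1 := by
        rw [sum_ite_eq]
        split <;> simp

/-- An undirected graph on the vertices below `n`, each edge of which is a pair of arcs with numbers
in `1, …, M`. The arc `h` enters the vertex `hd h`, and `mate h` is the opposite arc. The arcs that
leave `v` form a linked list `first v, nxt (first v), …` that ends with `0`. Vertices of colour `1`
are the sources, vertices of colour `2` the sinks. -/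
structure Network where
  n : ℕ
  M : ℕ
  hd : ℕ → ℕ
  mate : ℕ → ℕ
  nxt : ℕ → ℕ
  first : ℕ → ℕ
  col : ℕ → ℕ

namespace Network

variable (𝒩 : Network)

/-- `h` is the number of an arc. -/
def Arc (h : ℕ) : Prop := h ≠ 0 ∧ h ≤ 𝒩.M

/-- The vertex that an arc leaves. -/
def tail (h : ℕ) : ℕ := 𝒩.hd (𝒩.mate h)

/-- The data form a simple graph; the linked lists have decreasing arc numbers. -/
structure WF : Prop where
  hd_lt : ∀ h, 𝒩.Arc h → 𝒩.hd h < 𝒩.n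
  mate_arc : ∀ h, 𝒩.Arc h → 𝒩.Arc (𝒩.mate h)
  mate_mate : ∀ h, 𝒩.Arc h → 𝒩.mate (𝒩.mate h) = h
  mate_ne : ∀ h, 𝒩.Arc h → 𝒩.mate h ≠ h
  tail_ne : ∀ h, 𝒩.Arc h → 𝒩.tail h ≠ 𝒩.hd h
  inj : ∀ h h', 𝒩.Arc h → 𝒩.Arc h' → 𝒩.tail h = 𝒩.tail h' → 𝒩.hd h = 𝒩.hd h' → h = h'
  first_le : ∀ v, 𝒩.first v ≤ 𝒩.M
  first_tail : ∀ v, 𝒩.first v ≠ 0 → 𝒩.tail (𝒩.first v) = v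
  le_first : ∀ h, 𝒩.Arc h → h ≤ 𝒩.first (𝒩.tail h)
  nxt_lt : ∀ h, 𝒩.Arc h → 𝒩.nxt h < h
  nxt_tail : ∀ h, 𝒩.Arc h → 𝒩.nxt h ≠ 0 → 𝒩.tail (𝒩.nxt h) = 𝒩.tail h
  le_nxt : ∀ h h', 𝒩.Arc h → 𝒩.Arc h' → h' < h → 𝒩.tail h' = 𝒩.tail h → h' ≤ 𝒩.nxt h

/-- The sum of the values of `r` on all arcs, with weights `w`. -/
def weight (w r : ℕ → ℕ) : ℕ := ∑ h ∈ Finset.Icc 1 𝒩.M, w h * r h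

/-- Residual capacities after one unit has been pushed along the arc `c`. -/
def push (r : ℕ → ℕ) (c : ℕ) : ℕ → ℕ :=
  Function.update (Function.update r c (r c - 1)) (𝒩.mate c) (r (𝒩.mate c) + 1)

/-- Opposite residual capacities have the sum `2`. -/
def Paired (r : ℕ → ℕ) : Prop := ∀ h, 𝒩.Arc h → r h + r (𝒩.mate h) = 2

open Classical in
/-- The total capacity of the arcs that leave the set `U`. -/
noncomputable def cut (r : ℕ → ℕ) (U : ℕ → Prop) : ℕ :=
  𝒩.weight (fun h => if U (𝒩.tail h) ∧ ¬ U (𝒩.hd h) then 1 else 0) r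

/-- The set `U` separates the sources from the sinks. -/
def Sep (U : ℕ → Prop) : Prop :=
  ∀ h, 𝒩.Arc h → (𝒩.col (𝒩.hd h) = 1 → U (𝒩.hd h)) ∧ (𝒩.col (𝒩.hd h) = 2 → ¬ U (𝒩.hd h))

/-- `d` is a valid distance labelling (up to a shift by `1`; the label `0` is for infinity). -/
def Valid (d r : ℕ → ℕ) : Prop := ∀ h, 𝒩.Arc h → r h ≠ 0 → d (𝒩.hd h) ≠ 0 →
  d (𝒩.tail h) ≠ 0 ∧ d (𝒩.tail h) ≤ d (𝒩.hd h) + 1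

/-- Exactly the sinks have the label `1`, and every other finite label is supported by a residual
arc to a vertex with a smaller label. -/
structure Supp (d r : ℕ → ℕ) : Prop where
  sink : ∀ h, 𝒩.Arc h → (d (𝒩.hd h) = 1 ↔ 𝒩.col (𝒩.hd h) = 2)
  arc : ∀ h, 𝒩.Arc h → 1 < d (𝒩.hd h) → ∃ h', 𝒩.Arc h' ∧ 𝒩.tail h' = 𝒩.hd h ∧ r h' ≠ 0 ∧
    d (𝒩.hd h') + 1 = d (𝒩.hd h)

variable {𝒩}

theorem mem_Icc_iff_arc {h : ℕ} : h ∈ Finset.Icc 1 𝒩.M ↔ 𝒩.Arc h := by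
  simp only [Finset.mem_Icc, Arc]
  omega

theorem hd_mate (h : ℕ) : 𝒩.hd (𝒩.mate h) = 𝒩.tail h := rfl

theorem WF.tail_mate (wf : 𝒩.WF) {h : ℕ} (hh : 𝒩.Arc h) : 𝒩.tail (𝒩.mate h) = 𝒩.hd h := by
  rw [tail, wf.mate_mate h hh]

theorem WF.tail_lt (wf : 𝒩.WF) {h : ℕ} (hh : 𝒩.Arc h) : 𝒩.tail h < 𝒩.n :=
  wf.hd_lt _ (wf.mate_arc h hh)

/-! ### The effect of a push on weights and cuts -/

theorem sum_mul_update {s : Finset ℕ} (w r : ℕ → ℕ) {c : ℕ} (hc : c ∈ s) (y : ℕ) :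
    ∑ h ∈ s, w h * Function.update r c y h + w c * r c = ∑ h ∈ s, w h * r h + w c * y := by
  rw [← Finset.add_sum_erase s _ hc, ← Finset.add_sum_erase s (fun h => w h * r h) hc]
  have : ∑ h ∈ s.erase c, w h * Function.update r c y h = ∑ h ∈ s.erase c, w h * r h :=
    Finset.sum_congr rfl fun h hh => by
      rw [Function.update_of_ne (Finset.ne_of_mem_erase hh)]
  rw [this, Function.update_self]
  ring

/-- One unit of capacity moves from `c` to its mate. Written additively to avoid truncated
subtraction; used with indicator weights, for cuts and for the potential of the search. -/
theorem WF.weight_push (wf : 𝒩.WF) (w : ℕ → ℕ) {r : ℕ → ℕ} {c : ℕ} (hc : 𝒩.Arc c)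
    (hr : r c ≠ 0) : 𝒩.weight w (𝒩.push r c) + w c = 𝒩.weight w r + w (𝒩.mate c) := by
  have h₁ := sum_mul_update w r (mem_Icc_iff_arc.2 hc) (r c - 1)
  have h₂ := sum_mul_update w (Function.update r c (r c - 1))
    (mem_Icc_iff_arc.2 (wf.mate_arc c hc)) (r (𝒩.mate c) + 1)
  rw [Function.update_of_ne (wf.mate_ne c hc)] at h₂
  obtain ⟨x, hx⟩ := Nat.exists_eq_succ_of_ne_zero hr
  rw [weight, weight, push]
  rw [hx, Nat.succ_sub_one] at h₁ h₂
  rw [hx, Nat.succ_sub_one]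
  simp only [Nat.succ_eq_add_one, mul_add, mul_one] at h₁ h₂
  omega

theorem push_self (wf : 𝒩.WF) {r : ℕ → ℕ} {c : ℕ} (hc : 𝒩.Arc c) :
    𝒩.push r c c = r c - 1 := by
  simp [push, Function.update_of_ne (wf.mate_ne c hc).symm]

theorem push_mate {r : ℕ → ℕ} {c : ℕ} : 𝒩.push r c (𝒩.mate c) = r (𝒩.mate c) + 1 := by
  simp [push]

theorem push_of_ne {r : ℕ → ℕ} {c h : ℕ} (h₁ : h ≠ c) (h₂ : h ≠ 𝒩.mate c) :
    𝒩.push r c h = r h := by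
  simp [push, h₁, h₂]

theorem WF.mate_inj (wf : 𝒩.WF) {h h' : ℕ} (hh : 𝒩.Arc h) (hh' : 𝒩.Arc h')
    (e : 𝒩.mate h = 𝒩.mate h') : h = h' := by
  rw [← wf.mate_mate h hh, e, wf.mate_mate h' hh']

theorem WF.paired_push (wf : 𝒩.WF) {r : ℕ → ℕ} (hr : 𝒩.Paired r) {c : ℕ} (hc : 𝒩.Arc c)
    (h0 : r c ≠ 0) : 𝒩.Paired (𝒩.push r c) := by
  intro h hh
  have hp := hr h hh
  by_cases h1 : h = c
  · subst h1
    rw [push_self wf hc, push_mate]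
    omega
  by_cases h2 : h = 𝒩.mate c
  · subst h2
    rw [wf.mate_mate c hc] at hp ⊢
    rw [push_self wf hc, push_mate]
    omega
  · rw [push_of_ne h1 h2, push_of_ne, hp]
    · intro e
      exact h2 (by rw [← e, wf.mate_mate h hh])
    · intro e
      exact h1 (wf.mate_inj hh hc e)

-- Conservation law: the capacity of the cut plus one for a unit outside `U` does not change when
-- that unit moves from the tail of `c` to its head. All optimality arguments rest on this.
open Classical in
theorem WF.cut_push (wf : 𝒩.WF) {r : ℕ → ℕ} {c : ℕ} (hc : 𝒩.Arc c) (hr : r c ≠ 0)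
    (U : ℕ → Prop) : 𝒩.cut (𝒩.push r c) U + (if U (𝒩.hd c) then 0 else 1) =
      𝒩.cut r U + (if U (𝒩.tail c) then 0 else 1) := by
  have := wf.weight_push (fun h => if U (𝒩.tail h) ∧ ¬ U (𝒩.hd h) then 1 else 0) hc hr
  simp only [wf.tail_mate hc, hd_mate] at this
  simp only [cut]
  by_cases h₁ : U (𝒩.tail c) <;> by_cases h₂ : U (𝒩.hd c) <;> simp [h₁, h₂] at this ⊢ <;> omega

/-! ### Small cuts between distance layers -/

/-- The set of the vertices with labels above `j`. -/
def above (d : ℕ → ℕ) (j : ℕ) (v : ℕ) : Prop := d v = 0 ∨ j < d v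

theorem sep_above {d : ℕ → ℕ} {D j : ℕ} (hj : 1 ≤ j) (hjD : j ≤ D)
    (hsink : ∀ h, 𝒩.Arc h → 𝒩.col (𝒩.hd h) = 2 → d (𝒩.hd h) = 1)
    (hsrc : ∀ h, 𝒩.Arc h → 𝒩.col (𝒩.hd h) = 1 → d (𝒩.hd h) ≠ 0 → D < d (𝒩.hd h)) :
    𝒩.Sep (above d j) := by
  intro h hh
  constructor
  · intro hc
    by_cases h0 : d (𝒩.hd h) = 0
    · exact Or.inl h0
    · exact Or.inr (hjD.trans_lt (hsrc h hh hc h0))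
  · intro hc
    simp [above, hsink h hh hc]
    omega

-- By validity a residual arc decreases the label by at most one, so it can leave the set only from
-- layer `j + 1` to layer `j`; its residual capacity is at most 2 because opposite capacities have
-- the sum 2.
open Finset in
theorem cut_above_le {d r : ℕ → ℕ} (hr : 𝒩.Paired r) (hv : 𝒩.Valid d r) (j : ℕ) :
    𝒩.cut r (above d j) ≤
      2 * #{h ∈ Icc 1 𝒩.M | d (𝒩.hd h) = j ∧ d (𝒩.tail h) = j + 1} := by
  classical
  rw [card_filter, mul_sum, cut, weight]
  refine sum_le_sum fun h hh => ?_
  have hh := mem_Icc_iff_arc.1 hh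
  have hp := hr h hh
  by_cases hU : above d j (𝒩.tail h) ∧ ¬ above d j (𝒩.hd h)
  · rw [if_pos hU]
    by_cases h0 : r h = 0
    · simp [h0]
    · obtain ⟨h₁, h₂⟩ := hU
      simp only [above, not_or, not_lt] at h₁ h₂
      obtain ⟨h₃, h₄⟩ := hv h hh h0 h₂.1
      rw [if_pos (by omega)]
      omega
  · rw [if_neg hU]
    simp

/-- If the sources have labels above `D` then some cut has capacity at most `2 M / D`. -/
theorem exists_cut_le_arcs {d r : ℕ → ℕ} {D : ℕ} (hr : 𝒩.Paired r) (hv : 𝒩.Valid d r)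
    (hD : 1 ≤ D) (hsink : ∀ h, 𝒩.Arc h → 𝒩.col (𝒩.hd h) = 2 → d (𝒩.hd h) = 1)
    (hsrc : ∀ h, 𝒩.Arc h → 𝒩.col (𝒩.hd h) = 1 → d (𝒩.hd h) ≠ 0 → D < d (𝒩.hd h)) :
    ∃ U, 𝒩.Sep U ∧ D * 𝒩.cut r U ≤ 2 * 𝒩.M := by
  have hs := Finset.sum_card_filter_le (D := D) (Finset.Icc 1 𝒩.M)
    (fun j h => d (𝒩.hd h) = j ∧ d (𝒩.tail h) = j + 1) (fun h => d (𝒩.hd h)) (fun j h hp => hp.1)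
  obtain ⟨j, hj, hle⟩ := Finset.exists_card_mul_le_sum hD _ hs
  rw [Finset.mem_Icc] at hj
  refine ⟨above d j, sep_above hj.1 hj.2 hsink hsrc, ?_⟩
  have := Nat.mul_le_mul_left D (cut_above_le hr hv j)
  rw [Nat.card_Icc] at hle
  rw [Nat.mul_left_comm] at this
  omega

open Finset in
/-- If the sources have labels above `D` then some cut has capacity at most `8 n ^ 2 / D ^ 2`. -/
theorem exists_cut_le_vertices {d r : ℕ → ℕ} {D : ℕ} (wf : 𝒩.WF) (hr : 𝒩.Paired r)
    (hv : 𝒩.Valid d r) (hD : 1 ≤ D)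
    (hsink : ∀ h, 𝒩.Arc h → 𝒩.col (𝒩.hd h) = 2 → d (𝒩.hd h) = 1)
    (hsrc : ∀ h, 𝒩.Arc h → 𝒩.col (𝒩.hd h) = 1 → d (𝒩.hd h) ≠ 0 → D < d (𝒩.hd h)) :
    ∃ U, 𝒩.Sep U ∧ D ^ 2 * 𝒩.cut r U ≤ 8 * 𝒩.n ^ 2 := by
  have hs₁ := sum_card_filter_le (D := D) (range 𝒩.n) (fun j v => d v = j) d (fun j v hp => hp)
  -- Layer `j + 1` is counted under the index `j`. Adding both counts gives two consecutive layers
  -- that are small simultaneously.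
  have hs₂ := sum_card_filter_le (D := D) (range 𝒩.n) (fun j v => d v = j + 1)
    (fun v => d v - 1) (fun j v hp => by omega)
  have hs := Nat.add_le_add hs₁ hs₂
  rw [← sum_add_distrib, card_range] at hs
  obtain ⟨j, hj, hle⟩ := exists_card_mul_le_sum hD _ hs
  rw [mem_Icc] at hj
  refine ⟨above d j, sep_above hj.1 hj.2 hsink hsrc, ?_⟩
  have hcut := cut_above_le hr hv j
  set a := #{v ∈ range 𝒩.n | d v = j} with ha
  set b := #{v ∈ range 𝒩.n | d v = j + 1} with hb
  -- In a simple graph an arc is determined by its ends, so there are at most `a * b` arcs between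
  -- layers of sizes `a` and `b`.
  have hab : #{h ∈ Icc 1 𝒩.M | d (𝒩.hd h) = j ∧ d (𝒩.tail h) = j + 1} ≤ a * b := by
    rw [ha, hb, ← card_product]
    refine card_le_card_of_injOn (fun h => (𝒩.hd h, 𝒩.tail h)) ?_ ?_
    · intro h hh
      simp only [coe_filter, Set.mem_ofPred_eq, mem_Icc_iff_arc] at hh
      simp [wf.hd_lt h hh.1, wf.tail_lt hh.1, hh.2]
    · intro h hh h' hh' e
      simp only [coe_filter, Set.mem_ofPred_eq, mem_Icc_iff_arc] at hh hh'
      simp only [Prod.mk.injEq] at e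
      exact wf.inj h h' hh.1 hh'.1 e.2 e.1
  have h₁ : D * a ≤ 2 * 𝒩.n := by rw [mul_add] at hle; omega
  have h₂ : D * b ≤ 2 * 𝒩.n := by rw [mul_add] at hle; omega
  calc D ^ 2 * 𝒩.cut r (above d j) ≤ D ^ 2 * (2 * (a * b)) := by
        refine Nat.mul_le_mul_left _ (hcut.trans (by omega))
    _ = 2 * ((D * a) * (D * b)) := by ring
    _ ≤ 2 * ((2 * 𝒩.n) * (2 * 𝒩.n)) := Nat.mul_le_mul_left _ (Nat.mul_le_mul h₁ h₂)
    _ = 8 * 𝒩.n ^ 2 := by ring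

end Network

/-! ### The depth-first search of a phase -/

namespace Network

variable (𝒩 : Network)

/-- `v` is a vertex that is not isolated. -/
def Vert (v : ℕ) : Prop := ∃ h, 𝒩.Arc h ∧ 𝒩.hd h = v

/-- The arc `h` decreases the label by `1`. -/
def Dec (d : ℕ → ℕ) (h : ℕ) : Prop := d (𝒩.tail h) = d (𝒩.hd h) + 1

/-- The number of the arcs that are not yet scanned, if `cur v` is the arc to be scanned next at the
vertex `v`. -/
def unscanned (cur : ℕ → ℕ) : ℕ := ((Finset.Icc 1 𝒩.M).filter fun h => h ≤ cur (𝒩.tail h)).card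

/-- The pointers `cur` point into the lists of outgoing arcs. -/
def CurOk (cur : ℕ → ℕ) : Prop :=
  ∀ v, 𝒩.Vert v → cur v ≠ 0 → 𝒩.Arc (cur v) ∧ 𝒩.tail (cur v) = v

/-- The arcs on the path of the token at `u` from the source `home`: `pv j` is the vertex with the
label `j` on the path. -/
def OnPath (d cur pv : ℕ → ℕ) (home u h : ℕ) : Prop :=
  ∃ j, d u < j ∧ j ≤ d home ∧ h = cur (pv j)

open Classical in
/-- The invariant of the search, for the labels `d`, the residual capacities `r` and the scan
pointers `cur`. So far `δ` units have reached the sinks. At the start of the phase the residual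
capacities were `r₀`, and `δ₀` units had reached the sinks. The arcs in `on` hold a unit that has
not reached a sink, and that unit is outside `U` if `out U`. -/
structure Dfs (d r₀ : ℕ → ℕ) (δ₀ : ℕ) (cap : (ℕ → Prop) → ℕ) (r cur : ℕ → ℕ) (δ : ℕ)
    (on : ℕ → Prop) (out : (ℕ → Prop) → Prop) : Prop where
  paired : 𝒩.Paired r
  valid : 𝒩.Valid d r
  cutEq : ∀ U, 𝒩.Sep U → 𝒩.cut r U + δ + (if out U then 1 else 0) = cap U
  le : δ₀ ≤ δ
  track : δ = δ₀ → ∀ h, 𝒩.Arc h → 𝒩.Dec d h → r h + (if on h then 1 else 0) = r₀ h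
  curOk : 𝒩.CurOk cur
  scanned : ∀ h, 𝒩.Arc h → cur (𝒩.tail h) < h → r h = 0 ∨ ¬ 𝒩.Dec d h ∨ cur (𝒩.hd h) = 0
  sink : ∀ v, 𝒩.Vert v → 𝒩.col v = 2 → cur v ≠ 0

/-- The token at `u` has come from the source `home` along the vertices `pv j`. -/
structure Token (d r cur pv : ℕ → ℕ) (home u : ℕ) : Prop where
  vert_home : 𝒩.Vert home
  vert : 𝒩.Vert u
  le : d u ≤ d home
  ne : d u < d home → d u ≠ 0
  eq : d u = d home → u = home
  top : d u < d home → pv (d home) = home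
  path : ∀ j, d u < j → j ≤ d home → 𝒩.Vert (pv j) ∧ d (pv j) = j ∧ cur (pv j) ≠ 0 ∧
    r (cur (pv j)) ≤ 1 ∧ 𝒩.hd (cur (pv j)) = if j = d u + 1 then u else pv (j - 1)

variable {𝒩}

theorem vert_hd {h : ℕ} (hh : 𝒩.Arc h) : 𝒩.Vert (𝒩.hd h) := ⟨h, hh, rfl⟩

theorem WF.vert_tail (wf : 𝒩.WF) {h : ℕ} (hh : 𝒩.Arc h) : 𝒩.Vert (𝒩.tail h) :=
  ⟨_, wf.mate_arc h hh, rfl⟩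

theorem WF.vert_lt (wf : 𝒩.WF) {v : ℕ} (hv : 𝒩.Vert v) : v < 𝒩.n := by
  obtain ⟨h, hh, rfl⟩ := hv
  exact wf.hd_lt h hh

theorem WF.curOk_next (wf : 𝒩.WF) {cur : ℕ → ℕ} (hc : 𝒩.CurOk cur) {v : ℕ} (hv : 𝒩.Vert v)
    (h0 : cur v ≠ 0) : 𝒩.CurOk (Function.update cur v (𝒩.nxt (cur v))) := by
  obtain ⟨h₁, h₂⟩ := hc v hv h0
  intro w hw hw0
  by_cases hwv : w = v
  · subst hwv
    rw [Function.update_self] at hw0 ⊢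
    have := wf.nxt_lt _ h₁
    have hM := h₁.2
    exact ⟨⟨hw0, by omega⟩, by rw [wf.nxt_tail _ h₁ hw0, h₂]⟩
  · rw [Function.update_of_ne hwv] at hw0 ⊢
    exact hc w hw hw0

/-- After `cur v` has moved on, only one more arc is scanned. -/
theorem WF.lt_of_next_lt (wf : 𝒩.WF) {cur : ℕ → ℕ} (hc : 𝒩.CurOk cur) {v : ℕ} (hv : 𝒩.Vert v)
    (h0 : cur v ≠ 0) {h : ℕ} (hh : 𝒩.Arc h)
    (hlt : Function.update cur v (𝒩.nxt (cur v)) (𝒩.tail h) < h) :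
    h = cur v ∨ cur (𝒩.tail h) < h := by
  obtain ⟨h₁, h₂⟩ := hc v hv h0
  by_cases ht : 𝒩.tail h = v
  · rw [ht, Function.update_self] at hlt
    rw [ht]
    by_contra hcon
    -- The lists have decreasing numbers, and `nxt` skips no arc with the same tail.
    have := wf.le_nxt _ h h₁ hh (by omega) (by rw [ht, h₂])
    omega
  · rw [Function.update_of_ne ht] at hlt
    exact Or.inr hlt

/-- Exactly the arc `cur v` leaves the set of unscanned arcs, since its successor is the next
smaller arc with the same tail. -/
theorem WF.unscanned_next (wf : 𝒩.WF) {cur : ℕ → ℕ} (hc : 𝒩.CurOk cur) {v : ℕ} (hv : 𝒩.Vert v)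
    (h0 : cur v ≠ 0) :
    𝒩.unscanned (Function.update cur v (𝒩.nxt (cur v))) + 1 = 𝒩.unscanned cur := by
  obtain ⟨h₁, h₂⟩ := hc v hv h0
  have hmem : cur v ∈ (Finset.Icc 1 𝒩.M).filter fun h => h ≤ cur (𝒩.tail h) := by
    simp [mem_Icc_iff_arc.2 h₁, h₂, Finset.mem_filter, -Finset.mem_Icc]
  rw [unscanned, unscanned, ← Finset.card_erase_add_one hmem]
  congr 2
  ext h
  simp only [Finset.mem_filter, Finset.mem_erase, mem_Icc_iff_arc]
  constructor
  · rintro ⟨hh, hle⟩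
    by_cases ht : 𝒩.tail h = v
    · rw [ht, Function.update_self] at hle
      have := wf.nxt_lt _ h₁
      exact ⟨by omega, hh, by rw [ht]; omega⟩
    · rw [Function.update_of_ne ht] at hle
      exact ⟨fun e => ht (by rw [e, h₂]), hh, hle⟩
  · rintro ⟨hne, hh, hle⟩
    refine ⟨hh, ?_⟩
    by_contra hlt
    rcases wf.lt_of_next_lt hc hv h0 hh (not_le.1 hlt) with h' | h' <;> omega

theorem unscanned_le (cur : ℕ → ℕ) : 𝒩.unscanned cur ≤ 𝒩.M := by
  rw [unscanned]
  exact (Finset.card_filter_le _ _).trans (by simp)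

variable {d r₀ r cur pv : ℕ → ℕ} {δ₀ δ home u : ℕ} {cap : (ℕ → Prop) → ℕ}

/-- A search step moves the scan pointer of `u` past an arc that cannot be used. -/
theorem Dfs.skip (wf : 𝒩.WF)
    (H : 𝒩.Dfs d r₀ δ₀ cap r cur δ (OnPath d cur pv home u) (fun U => ¬ U u))
    (T : 𝒩.Token d r cur pv home u) (h0 : cur u ≠ 0) (hu : 𝒩.col u ≠ 2)
    (hc : r (cur u) = 0 ∨ ¬ 𝒩.Dec d (cur u)) :
    𝒩.Dfs d r₀ δ₀ cap r (Function.update cur u (𝒩.nxt (cur u))) δ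
      (OnPath d (Function.update cur u (𝒩.nxt (cur u))) pv home u) (fun U => ¬ U u) ∧
    𝒩.Token d r (Function.update cur u (𝒩.nxt (cur u))) pv home u := by
  have hpv : ∀ j, d u < j → j ≤ d home →
      Function.update cur u (𝒩.nxt (cur u)) (pv j) = cur (pv j) := by
    intro j h₁ h₂
    have := (T.path j h₁ h₂).2.1
    rw [Function.update_of_ne]
    intro e
    rw [e] at this
    omega
  have hon : OnPath d (Function.update cur u (𝒩.nxt (cur u))) pv home u =
      OnPath d cur pv home u := by
    ext h
    refine exists_congr fun j => and_congr_right fun h₁ => and_congr_right fun h₂ => ?_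
    rw [hpv j h₁ h₂]
  constructor
  · refine ⟨H.paired, H.valid, H.cutEq, H.le, ?_, wf.curOk_next H.curOk T.vert h0, ?_, ?_⟩
    · rw [hon]
      exact H.track
    · intro h hh hlt
      rcases wf.lt_of_next_lt H.curOk T.vert h0 hh hlt with rfl | h'
      · tauto
      · rcases H.scanned h hh h' with h₁ | h₁ | h₁
        · exact Or.inl h₁
        · exact Or.inr (Or.inl h₁)
        · refine Or.inr (Or.inr ?_)
          rw [Function.update_of_ne, h₁]
          rintro rfl
          exact h0 h₁
    · intro v hv hv2
      rw [Function.update_of_ne (fun e => hu (by rwa [e] at hv2))]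
      exact H.sink v hv hv2
  · refine ⟨T.vert_home, T.vert, T.le, T.ne, T.eq, T.top, ?_⟩
    intro j h₁ h₂
    rw [hpv j h₁ h₂]
    exact T.path j h₁ h₂

/-- A search step moves the token along an arc that decreases the label. -/
theorem Dfs.advance (wf : 𝒩.WF) (hsink : ∀ v, 𝒩.Vert v → (d v = 1 ↔ 𝒩.col v = 2))
    (H : 𝒩.Dfs d r₀ δ₀ cap r cur δ (OnPath d cur pv home u) (fun U => ¬ U u))
    (T : 𝒩.Token d r cur pv home u) (h0 : cur u ≠ 0) (hu : 𝒩.col u ≠ 2)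
    (hr : r (cur u) ≠ 0) (hdec : 𝒩.Dec d (cur u)) :
    𝒩.Dfs d r₀ δ₀ cap (𝒩.push r (cur u)) cur δ
      (OnPath d cur (Function.update pv (d u) u) home (𝒩.hd (cur u)))
      (fun U => ¬ U (𝒩.hd (cur u))) ∧
    𝒩.Token d (𝒩.push r (cur u)) cur (Function.update pv (d u) u) home (𝒩.hd (cur u)) := by
  classical
  obtain ⟨hc, ht⟩ := H.curOk u T.vert h0
  set c := cur u with hcdef
  have hdu : d u = d (𝒩.hd c) + 1 := by rw [← ht]; exact hdec
  -- The label 0 means infinity, so a decrease to 0 would be spurious. It would need `d u = 1`, and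
  -- then `u` would be a sink.
  have hne : d (𝒩.hd c) ≠ 0 := fun e => hu ((hsink u T.vert).1 (by omega))
  have hmate : ¬ 𝒩.Dec d (𝒩.mate c) := by
    rw [Dec, wf.tail_mate hc, hd_mate, ht]
    omega
  have hlem := T.le
  have hpath : ∀ j, d u < j → j ≤ d home → cur (pv j) ≠ c ∧ cur (pv j) ≠ 𝒩.mate c := by
    intro j h₁ h₂
    obtain ⟨p₁, p₂, p₃, -, -⟩ := T.path j h₁ h₂
    obtain ⟨q₁, q₂⟩ := H.curOk _ p₁ p₃
    constructor
    · intro e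
      rw [e, ht] at q₂
      rw [← q₂] at p₂
      omega
    · intro e
      rw [e, wf.tail_mate hc] at q₂
      rw [← q₂] at p₂
      omega
  constructor
  · refine ⟨wf.paired_push H.paired hc hr, ?_, ?_, H.le, ?_, H.curOk, ?_, H.sink⟩
    -- Only the mate of `c` can become residual. It leads to a larger label, so the labelling stays
    -- valid.
    · intro h hh hrh hdh
      by_cases hm : h = 𝒩.mate c
      · rw [hm, wf.tail_mate hc, hd_mate, ht]
        exact ⟨hne, by omega⟩
      · refine H.valid h hh ?_ hdh
        by_cases hhc : h = c
        · rwa [hhc]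
        · rwa [push_of_ne hhc hm] at hrh
    · intro U hU
      have h₁ := H.cutEq U hU
      have h₂ := wf.cut_push hc hr U
      rw [ht] at h₂
      by_cases a : U u <;> by_cases b : U (𝒩.hd c) <;> simp [a, b] at h₁ h₂ ⊢ <;> omega
    · intro hδ h hh hdh
      have h₁ := H.track hδ h hh hdh
      have hm : h ≠ 𝒩.mate c := fun e => hmate (e ▸ hdh)
      by_cases hhc : h = c
      · rw [if_neg] at h₁
        · rw [if_pos, ← h₁, hhc, push_self wf hc]
          · omega
          · exact ⟨d u, by omega, hlem, by rw [Function.update_self, hhc]⟩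
        · rintro ⟨j, h₂, h₃, h₄⟩
          exact (hpath j h₂ h₃).1 (h₄ ▸ hhc)
      · rw [push_of_ne hhc hm, ← h₁]
        congr 1
        refine if_congr ⟨?_, ?_⟩ rfl rfl
        · rintro ⟨j, h₂, h₃, h₄⟩
          by_cases hj : j = d u
          · rw [hj, Function.update_self] at h₄
            exact absurd h₄ hhc
          · rw [Function.update_of_ne hj] at h₄
            exact ⟨j, by omega, h₃, h₄⟩
        · rintro ⟨j, h₂, h₃, h₄⟩
          exact ⟨j, by omega, h₃, by rwa [Function.update_of_ne (by omega)]⟩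
    · intro h hh hlt
      rcases H.scanned h hh hlt with h₁ | h₁
      · by_cases hm : h = 𝒩.mate c
        · exact Or.inr (Or.inl (hm ▸ hmate))
        · left
          by_cases hhc : h = c
          · rw [hhc, push_self wf hc]
            rw [hhc] at h₁
            omega
          · rwa [push_of_ne hhc hm]
      · exact Or.inr h₁
  · refine ⟨T.vert_home, vert_hd hc, by omega, fun _ => hne, by omega, ?_, ?_⟩
    · intro _
      by_cases h : d home = d u
      · rw [h, Function.update_self, T.eq h.symm]
      · rw [Function.update_of_ne h, T.top (by omega)]
    · intro j h₁ h₂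
      by_cases hj : j = d u
      · rw [hj, Function.update_self, if_pos hdu]
        refine ⟨T.vert, rfl, h0, ?_, rfl⟩
        have := H.paired c hc
        rw [← hcdef, push_self wf hc]
        omega
      · have h₃ : d u < j := by omega
        obtain ⟨p₁, p₂, p₃, p₄, p₅⟩ := T.path j h₃ h₂
        rw [Function.update_of_ne hj, push_of_ne (hpath j h₃ h₂).1 (hpath j h₃ h₂).2]
        refine ⟨p₁, p₂, p₃, p₄, ?_⟩
        rw [p₅, if_neg (by omega : ¬ j = d (𝒩.hd c) + 1)]
        split_ifs with h
        · rw [h, Nat.add_sub_cancel, Function.update_self]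
        · rw [Function.update_of_ne (by omega)]

/-- A search step moves the token back from a vertex without unscanned arcs. -/
theorem Dfs.retreat (wf : 𝒩.WF) (hsink : ∀ v, 𝒩.Vert v → (d v = 1 ↔ 𝒩.col v = 2))
    (H : 𝒩.Dfs d r₀ δ₀ cap r cur δ (OnPath d cur pv home u) (fun U => ¬ U u))
    (T : 𝒩.Token d r cur pv home u) (h0 : cur u = 0) (hne : u ≠ home) {x c : ℕ}
    (hx : x = pv (d u + 1)) (hcx : c = cur x) :
    𝒩.Dfs d r₀ δ₀ cap (𝒩.push r (𝒩.mate c)) (Function.update cur x (𝒩.nxt c)) δ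
      (OnPath d (Function.update cur x (𝒩.nxt c)) pv home x) (fun U => ¬ U x) ∧
    𝒩.Token d (𝒩.push r (𝒩.mate c)) (Function.update cur x (𝒩.nxt c)) pv home x ∧
    𝒩.Vert x ∧ 𝒩.Arc c ∧ 𝒩.Dec d c ∧ r (𝒩.mate c) ≠ 0 ∧ cur x ≠ 0 ∧ d u < d home ∧
      𝒩.col x ≠ 2 := by
  classical
  have hlem := T.le
  have hlt : d u < d home := lt_of_le_of_ne T.le fun e => hne (T.eq e)
  obtain ⟨p₁, p₂, p₃, p₄, p₅⟩ := T.path (d u + 1) (by omega) hlt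
  rw [← hx] at p₁ p₂ p₃ p₄ p₅
  rw [← hcx] at p₄ p₅
  rw [if_pos rfl] at p₅
  obtain ⟨hc, ht⟩ := H.curOk x p₁ p₃
  rw [← hcx] at hc ht
  have hmc := wf.mate_arc c hc
  have hmm := wf.mate_mate c hc
  have hdec : 𝒩.Dec d c := by rw [Dec, ht, p₅, p₂]
  have hxs : 𝒩.col x ≠ 2 := fun e => T.ne hlt (by have := (hsink x p₁).2 e; omega)
  -- The arcs of the path have residual capacity at most 1, and opposite capacities have the sum 2,
  -- so the unit can be pushed back.
  have hr : r (𝒩.mate c) ≠ 0 := by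
    have := H.paired c hc
    omega
  have hmate : ¬ 𝒩.Dec d (𝒩.mate c) := by
    rw [Dec, wf.tail_mate hc, hd_mate, ht]
    rw [p₅]
    omega
  have hrc : 𝒩.push r (𝒩.mate c) c = r c + 1 := by
    have := push_mate (𝒩 := 𝒩) (r := r) (c := 𝒩.mate c)
    rwa [hmm] at this
  have hro : ∀ h, h ≠ c → h ≠ 𝒩.mate c → 𝒩.push r (𝒩.mate c) h = r h := fun h h₁ h₂ =>
    push_of_ne h₂ (by rwa [hmm])
  have hpv : ∀ j, d x < j → j ≤ d home →
      Function.update cur x (𝒩.nxt c) (pv j) = cur (pv j) ∧ cur (pv j) ≠ c ∧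
        cur (pv j) ≠ 𝒩.mate c := by
    intro j h₁ h₂
    obtain ⟨q₁, q₂, q₃, -, -⟩ := T.path j (by omega) h₂
    obtain ⟨q₄, q₅⟩ := H.curOk _ q₁ q₃
    refine ⟨?_, ?_, ?_⟩
    · rw [Function.update_of_ne]
      intro e
      rw [e] at q₂
      omega
    · intro e
      rw [e, ht] at q₅
      rw [← q₅] at q₂
      omega
    · intro e
      rw [e, wf.tail_mate hc, p₅] at q₅
      rw [← q₅] at q₂
      omega
  have hux : u ≠ x := fun e => by rw [← e] at p₂; omega
  refine ⟨?_, ?_, p₁, hc, hdec, hr, p₃, hlt, hxs⟩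
  · refine ⟨wf.paired_push H.paired hmc hr, ?_, ?_, H.le, ?_, ?_, ?_, ?_⟩
    · intro h hh hrh hdh
      by_cases hhc : h = c
      · rw [hhc, ht, p₂, p₅]
        exact ⟨by omega, le_rfl⟩
      · refine H.valid h hh ?_ hdh
        by_cases hm : h = 𝒩.mate c
        · rwa [hm]
        · rwa [hro h hhc hm] at hrh
    · intro U hU
      have h₁ := H.cutEq U hU
      have h₂ := wf.cut_push hmc hr U
      rw [wf.tail_mate hc, hd_mate, ht, p₅] at h₂
      by_cases a : U u <;> by_cases b : U x <;> simp [a, b] at h₁ h₂ ⊢ <;> omega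
    · intro hδ h hh hdh
      have h₁ := H.track hδ h hh hdh
      have hm : h ≠ 𝒩.mate c := fun e => hmate (e ▸ hdh)
      by_cases hhc : h = c
      · rw [if_pos] at h₁
        · rw [if_neg, ← h₁, hhc, hrc]
          rintro ⟨j, h₂, h₃, h₄⟩
          rw [(hpv j h₂ h₃).1] at h₄
          exact (hpv j h₂ h₃).2.1 (h₄ ▸ hhc)
        · exact ⟨d u + 1, by omega, hlt, by rw [← hx, ← hcx, hhc]⟩
      · rw [hro h hhc hm, ← h₁]
        congr 1
        refine if_congr ⟨?_, ?_⟩ rfl rfl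
        · rintro ⟨j, h₂, h₃, h₄⟩
          rw [(hpv j h₂ h₃).1] at h₄
          exact ⟨j, by omega, h₃, h₄⟩
        · rintro ⟨j, h₂, h₃, h₄⟩
          by_cases hj : j = d u + 1
          · rw [hj, ← hx, ← hcx] at h₄
            exact absurd h₄ hhc
          · have h₅ : d x < j := by omega
            exact ⟨j, h₅, h₃, by rwa [(hpv j h₅ h₃).1]⟩
    · rw [hcx]
      exact wf.curOk_next H.curOk p₁ p₃
    · intro h hh hlt'
      have hz : ∀ v, cur v = 0 → Function.update cur x (𝒩.nxt c) v = 0 := by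
        intro v hv
        rw [Function.update_of_ne, hv]
        rintro rfl
        exact p₃ hv
      rw [hcx] at hlt'
      rcases wf.lt_of_next_lt H.curOk p₁ p₃ hh hlt' with h₁ | h₁
      -- The arc just passed is `c`. It may be residual again, but its head is `u`, whose list is
      -- exhausted.
      · rw [← hcx] at h₁
        right; right
        exact hz _ (by rw [h₁, p₅, h0])
      · rcases H.scanned h hh h₁ with h₂ | h₂ | h₂
        · by_cases hm : h = 𝒩.mate c
          · exact Or.inr (Or.inl (hm ▸ hmate))
          · have hhc : h ≠ c := by
              intro e
              rw [e, ht, ← hcx] at h₁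
              omega
            exact Or.inl (by rw [hro h hhc hm, h₂])
        · exact Or.inr (Or.inl h₂)
        · exact Or.inr (Or.inr (hz _ h₂))
    · intro v hv hv2
      rw [Function.update_of_ne (fun e => hxs (by rwa [e] at hv2))]
      exact H.sink v hv hv2
  · refine ⟨T.vert_home, p₁, by omega, by omega, ?_, ?_, ?_⟩
    · intro e
      rw [p₂] at e
      rw [hx, e, T.top hlt]
    · intro _
      exact T.top hlt
    · intro j h₁ h₂
      obtain ⟨q₁, q₂, q₃, q₄, q₅⟩ := T.path j (by omega) h₂
      obtain ⟨e₁, e₂, e₃⟩ := hpv j h₁ h₂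
      rw [e₁, hro _ e₂ e₃]
      refine ⟨q₁, q₂, q₃, q₄, ?_⟩
      rw [q₅, if_neg (by omega)]
      split_ifs with h
      · rw [h, Nat.add_sub_cancel, p₂, hx]
      · rfl

/-- The token at the source `home`, before it has moved. -/
theorem Token.start (hv : 𝒩.Vert home) : 𝒩.Token d r cur pv home home where
  vert_home := hv
  vert := hv
  le := le_rfl
  ne h := absurd h (lt_irrefl _)
  eq _ := rfl
  top h := absurd h (lt_irrefl _)
  path j h₁ h₂ := by omega

theorem onPath_home : OnPath d cur pv home home = fun _ => False := by
  ext h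
  simp only [OnPath, iff_false]
  rintro ⟨j, h₁, h₂, -⟩
  omega

theorem Sep.source {U : ℕ → Prop} (hU : 𝒩.Sep U) (hv : 𝒩.Vert home) (hs : 𝒩.col home = 1) :
    U home := by
  obtain ⟨h, hh, rfl⟩ := hv
  exact (hU h hh).1 hs

/-- A unit at a source lies inside every separating set and on no arc of a path, so a token may be
created there, and also removed, without any change of the invariant. -/
theorem Dfs.start (H : 𝒩.Dfs d r₀ δ₀ cap r cur δ (fun _ => False) (fun _ => False))
    (hv : 𝒩.Vert home) (hs : 𝒩.col home = 1) :
    𝒩.Dfs d r₀ δ₀ cap r cur δ (OnPath d cur pv home home) (fun U => ¬ U home) := by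
  refine ⟨H.paired, H.valid, ?_, H.le, ?_, H.curOk, H.scanned, H.sink⟩
  · intro U hU
    simpa [Sep.source hU hv hs] using H.cutEq U hU
  · rw [onPath_home]
    exact H.track

theorem Dfs.rest
    (H : 𝒩.Dfs d r₀ δ₀ cap r cur δ (OnPath d cur pv home home) (fun U => ¬ U home))
    (hv : 𝒩.Vert home) (hs : 𝒩.col home = 1) :
    𝒩.Dfs d r₀ δ₀ cap r cur δ (fun _ => False) (fun _ => False) := by
  refine ⟨H.paired, H.valid, ?_, H.le, ?_, H.curOk, H.scanned, H.sink⟩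
  · intro U hU
    simpa [Sep.source hU hv hs] using H.cutEq U hU
  · have := H.track
    rw [onPath_home] at this
    exact this

/-- The token has reached a sink, and the next one starts at `home`. -/
theorem Dfs.deliver
    (H : 𝒩.Dfs d r₀ δ₀ cap r cur δ (OnPath d cur pv home u) (fun U => ¬ U u))
    (T : 𝒩.Token d r cur pv home u) (hu : 𝒩.col u = 2) (hs : 𝒩.col home = 1) :
    𝒩.Dfs d r₀ δ₀ cap r cur (δ + 1) (OnPath d cur pv home home) (fun U => ¬ U home) := by
  have hle := H.le
  refine ⟨H.paired, H.valid, ?_, by omega, by omega, H.curOk, H.scanned, H.sink⟩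
  intro U hU
  have h₁ := H.cutEq U hU
  -- A sink is outside `U`, so the unit was counted as outside; from now on it is counted in `δ`.
  have h₂ : ¬ U u := by
    obtain ⟨h, hh, rfl⟩ := T.vert
    exact (hU h hh).2 hu
  simp only [Sep.source hU T.vert_home hs, h₂, not_true_eq_false, not_false_eq_true, if_true,
    if_false] at h₁ ⊢
  omega

/-- After the search, a distance labelling is at least the old one, and the labels of the vertices
without unscanned arcs have increased. -/
theorem Dfs.le_label (hsink : ∀ v, 𝒩.Vert v → (d v = 1 ↔ 𝒩.col v = 2))
    {on : ℕ → Prop} {out : (ℕ → Prop) → Prop}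
    (H : 𝒩.Dfs d r₀ δ₀ cap r cur δ on out) {e : ℕ → ℕ}
    (S : 𝒩.Supp e r) {v : ℕ} (hv : 𝒩.Vert v) (h0 : e v ≠ 0) :
    d v ≠ 0 ∧ d v ≤ e v ∧ (d v = e v → cur v ≠ 0) := by
  induction hk : e v using Nat.strong_induction_on generalizing v with
  | _ k ih =>
    obtain ⟨h, hh, rfl⟩ := hv
    by_cases h1 : k = 1
    · have h2 := (S.sink h hh).1 (hk.trans h1)
      have h3 := (hsink _ (vert_hd hh)).2 h2
      exact ⟨by omega, by omega, fun _ => H.sink _ (vert_hd hh) h2⟩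
    · obtain ⟨h', hh', ht, hr, he⟩ := S.arc h hh (by omega)
      have he1 : e (𝒩.hd h') ≠ 0 := by
        intro e0
        have := (S.sink h hh).1 (by omega)
        omega
      obtain ⟨i₁, i₂, i₃⟩ := ih _ (by omega) (vert_hd hh') he1 rfl
      obtain ⟨j₁, j₂⟩ := H.valid h' hh' hr i₁
      rw [ht] at j₁ j₂
      refine ⟨j₁, by omega, ?_⟩
      -- If the labels agree at an exhausted vertex, its supporting arc was scanned and is residual.
      -- The chain of inequalities is then tight, so the arc decreases `d` and the labels agree at
      -- its head too. By induction the head is not exhausted, and no reason remains for having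
      -- passed the arc.
      intro hdk hcur
      have hlt : cur (𝒩.tail h') < h' := by
        rw [ht, hcur]
        exact Nat.pos_of_ne_zero hh'.1
      rcases H.scanned h' hh' hlt with h₂ | h₂ | h₂
      · exact hr h₂
      · exact h₂ (by rw [Dec, ht]; omega)
      · exact i₃ (by omega) h₂

/-- If no unit has reached a sink in a search, then the vertices with labels have unscanned arcs. -/
theorem Dfs.unscanned_of_label
    {on : ℕ → Prop} {out : (ℕ → Prop) → Prop}
    (H : 𝒩.Dfs d r₀ δ₀ cap r cur δ on out) (hon : ∀ h, ¬ on h) (hδ : δ = δ₀)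
    (S : 𝒩.Supp d r₀) {v : ℕ} (hv : 𝒩.Vert v) (h0 : d v ≠ 0) : cur v ≠ 0 := by
  induction hk : d v using Nat.strong_induction_on generalizing v with
  | _ k ih =>
    obtain ⟨h, hh, rfl⟩ := hv
    by_cases h1 : k = 1
    · exact H.sink _ (vert_hd hh) ((S.sink h hh).1 (hk.trans h1))
    · obtain ⟨h', hh', ht, hr, he⟩ := S.arc h hh (by omega)
      have hdec : 𝒩.Dec d h' := by rw [Dec, ht]; omega
      -- With nothing delivered and no token on its way, an arc that decreases the label has its
      -- initial residual capacity, so the support of `d` at the start of the phase is intact.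
      have h2 := H.track hδ h' hh' hdec
      rw [if_neg (hon h')] at h2
      intro hcur
      have hlt : cur (𝒩.tail h') < h' := by
        rw [ht, hcur]
        exact Nat.pos_of_ne_zero hh'.1
      rcases H.scanned h' hh' hlt with h₂ | h₂ | h₂
      · omega
      · exact h₂ hdec
      · refine ih _ (by omega) (vert_hd hh') ?_ rfl h₂
        intro e0
        have := hh'.1
        omega

/-! ### The potential of the search -/

open Classical in
/-- The potential that bounds the remaining number of steps of the search. -/
noncomputable def pot (𝒩 : Network) (d r cur : ℕ → ℕ) (u : ℕ) : ℕ :=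
  2 * 𝒩.weight (fun h => if 𝒩.Dec d h then 1 else 0) r + 4 * 𝒩.unscanned cur +
    if 𝒩.col u = 2 then 1 else 0

/-- An advance uses up one unit of label-decreasing capacity, which gains 2 and outweighs the 1 that
a sink may add. A retreat gives these 2 back but passes an arc, worth 4. The extra 1 at a sink pays
for the jump back to the source. -/
theorem WF.pot_advance (wf : 𝒩.WF) {c : ℕ} (hc : 𝒩.Arc c) (hr : r c ≠ 0) (hdec : 𝒩.Dec d c)
    (v : ℕ) (hu : 𝒩.col u ≠ 2) : 𝒩.pot d (𝒩.push r c) cur v + 1 ≤ 𝒩.pot d r cur u := by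
  classical
  have := wf.weight_push (fun h => if 𝒩.Dec d h then 1 else 0) hc hr
  have hm : ¬ 𝒩.Dec d (𝒩.mate c) := by
    rw [Dec, wf.tail_mate hc, hd_mate]
    rw [Dec] at hdec
    omega
  simp only [hdec, hm, if_true, if_false] at this
  simp only [pot, hu, if_false]
  split <;> omega

theorem WF.pot_retreat (wf : 𝒩.WF) (hcur : 𝒩.CurOk cur) {x c : ℕ} (hc : 𝒩.Arc c)
    (hr : r (𝒩.mate c) ≠ 0) (hdec : 𝒩.Dec d c) (hv : 𝒩.Vert x) (h0 : cur x ≠ 0)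
    (hcx : c = cur x) (hx : 𝒩.col x ≠ 2) :
    𝒩.pot d (𝒩.push r (𝒩.mate c)) (Function.update cur x (𝒩.nxt c)) x + 1 ≤
      𝒩.pot d r cur u := by
  classical
  have := wf.weight_push (fun h => if 𝒩.Dec d h then 1 else 0) (wf.mate_arc c hc) hr
  have hm : ¬ 𝒩.Dec d (𝒩.mate c) := by
    rw [Dec, wf.tail_mate hc, hd_mate]
    rw [Dec] at hdec
    omega
  rw [wf.mate_mate c hc] at this
  simp only [hdec, hm, if_true, if_false] at this
  have h₂ := wf.unscanned_next hcur hv h0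
  simp only [pot, hx, if_false, hcx] at this h₂ ⊢
  split <;> omega

theorem WF.pot_skip (wf : 𝒩.WF) (hcur : 𝒩.CurOk cur) (hv : 𝒩.Vert u) (h0 : cur u ≠ 0) :
    𝒩.pot d r (Function.update cur u (𝒩.nxt (cur u))) u + 1 ≤ 𝒩.pot d r cur u := by
  have h₂ := wf.unscanned_next hcur hv h0
  simp only [pot]
  omega

theorem pot_deliver (hu : 𝒩.col u = 2) (hh : 𝒩.col home = 1) :
    𝒩.pot d r cur home + 1 ≤ 𝒩.pot d r cur u := by
  simp [pot, hu, hh]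

/-- Each of the `M` arcs has residual capacity at most 2 and is scanned at most once, whence `2 * 2
M + 4 M + 1`. -/
theorem Paired.pot_le (hr : 𝒩.Paired r) : 𝒩.pot d r cur u ≤ 8 * 𝒩.M + 1 := by
  classical
  have h₁ : 𝒩.weight (fun h => if 𝒩.Dec d h then 1 else 0) r ≤ 2 * 𝒩.M := by
    calc 𝒩.weight (fun h => if 𝒩.Dec d h then 1 else 0) r ≤ ∑ h ∈ Finset.Icc 1 𝒩.M, 2 := by
          refine Finset.sum_le_sum fun h hh => ?_
          have := hr h (mem_Icc_iff_arc.1 hh)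
          dsimp only
          split <;> omega
      _ = 2 * 𝒩.M := by simp [mul_comm]
  have h₂ := unscanned_le (𝒩 := 𝒩) cur
  rw [pot]
  split <;> omega

end Network

/-! ### The program of the depth-first search -/

-- Arrays and variables are notations for numerals, so that `simp` decides which of them are equal
-- and resolves the updates of a state.
notation "aInOut" => 0
notation "aCol" => 1
notation "aHd" => 2
notation "aMate" => 3
notation "aNxt" => 4
notation "aFirst" => 5
notation "aR" => 6
notation "aCur" => 7
notation "aD" => 8
notation "aQ" => 9
notation "aPv" => 10

notation "vN" => 0
notation "vM" => 1
notation "vU" => 2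
notation "vP" => 3
notation "vE" => 4
notation "vI" => 5
notation "vW" => 6
notation "vC" => 7
notation "vF" => 8
notation "vQh" => 9
notation "vQt" => 10
notation "vHome" => 11
notation "vG" => 12
notation "vLeft" => 13
notation "vX" => 14

namespace HappyEdges

open ArrayLang ArrayLang.Exp ArrayLang.Cmd

attribute [simp] Exp.eval Exp.Ok Cond.Ok Cond.Holds Cond.left Cond.right

/-- The state holds the data of the network. -/
structure Holds (𝒩 : Network) (σ : St) : Prop where
  n : σ.v vN = 𝒩.n
  M : σ.v vM = 𝒩.M
  col : σ.a aCol = 𝒩.col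
  hd : σ.a aHd = 𝒩.hd
  mate : σ.a aMate = 𝒩.mate
  nxt : σ.a aNxt = 𝒩.nxt
  first : σ.a aFirst = 𝒩.first

/-- Move the token back to the previous vertex of its path. -/
def retreatCmd : Cmd :=
  .seq (set vX (arr aPv (add (arr aD (var vU)) (const 1)))) <|
  .seq (set vC (arr aCur (var vX))) <|
  .seq (put aR (arr aMate (var vC)) (sub (arr aR (arr aMate (var vC))) (const 1))) <|
  .seq (put aR (var vC) (add (arr aR (var vC)) (const 1))) <|
  .seq (put aCur (var vX) (arr aNxt (var vC))) <|
  set vU (var vX)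

/-- Move the token along the arc `vC` to the vertex `vW`. -/
def advanceCmd : Cmd :=
  .seq (put aR (var vC) (sub (arr aR (var vC)) (const 1))) <|
  .seq (put aR (arr aMate (var vC)) (add (arr aR (arr aMate (var vC))) (const 1))) <|
  .seq (put aPv (arr aD (var vU)) (var vU)) <|
  set vU (var vW)

/-- One step of the search. -/
def tokenCmd : Cmd :=
  ite (.eq (arr aCol (var vU)) (const 2))
    (.seq (set vF (const 1)) (set vU (var vHome)))
    (.seq (set vC (arr aCur (var vU)))
      (ite (.eq (var vC) (const 0))
        (ite (.eq (var vU) (var vHome)) (set vG (const 0)) retreatCmd)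
        (.seq (set vW (arr aHd (var vC)))
          (ite (.ne (arr aR (var vC)) (const 0))
            (ite (.eq (arr aD (var vU)) (add (arr aD (var vW)) (const 1))) advanceCmd
              (put aCur (var vU) (arr aNxt (var vC))))
            (put aCur (var vU) (arr aNxt (var vC)))))))

/-- The search from all sources. -/
def dfsCmd : Cmd :=
  .seq (set vI (var vM)) <|
  whl (.ne (var vI) (const 0)) <|
  .seq (set vHome (arr aHd (var vI))) <|
  .seq (ite (.eq (arr aCol (var vHome)) (const 1))
    (.seq (set vU (var vHome)) (.seq (set vG (const 1)) (whl (.ne (var vG) (const 0)) tokenCmd)))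
    (set vG (const 0))) <|
  set vI (sub (var vI) (const 1))

/-- The sizes of the arrays and of the words suffice for the network. -/
structure Fits (𝒩 : Network) (N W : ℕ) : Prop where
  n : 𝒩.n ≤ N
  M : 𝒩.M + 2 ≤ N
  W : N + 3 ≤ W

/-- The invariant while the token from the source `home` moves. -/
structure TokenInv (𝒩 : Network) (d r₀ : ℕ → ℕ) (δ₀ : ℕ) (cap : (ℕ → Prop) → ℕ) (cur₀ : ℕ → ℕ)
    (i home δ : ℕ) (σ : St) : Prop where
  holds : Holds 𝒩 σ
  label : σ.a aD = d
  vi : σ.v vI = i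
  vhome : σ.v vHome = home
  src : 𝒩.col home = 1
  dfs : 𝒩.Dfs d r₀ δ₀ cap (σ.a aR) (σ.a aCur) δ
    (Network.OnPath d (σ.a aCur) (σ.a aPv) home (σ.v vU)) (fun U => ¬ U (σ.v vU))
  tok : 𝒩.Token d (σ.a aR) (σ.a aCur) (σ.a aPv) home (σ.v vU)
  flag : σ.v vF = 0 ∧ δ = δ₀ ∨ σ.v vF = 1 ∧ δ₀ < δ
  dead : ∀ v, cur₀ v = 0 → σ.a aCur v = 0
  idle : σ.v vG = 0 → σ.v vU = home ∧ σ.a aCur home = 0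

variable {𝒩 : Network} {N W : ℕ} {d r₀ : ℕ → ℕ} {δ₀ : ℕ} {cap : (ℕ → Prop) → ℕ} {cur₀ : ℕ → ℕ}
  {i home δ : ℕ}

/-- The outcomes are delivery at a sink, stop at an exhausted source, retreat, advance and skip. All
but the stop lower the potential, and the stop clears `vG`; 15 bounds the steps, with the loop test
included. -/
theorem tokenCmd_spec (wf : 𝒩.WF) (ft : Fits 𝒩 N W)
    (hsink : ∀ v, 𝒩.Vert v → (d v = 1 ↔ 𝒩.col v = 2)) (hd : ∀ v, 𝒩.Vert v → d v + 1 < N)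
    {σ : St} (I : TokenInv 𝒩 d r₀ δ₀ cap cur₀ i home δ σ) (hg : σ.v vG = 1) :
    WP 11 N W tokenCmd σ 1 fun s τ => ∃ δ', TokenInv 𝒩 d r₀ δ₀ cap cur₀ i home δ' τ ∧
      (τ.v vG = 1 ∧ 𝒩.pot d (τ.a aR) (τ.a aCur) (τ.v vU) + 1 ≤
        𝒩.pot d (σ.a aR) (σ.a aCur) (σ.v vU) ∨ τ.v vG = 0 ∧
        𝒩.pot d (τ.a aR) (τ.a aCur) (τ.v vU) ≤ 𝒩.pot d (σ.a aR) (σ.a aCur) (σ.v vU)) ∧ s ≤ 15 := by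
  obtain ⟨⟨h0, h1, hcol, hhd, hmate, hnxt, hfirst⟩, hD, hi, hh, hsrc, H, T, hflag, hdead, hidle⟩ := I
  have hfn := ft.n
  have hfM := ft.M
  have hfW := ft.W
  have hul := wf.vert_lt T.vert
  have hun : σ.v vU < N := by omega
  have h1W : 1 ≤ W := by omega
  have h2W : 2 ≤ W := by omega
  have hdu := hd _ T.vert
  rw [tokenCmd, WP_ite]
  refine ⟨by simp [hun, h2W], ?_, ?_⟩
  · intro hc
    simp [hcol] at hc
    simp [h1W]
    refine ⟨⟨δ + 1, ?_⟩, Or.inl ⟨hg, ?_⟩⟩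
    · have hle := H.le
      exact {
        holds := by constructor <;> simp [h0, h1, hcol, hhd, hmate, hnxt, hfirst]
        label := by simp [hD]
        vi := by simp [hi]
        vhome := by simp [hh]
        src := hsrc
        dfs := by simpa [hh] using H.deliver T hc hsrc
        tok := by simpa [hh] using Network.Token.start T.vert_home
        flag := by simp; omega
        dead := by simpa using hdead
        idle := by simp [hg] }
    · rw [hh]
      exact Network.pot_deliver hc hsrc
  · intro hc
    simp [hcol] at hc
    by_cases hcur : σ.a aCur (σ.v vU) = 0
    · by_cases huh : σ.v vU = home
      · rw [huh] at H T hcur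
        simp [hcur, huh, hh]
        refine ⟨by omega, δ, ?_⟩
        exact {
          holds := by constructor <;> simp [h0, h1, hcol, hhd, hmate, hnxt, hfirst]
          label := by simp [hD]
          vi := by simp [hi]
          vhome := by simp [hh]
          src := hsrc
          dfs := by simpa [huh] using H
          tok := by simpa [huh] using T
          flag := by simpa using hflag
          dead := by simpa using hdead
          idle := by simp [huh, hcur] }
      · obtain ⟨H', T', hx, hca, hdec, hr, hcx, hlt, hxs⟩ := H.retreat wf hsink T hcur huh rfl rfl
        set x := σ.a aPv (d (σ.v vU) + 1) with hxdef
        set c := σ.a aCur x with hcdef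
        have hxN : x < N := (wf.vert_lt hx).trans_le hfn
        have hcN : c < N := by have := hca.2; omega
        have hmN : 𝒩.mate c < N := by have := (wf.mate_arc c hca).2; omega
        have hr1 : σ.a aR c < W := by have := H.paired c hca; omega
        have hup : Function.update (σ.a aR) (𝒩.mate c) (σ.a aR (𝒩.mate c) - 1) c = σ.a aR c :=
          Function.update_of_ne (wf.mate_ne c hca).symm _ _
        have hpush : Function.update (Function.update (σ.a aR) (𝒩.mate c)
            (σ.a aR (𝒩.mate c) - 1)) c (σ.a aR c + 1) = 𝒩.push (σ.a aR) (𝒩.mate c) := by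
          rw [Network.push, wf.mate_mate c hca]
        simp [hcur, huh, hh, retreatCmd, hD, hmate, hnxt, ← hxdef, ← hcdef, hun, hxN, hcN, hmN,
          h1W, hup, hr1, hpush, hdu]
        refine ⟨by omega, ⟨δ, ?_⟩, Or.inl ⟨hg, ?_⟩⟩
        · exact {
            holds := by constructor <;> simp [h0, h1, hcol, hhd, hmate, hnxt, hfirst]
            label := by simp [hD]
            vi := by simp [hi]
            vhome := by simp [hh]
            src := hsrc
            dfs := by simpa [hup, hpush] using H'
            tok := by simpa [hup, hpush] using T'
            flag := by simpa using hflag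
            dead := by
              intro v hv
              have := hdead v hv
              have hvx : v ≠ x := fun e => hcx (by rwa [e] at this)
              simpa [Function.update_of_ne hvx] using this
            idle := by simp [hg] }
        · exact wf.pot_retreat H.curOk hca hr hdec hx hcx rfl hxs
    · obtain ⟨hca, ht⟩ := H.curOk _ T.vert hcur
      -- Used for both kinds of useless arcs: saturated ones and those that do not decrease the
      -- label.
      have hskip : (σ.a aR (σ.a aCur (σ.v vU)) = 0 ∨ ¬ 𝒩.Dec d (σ.a aCur (σ.v vU))) →
          (∃ δ', TokenInv 𝒩 d r₀ δ₀ cap cur₀ i home δ'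
            (((σ.setv vC (σ.a aCur (σ.v vU))).setv vW (𝒩.hd (σ.a aCur (σ.v vU)))).seta aCur
              (σ.v vU) (𝒩.nxt (σ.a aCur (σ.v vU))))) ∧
          𝒩.pot d (σ.a aR) (Function.update (σ.a aCur) (σ.v vU) (𝒩.nxt (σ.a aCur (σ.v vU))))
            (σ.v vU) < 𝒩.pot d (σ.a aR) (σ.a aCur) (σ.v vU) := by
        intro hbad
        obtain ⟨H', T'⟩ := H.skip wf T hcur hc hbad
        refine ⟨⟨δ, ?_⟩, wf.pot_skip H.curOk T.vert hcur⟩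
        exact {
            holds := by constructor <;> simp [h0, h1, hcol, hhd, hmate, hnxt, hfirst]
            label := by simp [hD]
            vi := by simp [hi]
            vhome := by simp [hh]
            src := hsrc
            dfs := by simpa using H'
            tok := by simpa using T'
            flag := by simpa using hflag
            dead := by
              intro v hv
              have := hdead v hv
              have hvx : v ≠ σ.v vU := fun e => hcur (e ▸ this)
              simpa [Function.update_of_ne hvx] using this
            idle := by simp [hg] }
      set c := σ.a aCur (σ.v vU) with hcdef
      have hcN : c < N := by have := hca.2; omega
      have hmN : 𝒩.mate c < N := by have := (wf.mate_arc c hca).2; omega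
      have hwN : 𝒩.hd c < N := (wf.hd_lt c hca).trans_le hfn
      have hdW : d (𝒩.hd c) < W := by have := hd _ (Network.vert_hd hca); omega
      have hdN : d (σ.v vU) < N := by omega
      have hup : Function.update (σ.a aR) c (σ.a aR c - 1) (𝒩.mate c) = σ.a aR (𝒩.mate c) :=
        Function.update_of_ne (wf.mate_ne c hca) _ _
      have hr1 : σ.a aR (𝒩.mate c) < W := by have := H.paired c hca; omega
      have hpush : Function.update (Function.update (σ.a aR) c
          (σ.a aR c - 1)) (𝒩.mate c) (σ.a aR (𝒩.mate c) + 1) = 𝒩.push (σ.a aR) c := rfl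
      simp [hcur, advanceCmd, hD, hhd, hmate, hnxt, ← hcdef, hun, hcN, hmN, hwN, hdW, hdN, h1W,
        hup, hr1, hpush, hg]
      refine ⟨fun hr => ⟨fun hdec => ?_, fun hdec => ?_⟩, fun hr => ?_⟩
      · have hdec' : 𝒩.Dec d c := by rw [Network.Dec, ht, hdec]
        obtain ⟨H', T'⟩ := H.advance wf hsink T hcur hc hr hdec'
        refine ⟨⟨δ, ?_⟩, wf.pot_advance hca hr hdec' _ hc⟩
        exact {
            holds := by constructor <;> simp [h0, h1, hcol, hhd, hmate, hnxt, hfirst]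
            label := by simp [hD]
            vi := by simp [hi]
            vhome := by simp [hh]
            src := hsrc
            dfs := by simpa [hup, hpush] using H'
            tok := by simpa [hup, hpush] using T'
            flag := by simpa using hflag
            dead := by simpa using hdead
            idle := by simp [hg] }
      · exact hskip (Or.inr (fun h => hdec (by rw [Network.Dec, ht] at h; exact h)))
      · exact hskip (Or.inl hr)

end HappyEdges

/-! ### Correctness and cost of the depth-first search -/

namespace Network

variable {𝒩 : Network} {d r cur : ℕ → ℕ} {u : ℕ}

open Classical in
/-- The potential of the search when the token is not at a sink. -/
noncomputable def pot₀ (𝒩 : Network) (d r cur : ℕ → ℕ) : ℕ :=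
  2 * 𝒩.weight (fun h => if 𝒩.Dec d h then 1 else 0) r + 4 * 𝒩.unscanned cur

theorem pot_of_ne (hu : 𝒩.col u ≠ 2) : 𝒩.pot d r cur u = 𝒩.pot₀ d r cur := by
  simp [pot, pot₀, hu]

theorem Paired.pot₀_le (hr : 𝒩.Paired r) : 𝒩.pot₀ d r cur ≤ 8 * 𝒩.M + 1 := by
  refine le_trans ?_ (hr.pot_le (d := d) (cur := cur) (u := 0))
  rw [pot, pot₀]
  omega

end Network

namespace HappyEdges

open ArrayLang ArrayLang.Exp ArrayLang.Cmd

variable {𝒩 : Network} {N W : ℕ} {d r₀ : ℕ → ℕ} {δ₀ : ℕ} {cap : (ℕ → Prop) → ℕ} {cur₀ : ℕ → ℕ}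
  {i home δ : ℕ}

theorem tokenLoop_spec (wf : 𝒩.WF) (ft : Fits 𝒩 N W)
    (hsink : ∀ v, 𝒩.Vert v → (d v = 1 ↔ 𝒩.col v = 2)) (hd : ∀ v, 𝒩.Vert v → d v + 1 < N)
    {σ : St} {t : ℕ} (I : TokenInv 𝒩 d r₀ δ₀ cap cur₀ i home δ σ) (hg : σ.v vG = 1) :
    WP 11 N W (whl (.ne (var vG) (const 0)) tokenCmd) σ t fun s τ =>
      ∃ δ', TokenInv 𝒩 d r₀ δ₀ cap cur₀ i home δ' τ ∧ τ.v vG = 0 ∧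
        s + 16 * 𝒩.pot d (τ.a aR) (τ.a aCur) (τ.v vU) ≤
          t + 16 * 𝒩.pot d (σ.a aR) (σ.a aCur) (σ.v vU) + 17 := by
  -- The additional 16 while `vG = 1` pays for the stopping step, which need not lower the
  -- potential.
  apply WP_whl (fun φ σ => ∃ δ, TokenInv 𝒩 d r₀ δ₀ cap cur₀ i home δ σ ∧
    (σ.v vG = 1 ∧ φ = 16 * 𝒩.pot d (σ.a aR) (σ.a aCur) (σ.v vU) + 16 ∨
      σ.v vG = 0 ∧ φ = 16 * 𝒩.pot d (σ.a aR) (σ.a aCur) (σ.v vU)))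
    (16 * 𝒩.pot d (σ.a aR) (σ.a aCur) (σ.v vU) + 16)
  · exact ⟨δ, I, Or.inl ⟨hg, rfl⟩⟩
  · simp
  · rintro φ σ ⟨δ, I, ⟨hg, hφ⟩ | ⟨hg, hφ⟩⟩ hc
    · refine (tokenCmd_spec wf ft hsink hd I hg).mono ?_
      rintro s τ ⟨δ', I', ⟨hg', hp⟩ | ⟨hg', hp⟩, hs⟩
      · exact ⟨_, ⟨δ', I', Or.inl ⟨hg', rfl⟩⟩, by omega⟩
      · exact ⟨_, ⟨δ', I', Or.inr ⟨hg', rfl⟩⟩, by omega⟩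
    · simp [hg] at hc
  · rintro ψ s τ ⟨δ, I, ⟨hg, hφ⟩ | ⟨hg, hφ⟩⟩ hc hs
    · simp [hg] at hc
    · exact ⟨δ, I, hg, by omega⟩

/-- What the depth-first search achieves. -/
structure DfsDone (𝒩 : Network) (d r₀ : ℕ → ℕ) (δ₀ : ℕ) (cap : (ℕ → Prop) → ℕ) (δ : ℕ)
    (σ : St) : Prop where
  holds : Holds 𝒩 σ
  label : σ.a aD = d
  dfs : 𝒩.Dfs d r₀ δ₀ cap (σ.a aR) (σ.a aCur) δ (fun _ => False) (fun _ => False)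
  flag : σ.v vF = 0 ∧ δ = δ₀ ∨ σ.v vF = 1 ∧ δ₀ < δ

theorem dfsCmd_spec (wf : 𝒩.WF) (ft : Fits 𝒩 N W)
    (hsink : ∀ v, 𝒩.Vert v → (d v = 1 ↔ 𝒩.col v = 2)) (hd : ∀ v, 𝒩.Vert v → d v + 1 < N)
    {σ : St} {t : ℕ} (I : DfsDone 𝒩 d r₀ δ₀ cap δ σ) :
    WP 11 N W dfsCmd σ t fun s τ => ∃ δ', DfsDone 𝒩 d r₀ δ₀ cap δ' τ ∧
      (∀ v, 𝒩.Vert v → 𝒩.col v = 1 → τ.a aCur v = 0) ∧ s ≤ t + 200 * (𝒩.M + 1) := by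
  have hfn := ft.n
  have hfM := ft.M
  have hfW := ft.W
  have h1W : 1 ≤ W := by omega
  simp only [dfsCmd, WP_seq (p := set vI (var vM)), WP_set]
  refine ⟨trivial, ?_⟩
  -- Sources are found as heads of arcs, so isolated vertices cost nothing. The potential is shared
  -- by all sources; 30 covers the overhead for each arc. Sources already treated remain exhausted,
  -- by the field `dead` of `TokenInv`.
  apply WP_whl (fun φ σ => ∃ δ, DfsDone 𝒩 d r₀ δ₀ cap δ σ ∧ σ.v vI ≤ 𝒩.M ∧
    (∀ h, 𝒩.Arc h → σ.v vI < h → 𝒩.col (𝒩.hd h) = 1 → σ.a aCur (𝒩.hd h) = 0) ∧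
    φ = 16 * 𝒩.pot₀ d (σ.a aR) (σ.a aCur) + 30 * σ.v vI)
    (16 * 𝒩.pot₀ d (σ.a aR) (σ.a aCur) + 30 * 𝒩.M)
  · obtain ⟨⟨h0, h1, hcol, hhd, hmate, hnxt, hfirst⟩, hD, H, hf⟩ := I
    refine ⟨δ, ⟨⟨?_, ?_, ?_, ?_, ?_, ?_, ?_⟩, ?_, ?_, ?_⟩, ?_, ?_, ?_⟩
    · simp [h0]
    · simp [h1]
    · simp [hcol]
    · simp [hhd]
    · simp [hmate]
    · simp [hnxt]
    · simp [hfirst]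
    · simp [hD]
    · simpa using H
    · simpa using hf
    · simp [h1]
    · simp only [St.setv_v, if_true, Exp.eval, h1]
      intro h hh hlt
      have := hh.2
      omega
    · simp [h1]
  · simp
  · rintro φ σ ⟨δ, ⟨⟨h0, h1, hcol, hhd, hmate, hnxt, hfirst⟩, hD, H, hf⟩, hiM, hdone, hφ⟩ hc
    have hi0 : σ.v vI ≠ 0 := by simpa using hc
    have hia : 𝒩.Arc (σ.v vI) := ⟨hi0, hiM⟩
    have hv := Network.vert_hd hia
    have hhN : 𝒩.hd (σ.v vI) < N := (wf.vert_lt hv).trans_le hfn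
    have hiN : σ.v vI < N := by omega
    rw [WP_seq, WP_set]
    refine ⟨by simp [hiN], ?_⟩
    rw [WP_seq, WP_ite]
    refine ⟨by simp [hhd, hhN, h1W], ?_, ?_⟩
    · intro hs
      simp [hhd, hcol] at hs
      rw [WP_seq, WP_set]
      refine ⟨by simp, ?_⟩
      rw [WP_seq, WP_set]
      refine ⟨by simp [h1W], ?_⟩
      have I : TokenInv 𝒩 d r₀ δ₀ cap (σ.a aCur) (σ.v vI) (𝒩.hd (σ.v vI)) δ
          (((σ.setv vHome (𝒩.hd (σ.v vI))).setv vU (𝒩.hd (σ.v vI))).setv vG 1) := {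
        holds := by constructor <;> simp [h0, h1, hcol, hhd, hmate, hnxt, hfirst]
        label := by simp [hD]
        vi := by simp
        vhome := by simp
        src := hs
        dfs := by simpa using H.start hv hs
        tok := by simpa using Network.Token.start hv
        flag := by simpa using hf
        dead := by simp
        idle := by simp }
      have := tokenLoop_spec (t := 1 + 1 + 1 + 1 + 1) wf ft hsink hd I (by simp)
      simp only [Exp.eval, St.setv_v, St.setv_a, hhd] at this ⊢
      refine this.mono ?_
      rintro s τ ⟨δ', I', hg, hs'⟩
      obtain ⟨⟨h0, h1, hcol, hhd, hmate, hnxt, hfirst⟩, hD, hi, hh, hsrc, H', T', hflag, hdead,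
        hidle⟩ := I'
      obtain ⟨hu, hcur⟩ := hidle hg
      simp only [WP_set]
      refine ⟨by simp [h1W], ?_⟩
      refine ⟨_, ⟨δ', ⟨⟨?_, ?_, ?_, ?_, ?_, ?_, ?_⟩, ?_, ?_, ?_⟩, ?_, ?_, rfl⟩, ?_⟩
      · simp [h0]
      · simp [h1]
      · simp [hcol]
      · simp [hhd]
      · simp [hmate]
      · simp [hnxt]
      · simp [hfirst]
      · simp [hD]
      · rw [hu] at H'
        simpa using H'.rest hv hs
      · simpa using hflag
      · simp [hi]; omega
      · simp only [St.setv_v, if_true, Exp.eval, hi, St.setv_a]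
        intro h hh hlt hs
        by_cases he : h = σ.v vI
        · rw [he, hcur]
        · exact hdead _ (hdone h hh (by omega) hs)
      · have e₁ : 𝒩.col (τ.v vU) ≠ 2 := by rw [hu, hs]; decide
        have e₂ : 𝒩.col (𝒩.hd (σ.v vI)) ≠ 2 := by rw [hs]; decide
        simp at hs'
        rw [Network.pot_of_ne e₁, Network.pot_of_ne e₂] at hs'
        simp [hi]
        omega
    · intro hs
      simp [hhd, hcol] at hs
      simp [h1W]
      refine ⟨⟨⟨δ, ⟨⟨?_, ?_, ?_, ?_, ?_, ?_, ?_⟩, ?_, ?_, ?_⟩⟩, ?_, ?_⟩, ?_⟩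
      · simp [h0]
      · simp [h1]
      · simp [hcol]
      · simp [hhd]
      · simp [hmate]
      · simp [hnxt]
      · simp [hfirst]
      · simp [hD]
      · simpa using H
      · simpa using hf
      · omega
      · intro h hh hlt hs'
        by_cases he : h = σ.v vI
        · exact absurd hs' (he ▸ hs)
        · exact hdone h hh (by omega) hs'
      · omega
  · rintro ψ s τ ⟨δ, I', hiM, hdone, hφ⟩ hc hs
    have hi0 : τ.v vI = 0 := by simpa using hc
    refine ⟨δ, I', ?_, ?_⟩
    · rintro v ⟨h, hh, rfl⟩ hs
      exact hdone h hh (by rw [hi0]; exact Nat.pos_of_ne_zero hh.1) hs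
    · have := I.dfs.paired.pot₀_le (d := d) (cur := σ.a aCur)
      omega

end HappyEdges

/-! ### The breadth-first search of a phase -/

namespace Network

variable (𝒩 : Network)

/-- The number of the arcs whose heads have no label yet. -/
def unseen (d : ℕ → ℕ) : ℕ := ((Finset.Icc 1 𝒩.M).filter fun h => d (𝒩.hd h) = 0).card

/-- The invariant of the backward search from the sinks, for the residual capacities `r`, the
labels `d`, the queue `q qh, …, q (qt - 1)`, and the scan pointers `cur`. -/
structure Bfs (r d q cur : ℕ → ℕ) (qh qt : ℕ) : Prop where
  le : qh ≤ qt
  card : qt + 𝒩.unseen d ≤ 𝒩.M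
  vert : ∀ i < qt, 𝒩.Vert (q i) ∧ d (q i) ≠ 0
  mem : ∀ v, 𝒩.Vert v → d v ≠ 0 → ∃ i < qt, q i = v
  mono : ∀ i j, i ≤ j → j < qt → d (q i) ≤ d (q j)
  near : qh < qt → ∀ j < qt, d (q j) ≤ d (q qh) + 1
  label : ∀ i < qt, d (q i) ≤ i + 1
  one : ∀ v, 𝒩.Vert v → d v = 1 → 𝒩.col v = 2
  arc : ∀ v, 𝒩.Vert v → 1 < d v → ∃ h, 𝒩.Arc h ∧ 𝒩.tail h = v ∧ r h ≠ 0 ∧ d (𝒩.hd h) + 1 = d v ∧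
    d (𝒩.hd h) ≠ 0
  curOk : 𝒩.CurOk cur
  scanned : ∀ h, 𝒩.Arc h → r h ≠ 0 → cur (𝒩.hd h) < 𝒩.mate h →
    d (𝒩.hd h) ≠ 0 ∧ d (𝒩.tail h) ≠ 0 ∧ d (𝒩.tail h) ≤ d (𝒩.hd h) + 1
  done : ∀ i < qh, cur (q i) = 0

variable {𝒩} {r d q cur : ℕ → ℕ} {qh qt : ℕ}

theorem unseen_le (d : ℕ → ℕ) : 𝒩.unseen d ≤ 𝒩.M := by
  rw [unseen]
  exact (Finset.card_filter_le _ _).trans (by simp)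

/-- A non-isolated vertex is the head of some arc, which leaves the count. Counting arcs rather than
vertices bounds the queue and the running time by `M`, independently of the number of isolated
vertices. -/
theorem unseen_update {v y : ℕ} (hv : 𝒩.Vert v) (h0 : d v = 0) (hy : y ≠ 0) :
    𝒩.unseen (Function.update d v y) + 1 ≤ 𝒩.unseen d := by
  obtain ⟨h, hh, rfl⟩ := hv
  refine Finset.card_lt_card ⟨?_, ?_⟩
  · intro k hk
    simp only [Finset.mem_filter, mem_Icc_iff_arc] at hk ⊢
    refine ⟨hk.1, ?_⟩
    by_contra hne
    rw [Function.update_of_ne] at hk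
    · exact hne hk.2
    · intro e
      exact hne (e ▸ h0)
  · intro hsub
    have : h ∈ (Finset.Icc 1 𝒩.M).filter fun k => d (𝒩.hd k) = 0 := by
      simp only [Finset.mem_filter, mem_Icc_iff_arc]
      exact ⟨hh, h0⟩
    have := hsub this
    simp only [Finset.mem_filter, Function.update_self] at this
    exact hy this.2

theorem WF.bfs_start (wf : 𝒩.WF) (h0 : ∀ v, 𝒩.Vert v → d v = 0)
    (hcur : ∀ v, 𝒩.Vert v → cur v = 𝒩.first v) : 𝒩.Bfs r d q cur 0 0 where
  le := le_rfl
  card := by simpa using unseen_le d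
  vert i hi := absurd hi (Nat.not_lt_zero i)
  mem v hv h := absurd (h0 v hv) h
  mono i j _ hj := absurd hj (Nat.not_lt_zero j)
  near h := absurd h (lt_irrefl _)
  label i hi := absurd hi (Nat.not_lt_zero i)
  one v hv h := by rw [h0 v hv] at h; omega
  arc v hv h := by rw [h0 v hv] at h; omega
  curOk v hv h := by
    rw [hcur v hv] at h ⊢
    exact ⟨⟨h, wf.first_le v⟩, wf.first_tail v h⟩
  scanned h hh _ hlt := by
    rw [hcur _ (vert_hd hh)] at hlt
    have := wf.le_first _ (wf.mate_arc h hh)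
    rw [wf.tail_mate hh] at this
    omega
  done i hi := absurd hi (Nat.not_lt_zero i)

/-- Append a vertex to the queue. -/
theorem Bfs.enqueue (B : 𝒩.Bfs r d q cur qh qt) {w y : ℕ} (hw : 𝒩.Vert w) (h0 : d w = 0)
    (hy : y ≠ 0) (hle : ∀ j < qt, d (q j) ≤ y) (hnear : qh < qt → y ≤ d (q qh) + 1)
    (hlab : y ≤ qt + 1) (hone : y = 1 → 𝒩.col w = 2)
    (harc : 1 < y → ∃ h, 𝒩.Arc h ∧ 𝒩.tail h = w ∧ r h ≠ 0 ∧ d (𝒩.hd h) + 1 = y ∧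
      d (𝒩.hd h) ≠ 0) :
    𝒩.Bfs r (Function.update d w y) (Function.update q qt w) cur qh (qt + 1) := by
  have hd : ∀ v, d v ≠ 0 → Function.update d w y v = d v := by
    intro v hv
    rw [Function.update_of_ne]
    rintro rfl
    exact hv h0
  have hq : ∀ i, i < qt → Function.update q qt w i = q i := fun i hi =>
    Function.update_of_ne (by omega) _ _
  have hdq : ∀ i, i < qt → Function.update d w y (Function.update q qt w i) = d (q i) := by
    intro i hi
    rw [hq i hi, hd _ (B.vert i hi).2]
  have hdt : Function.update d w y (Function.update q qt w qt) = y := by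
    rw [Function.update_self, Function.update_self]
  have hle' := B.le
  have hcard := B.card
  have hun := unseen_update hw h0 hy
  refine ⟨by omega, by omega, ?_, ?_, ?_, ?_, ?_, ?_, ?_, B.curOk, ?_, ?_⟩
  · intro i hi
    by_cases h : i = qt
    · rw [h, hdt, Function.update_self]
      exact ⟨hw, hy⟩
    · rw [hdq i (by omega), hq i (by omega)]
      exact B.vert i (by omega)
  · intro v hv hv0
    by_cases h : v = w
    · exact ⟨qt, by omega, by rw [Function.update_self, h]⟩
    · rw [Function.update_of_ne h] at hv0
      obtain ⟨i, hi, rfl⟩ := B.mem v hv hv0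
      exact ⟨i, by omega, hq i hi⟩
  · intro i j hij hj
    by_cases h : j = qt
    · by_cases h' : i = qt
      · rw [h, h']
      · rw [h, hdt, hdq i (by omega)]
        exact hle i (by omega)
    · rw [hdq i (by omega), hdq j (by omega)]
      exact B.mono i j hij (by omega)
  · intro _ j hj
    by_cases h : qh = qt
    · rw [h, hdt]
      by_cases h' : j = qt
      · rw [h', hdt]; omega
      · rw [hdq j (by omega)]
        exact (hle j (by omega)).trans (Nat.le_succ y)
    · rw [hdq qh (by omega)]
      by_cases h' : j = qt
      · rw [h', hdt]
        exact hnear (by omega)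
      · rw [hdq j (by omega)]
        exact B.near (by omega) j (by omega)
  · intro i hi
    by_cases h : i = qt
    · rw [h, hdt]
      exact hlab
    · rw [hdq i (by omega)]
      exact B.label i (by omega)
  · intro v hv h1
    by_cases h : v = w
    · rw [h, Function.update_self] at h1
      rw [h]
      exact hone h1
    · rw [Function.update_of_ne h] at h1
      exact B.one v hv h1
  · intro v hv h1
    by_cases h : v = w
    · rw [h, Function.update_self] at h1 ⊢
      obtain ⟨k, k₁, k₂, k₃, k₄, k₅⟩ := harc h1
      refine ⟨k, k₁, k₂, k₃, ?_⟩
      rw [hd _ k₅]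
      exact ⟨k₄, k₅⟩
    · rw [Function.update_of_ne h] at h1 ⊢
      obtain ⟨k, k₁, k₂, k₃, k₄, k₅⟩ := B.arc v hv h1
      refine ⟨k, k₁, k₂, k₃, ?_⟩
      rw [hd _ k₅]
      exact ⟨k₄, k₅⟩
  · intro h hh hr hlt
    obtain ⟨e₁, e₂, e₃⟩ := B.scanned h hh hr hlt
    rw [hd _ e₁, hd _ e₂]
    exact ⟨e₁, e₂, e₃⟩
  · intro i hi
    rw [hq i (by omega)]
    exact B.done i hi

/-- Scan an arc of the first vertex in the queue. -/
theorem Bfs.scan (wf : 𝒩.WF) (B : 𝒩.Bfs r d q cur qh qt) (hlt : qh < qt) (h0 : cur (q qh) ≠ 0)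
    (hw : r (𝒩.mate (cur (q qh))) ≠ 0 → d (𝒩.hd (cur (q qh))) ≠ 0) :
    𝒩.Bfs r d q (Function.update cur (q qh) (𝒩.nxt (cur (q qh)))) qh qt := by
  obtain ⟨hv, hv0⟩ := B.vert qh hlt
  obtain ⟨hc, ht⟩ := B.curOk _ hv h0
  refine ⟨B.le, B.card, B.vert, B.mem, B.mono, B.near, B.label, B.one, B.arc,
    wf.curOk_next B.curOk hv h0, ?_, ?_⟩
  · intro h hh hr hs
    rw [← wf.tail_mate hh] at hs
    rcases wf.lt_of_next_lt B.curOk hv h0 (wf.mate_arc h hh) hs with e | e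
    · have e' : h = 𝒩.mate (cur (q qh)) := by rw [← e, wf.mate_mate h hh]
      rw [e', wf.tail_mate hc, hd_mate, ht]
      -- The tail of the scanned arc has a label, so it is in the queue, where labels exceed that of
      -- the first vertex by at most one.
      have hd0 := hw (e' ▸ hr)
      obtain ⟨j, hj, hj'⟩ := B.mem _ (vert_hd hc) hd0
      refine ⟨hv0, hd0, ?_⟩
      rw [← hj']
      exact B.near hlt j hj
    · rw [wf.tail_mate hh] at e
      exact B.scanned h hh hr e
  · intro i hi
    rw [Function.update_of_ne, B.done i hi]
    intro e
    rw [← e] at h0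
    exact h0 (B.done i hi)

/-- Remove the first vertex from the queue. -/
theorem Bfs.dequeue (B : 𝒩.Bfs r d q cur qh qt) (hlt : qh < qt) (h0 : cur (q qh) = 0) :
    𝒩.Bfs r d q cur (qh + 1) qt := by
  refine ⟨hlt, B.card, B.vert, B.mem, B.mono, ?_, B.label, B.one, B.arc, B.curOk, B.scanned, ?_⟩
  · intro h j hj
    have h₁ := B.near hlt j hj
    have h₂ := B.mono qh (qh + 1) (by omega) h
    omega
  · intro i hi
    by_cases h : i = qh
    · rw [h, h0]
    · exact B.done i (by omega)

/-- When the queue is empty, every vertex with a label has been removed with an exhausted pointer,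
so all residual arcs into it have been scanned. -/
theorem Bfs.valid (wf : 𝒩.WF) (B : 𝒩.Bfs r d q cur qt qt) : 𝒩.Valid d r := by
  intro h hh hr h0
  obtain ⟨i, hi, e⟩ := B.mem _ (vert_hd hh) h0
  refine (B.scanned h hh hr ?_).2
  rw [← e, B.done i hi]
  exact Nat.pos_of_ne_zero (wf.mate_arc h hh).1

theorem Bfs.supp (B : 𝒩.Bfs r d q cur qt qt)
    (hs : ∀ v, 𝒩.Vert v → 𝒩.col v = 2 → d v = 1) : 𝒩.Supp d r where
  sink h hh := ⟨B.one _ (vert_hd hh), hs _ (vert_hd hh)⟩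
  arc h hh h1 := by
    obtain ⟨k, k₁, k₂, k₃, k₄, -⟩ := B.arc _ (vert_hd hh) h1
    exact ⟨k, k₁, k₂, k₃, k₄⟩

/-- A label is at most one more than its position in the queue, and the queue has length at most
`M`. -/
theorem Bfs.label_le (B : 𝒩.Bfs r d q cur qh qt) {v : ℕ} (hv : 𝒩.Vert v) : d v ≤ 𝒩.M := by
  by_cases h : d v = 0
  · omega
  · obtain ⟨i, hi, rfl⟩ := B.mem v hv h
    have h₁ := B.label i hi
    have h₂ := B.card
    omega

end Network

/-! ### The program of the breadth-first search -/

namespace HappyEdges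

open ArrayLang ArrayLang.Exp ArrayLang.Cmd

/-- A loop over all arcs. -/
def arcLoop (p : Cmd) : Cmd :=
  .seq (set vI (var vM)) <| whl (.ne (var vI) (const 0)) <| .seq p <|
    set vI (sub (var vI) (const 1))

/-- Remove all labels and reset the scan pointers. -/
def clearCmd : Cmd :=
  arcLoop <| .seq (set vW (arr aHd (var vI))) <| .seq (put aD (var vW) (const 0)) <|
    put aCur (var vW) (arr aFirst (var vW))

/-- Reset the scan pointers. -/
def resetCmd : Cmd :=
  arcLoop <| .seq (set vW (arr aHd (var vI))) <| put aCur (var vW) (arr aFirst (var vW))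

/-- Append the vertex `vW` with the label `e` to the queue, unless it has a label. -/
def enqueueCmd (e : Exp) : Cmd :=
  ite (.eq (arr aD (var vW)) (const 0))
    (.seq (put aD (var vW) e) <| .seq (put aQ (var vQt) (var vW)) <|
      set vQt (add (var vQt) (const 1)))
    (set vW (var vW))

/-- Put the sinks into the queue. -/
def seedCmd : Cmd :=
  arcLoop <| .seq (set vW (arr aHd (var vI))) <|
    ite (.eq (arr aCol (var vW)) (const 2)) (enqueueCmd (const 1)) (set vW (var vW))

/-- One step of the breadth-first search. -/
def scanCmd : Cmd :=
  .seq (set vU (arr aQ (var vQh))) <|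
  .seq (set vC (arr aCur (var vU))) <|
  ite (.eq (var vC) (const 0)) (set vQh (add (var vQh) (const 1))) <|
    .seq (set vW (arr aHd (var vC))) <|
    .seq (ite (.ne (arr aR (arr aMate (var vC))) (const 0))
      (enqueueCmd (add (arr aD (var vU)) (const 1))) (set vW (var vW))) <|
    put aCur (var vU) (arr aNxt (var vC))

/-- The breadth-first search from the sinks. -/
def bfsCmd : Cmd :=
  .seq clearCmd <| .seq (set vQh (const 0)) <| .seq (set vQt (const 0)) <| .seq seedCmd <|
  .seq (whl (.lt (var vQh) (var vQt)) scanCmd) resetCmd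

variable {𝒩 : Network} {N W : ℕ}

/-- `J i` describes the state in which the arcs `1, …, i` are still to be processed. The bound `k`
for the body includes the loop test, and the decrement adds 1. -/
theorem arcLoop_spec (J : ℕ → St → Prop) (k : ℕ) {p : Cmd} {σ : St} {t : ℕ} (hW : 1 ≤ W)
    (hM : σ.v vM = 𝒩.M) (hJ : J 𝒩.M (σ.setv vI 𝒩.M))
    (step : ∀ i σ, 𝒩.Arc i → J i σ → σ.v vI = i →
      WP 11 N W p σ 1 fun s τ => τ.v vI = i ∧ s ≤ k ∧ J (i - 1) (τ.setv vI (i - 1)))  :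
    WP 11 N W (arcLoop p) σ t fun s τ => J 0 τ ∧ s ≤ t + (k + 1) * 𝒩.M + 2 := by
  rw [arcLoop, WP_seq, WP_set]
  refine ⟨trivial, ?_⟩
  apply WP_whl (fun φ σ => ∃ i ≤ 𝒩.M, J i σ ∧ σ.v vI = i ∧ φ = (k + 1) * i) ((k + 1) * 𝒩.M)
  · exact ⟨𝒩.M, le_rfl, by simpa [hM] using hJ, by simp [hM], rfl⟩
  · simp
  · rintro φ σ ⟨i, hi, hJ, hv, rfl⟩ hc
    have hi0 : i ≠ 0 := by simpa [hv] using hc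
    rw [WP_seq]
    refine (step i σ ⟨hi0, hi⟩ hJ hv).mono ?_
    rintro s τ ⟨hv', hs, hJ'⟩
    simp only [WP_set]
    refine ⟨by simp [hW], _, ⟨i - 1, by omega, by simpa [hv'] using hJ', by simp [hv'], rfl⟩, ?_⟩
    obtain ⟨x, rfl⟩ := Nat.exists_eq_succ_of_ne_zero hi0
    rw [Nat.succ_sub_one, Nat.succ_eq_add_one, mul_add]
    omega
  · rintro ψ s τ ⟨i, hi, hJ, hv, rfl⟩ hc hs
    have hi0 : i = 0 := by simpa [hv] using hc
    subst hi0
    exact ⟨hJ, by omega⟩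

/-- The state holds the data of the network, the residual capacities `r`, and the flag `f`. -/
structure Base (𝒩 : Network) (r : ℕ → ℕ) (f : ℕ) (σ : St) : Prop where
  holds : Holds 𝒩 σ
  cap : σ.a aR = r
  flag : σ.v vF = f

variable {r : ℕ → ℕ} {f : ℕ}

theorem clearCmd_spec (wf : 𝒩.WF) (ft : Fits 𝒩 N W) {σ : St} {t : ℕ} (hB : Base 𝒩 r f σ) :
    WP 11 N W clearCmd σ t fun s τ => Base 𝒩 r f τ ∧
      (∀ v, 𝒩.Vert v → τ.a aD v = 0 ∧ τ.a aCur v = 𝒩.first v) ∧ s ≤ t + 10 * (𝒩.M + 1) := by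
  have hfn := ft.n
  have hfM := ft.M
  have hfW := ft.W
  refine (arcLoop_spec (fun i σ => Base 𝒩 r f σ ∧ ∀ h, 𝒩.Arc h → i < h →
    σ.a aD (𝒩.hd h) = 0 ∧ σ.a aCur (𝒩.hd h) = 𝒩.first (𝒩.hd h)) 4 (by omega) hB.holds.M ?_ ?_).mono ?_
  · obtain ⟨⟨h0, h1, hcol, hhd, hmate, hnxt, hfirst⟩, hr, hf⟩ := hB
    refine ⟨⟨?_, by simp [hr], by simp [hf]⟩, fun h hh hlt => absurd hh.2 (by omega)⟩
    constructor <;> simp [h0, h1, hcol, hhd, hmate, hnxt, hfirst]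
  · rintro i σ hi ⟨⟨⟨h0, h1, hcol, hhd, hmate, hnxt, hfirst⟩, hr, hf⟩, hdone⟩ hv
    have hiN : i < N := by have := hi.2; omega
    have hwN : 𝒩.hd i < N := (wf.hd_lt i hi).trans_le hfn
    simp [hhd, hfirst, hv, hiN, hwN]
    refine ⟨⟨?_, by simp [hr], by simp [hf]⟩, ?_⟩
    · constructor <;> simp [h0, h1, hcol, hhd, hmate, hnxt, hfirst]
    · intro h hh hlt
      -- A vertex is treated once for each arc that enters it; the repetition is harmless because
      -- the assignments do not depend on the arc.
      by_cases he : 𝒩.hd h = 𝒩.hd i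
      · simp [he]
      · rw [Function.update_of_ne he, Function.update_of_ne he]
        refine hdone h hh ?_
        have : h ≠ i := fun e => he (by rw [e])
        omega
  · rintro s τ ⟨⟨hB', hdone⟩, hs⟩
    refine ⟨hB', ?_, by omega⟩
    rintro v ⟨h, hh, rfl⟩
    exact hdone h hh (Nat.pos_of_ne_zero hh.1)

theorem resetCmd_spec (wf : 𝒩.WF) (ft : Fits 𝒩 N W) {σ : St} {t : ℕ} {d : ℕ → ℕ}
    (hB : Base 𝒩 r f σ) (hd : σ.a aD = d) :
    WP 11 N W resetCmd σ t fun s τ => Base 𝒩 r f τ ∧ τ.a aD = d ∧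
      (∀ v, 𝒩.Vert v → τ.a aCur v = 𝒩.first v) ∧ s ≤ t + 10 * (𝒩.M + 1) := by
  have hfn := ft.n
  have hfM := ft.M
  have hfW := ft.W
  refine (arcLoop_spec (fun i σ => (Base 𝒩 r f σ ∧ σ.a aD = d) ∧ ∀ h, 𝒩.Arc h → i < h →
    σ.a aCur (𝒩.hd h) = 𝒩.first (𝒩.hd h)) 3 (by omega) hB.holds.M ?_ ?_).mono ?_
  · obtain ⟨⟨h0, h1, hcol, hhd, hmate, hnxt, hfirst⟩, hr, hf⟩ := hB
    refine ⟨⟨⟨?_, by simp [hr], by simp [hf]⟩, by simp [hd]⟩,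
      fun h hh hlt => absurd hh.2 (by omega)⟩
    constructor <;> simp [h0, h1, hcol, hhd, hmate, hnxt, hfirst]
  · rintro i σ hi ⟨⟨⟨⟨h0, h1, hcol, hhd, hmate, hnxt, hfirst⟩, hr, hf⟩, hd⟩, hdone⟩ hv
    have hiN : i < N := by have := hi.2; omega
    have hwN : 𝒩.hd i < N := (wf.hd_lt i hi).trans_le hfn
    simp [hhd, hfirst, hv, hiN, hwN, hd]
    refine ⟨⟨?_, by simp [hr], by simp [hf]⟩, ?_⟩
    · constructor <;> simp [h0, h1, hcol, hhd, hmate, hnxt, hfirst]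
    · intro h hh hlt
      by_cases he : 𝒩.hd h = 𝒩.hd i
      · simp [he]
      · rw [Function.update_of_ne he]
        refine hdone h hh ?_
        have : h ≠ i := fun e => he (by rw [e])
        omega
  · rintro s τ ⟨⟨hB', hdone⟩, hs⟩
    refine ⟨hB'.1, hB'.2, ?_, by omega⟩
    rintro v ⟨h, hh, rfl⟩
    exact hdone h hh (Nat.pos_of_ne_zero hh.1)

end HappyEdges

/-! ### Correctness and cost of the breadth-first search -/

namespace HappyEdges

open ArrayLang ArrayLang.Exp ArrayLang.Cmd

variable {𝒩 : Network} {N W : ℕ} {r : ℕ → ℕ} {f : ℕ}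

/-- The invariant of the breadth-first search. -/
structure BfsInv (𝒩 : Network) (r : ℕ → ℕ) (f : ℕ) (σ : St) : Prop where
  base : Base 𝒩 r f σ
  bfs : 𝒩.Bfs r (σ.a aD) (σ.a aQ) (σ.a aCur) (σ.v vQh) (σ.v vQt)

theorem seedCmd_spec (wf : 𝒩.WF) (ft : Fits 𝒩 N W) {σ : St} {t : ℕ} (hI : BfsInv 𝒩 r f σ)
    (h0 : σ.v vQt = 0) :
    WP 11 N W seedCmd σ t fun s τ => BfsInv 𝒩 r f τ ∧
      (∀ v, 𝒩.Vert v → 𝒩.col v = 2 → τ.a aD v = 1) ∧ s ≤ t + 10 * (𝒩.M + 1) := by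
  have hfn := ft.n
  have hfM := ft.M
  have hfW := ft.W
  have h1W : 1 ≤ W := by omega
  have h2W : 2 ≤ W := by omega
  -- While the sinks are collected, all labels in the queue are 1, so appending another label 1
  -- keeps the queue sorted.
  refine (arcLoop_spec (fun i σ => (BfsInv 𝒩 r f σ ∧ ∀ j < σ.v vQt, σ.a aD (σ.a aQ j) = 1) ∧
    ∀ h, 𝒩.Arc h → i < h → 𝒩.col (𝒩.hd h) = 2 → σ.a aD (𝒩.hd h) = 1) 7 (by omega)
    hI.base.holds.M ?_ ?_).mono ?_
  · obtain ⟨⟨⟨h0, h1, hcol, hhd, hmate, hnxt, hfirst⟩, hr, hf⟩, B⟩ := hI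
    refine ⟨⟨⟨⟨?_, by simp [hr], by simp [hf]⟩, by simpa using B⟩, ?_⟩,
      fun h hh hlt => absurd hh.2 (by omega)⟩
    · constructor <;> simp [h0, h1, hcol, hhd, hmate, hnxt, hfirst]
    · intro j hj
      simp at hj
      omega
  · rintro i σ hi ⟨⟨⟨⟨⟨h0, h1, hcol, hhd, hmate, hnxt, hfirst⟩, hr, hf⟩, B⟩, hall⟩, hdone⟩ hv
    have hiN : i < N := by have := hi.2; omega
    have hwN : 𝒩.hd i < N := (wf.hd_lt i hi).trans_le hfn
    have hcard := B.card
    have hqN : σ.v vQt < N := by omega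
    have hqW : σ.v vQt < W := by omega
    have hw := Network.vert_hd hi
    simp [enqueueCmd, hhd, hv, hiN, hwN, hqN, hqW, hcol, h1W, h2W]
    refine ⟨fun hc => ⟨fun hd0 => ?_, fun hd0 => ?_⟩, fun hc => ?_⟩
    · have hne : ∀ j < σ.v vQt, σ.a aQ j ≠ 𝒩.hd i := by
        intro j hj e
        have := hall j hj
        rw [e, hd0] at this
        omega
      refine ⟨⟨⟨⟨?_, by simp [hr], by simp [hf]⟩, ?_⟩, ?_⟩, ?_⟩
      · constructor <;> simp [h0, h1, hcol, hhd, hmate, hnxt, hfirst]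
      · have := B.enqueue hw hd0 one_ne_zero (fun j hj => (hall j hj).le) (fun _ => by omega)
          (by omega) (fun _ => hc) (by omega)
        simpa using this
      · intro j hj
        by_cases hjq : j = σ.v vQt
        · simp [hjq]
        · rw [Function.update_of_ne hjq, Function.update_of_ne (hne j (by omega))]
          exact hall j (by omega)
      · intro h hh hlt hs
        by_cases he : 𝒩.hd h = 𝒩.hd i
        · simp [he]
        · rw [Function.update_of_ne he]
          refine hdone h hh ?_ hs
          have : h ≠ i := fun e => he (by rw [e])
          omega
    · refine ⟨⟨⟨⟨?_, by simp [hr], by simp [hf]⟩, by simpa using B⟩, hall⟩, ?_⟩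
      · constructor <;> simp [h0, h1, hcol, hhd, hmate, hnxt, hfirst]
      · intro h hh hlt hs
        by_cases he : h = i
        · obtain ⟨j, hj, e⟩ := B.mem _ hw hd0
          rw [he, ← e]
          exact hall j hj
        · exact hdone h hh (by omega) hs
    · refine ⟨⟨⟨⟨?_, by simp [hr], by simp [hf]⟩, by simpa using B⟩, hall⟩, ?_⟩
      · constructor <;> simp [h0, h1, hcol, hhd, hmate, hnxt, hfirst]
      · intro h hh hlt hs
        by_cases he : h = i
        · exact absurd hs (by rwa [he])
        · exact hdone h hh (by omega) hs
  · rintro s τ ⟨⟨⟨hI', hall⟩, hdone⟩, hs⟩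
    refine ⟨hI', ?_, by omega⟩
    rintro v ⟨h, hh, rfl⟩
    exact hdone h hh (Nat.pos_of_ne_zero hh.1)

/-- A removal shortens the queue, and a scan passes an arc. Appending a vertex lengthens the queue
by one, which the drop of `unseen` compensates. -/
theorem scanCmd_spec (wf : 𝒩.WF) (ft : Fits 𝒩 N W) {σ : St} (hI : BfsInv 𝒩 r f σ)
    (hsink : ∀ v, 𝒩.Vert v → 𝒩.col v = 2 → σ.a aD v = 1) (hlt : σ.v vQh < σ.v vQt) :
    WP 11 N W scanCmd σ 1 fun s τ => BfsInv 𝒩 r f τ ∧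
      (∀ v, 𝒩.Vert v → 𝒩.col v = 2 → τ.a aD v = 1) ∧ s ≤ 12 ∧
      𝒩.unscanned (τ.a aCur) + 𝒩.unseen (τ.a aD) + (τ.v vQt - τ.v vQh) + 1 ≤
        𝒩.unscanned (σ.a aCur) + 𝒩.unseen (σ.a aD) + (σ.v vQt - σ.v vQh) := by
  have hfn := ft.n
  have hfM := ft.M
  have hfW := ft.W
  have h1W : 1 ≤ W := by omega
  obtain ⟨⟨⟨h0, h1, hcol, hhd, hmate, hnxt, hfirst⟩, hr, hf⟩, B⟩ := hI
  have hcard := B.card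
  have hqN : σ.v vQh < N := by omega
  have hqW : σ.v vQh < W := by omega
  have htN : σ.v vQt < N := by omega
  have htW : σ.v vQt < W := by omega
  obtain ⟨hv, hv0⟩ := B.vert _ hlt
  have huN : σ.a aQ (σ.v vQh) < N := (wf.vert_lt hv).trans_le hfn
  by_cases hcur : σ.a aCur (σ.a aQ (σ.v vQh)) = 0
  · simp [scanCmd, hqN, huN, hcur, h1W, hqW]
    refine ⟨⟨⟨?_, by simp [hr], by simp [hf]⟩, ?_⟩, hsink, by omega⟩
    · constructor <;> simp [h0, h1, hcol, hhd, hmate, hnxt, hfirst]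
    · simpa using B.dequeue hlt hcur
  · obtain ⟨hca, hct⟩ := B.curOk _ hv hcur
    have hscan := fun h => B.scan wf hlt hcur h
    have hun := wf.unscanned_next B.curOk hv hcur
    have hlab := B.label_le hv
    have hnear := B.near hlt
    have hq := B.label _ hlt
    have hmono := B.mono (σ.v vQh) (σ.v vQt - 1)
    have henq := fun h₁ h₂ => B.enqueue (y := σ.a aD (σ.a aQ (σ.v vQh)) + 1)
      (Network.vert_hd hca) h₁ (Nat.succ_ne_zero _) hnear (fun _ => le_rfl) (by omega)
      (fun e => absurd e (by omega)) (fun _ => ⟨_, wf.mate_arc _ hca, wf.tail_mate hca, h₂,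
        by rw [Network.hd_mate, hct], by rw [Network.hd_mate, hct]; exact hv0⟩)
    have hseen := fun h₁ => Network.unseen_update (d := σ.a aD)
      (y := σ.a aD (σ.a aQ (σ.v vQh)) + 1) (Network.vert_hd hca) h₁ (Nat.succ_ne_zero _)
    set u := σ.a aQ (σ.v vQh) with hu
    set c := σ.a aCur u with hc
    have hcN : c < N := by have := hca.2; omega
    have hmN : 𝒩.mate c < N := by have := (wf.mate_arc c hca).2; omega
    have hwN : 𝒩.hd c < N := (wf.hd_lt c hca).trans_le hfn
    have hdW : σ.a aD u < W := by omega
    simp [scanCmd, enqueueCmd, ← hu, ← hc, hqN, huN, hcur, h1W, hcN, hhd, hmate, hmN, hwN, hdW,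
      htN, htW, hnxt, hr]
    refine ⟨fun hrc => ⟨fun hd0 => ?_, fun hd0 => ?_⟩, fun hrc => ?_⟩
    -- The vertex is appended before the pointer moves, so that the tail of the scanned arc already
    -- has a label.
    · have B' := henq hd0 hrc
      have hq' : Function.update (σ.a aQ) (σ.v vQt) (𝒩.hd c) (σ.v vQh) = u := by
        rw [Function.update_of_ne (by omega)]
      have B'' := B'.scan wf (by omega) (by rwa [hq']) (by
        intro _
        rw [hq', ← hc, Function.update_self]
        omega)
      rw [hq', ← hc] at B''
      refine ⟨⟨⟨?_, by simp [hr], by simp [hf]⟩, ?_⟩, ?_, ?_⟩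
      · constructor <;> simp [h0, h1, hcol, hhd, hmate, hnxt, hfirst]
      · simpa using B''
      · intro v hv hs
        have := hsink v hv hs
        rw [Function.update_of_ne, this]
        rintro rfl
        omega
      · have := hseen hd0
        omega
    · refine ⟨⟨⟨?_, by simp [hr], by simp [hf]⟩, ?_⟩, hsink, by omega⟩
      · constructor <;> simp [h0, h1, hcol, hhd, hmate, hnxt, hfirst]
      · simpa using hscan (fun _ => hd0)
    · refine ⟨⟨⟨?_, by simp [hr], by simp [hf]⟩, ?_⟩, hsink, by omega⟩
      · constructor <;> simp [h0, h1, hcol, hhd, hmate, hnxt, hfirst]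
      · simpa using hscan (fun h => absurd hrc h)

theorem bfsCmd_spec (wf : 𝒩.WF) (ft : Fits 𝒩 N W) {σ : St} {t : ℕ} (hB : Base 𝒩 r f σ) :
    WP 11 N W bfsCmd σ t fun s τ => Base 𝒩 r f τ ∧ 𝒩.Valid (τ.a aD) r ∧ 𝒩.Supp (τ.a aD) r ∧
      (∀ v, 𝒩.Vert v → τ.a aD v ≤ 𝒩.M) ∧ (∀ v, 𝒩.Vert v → τ.a aCur v = 𝒩.first v) ∧
      s ≤ t + 100 * (𝒩.M + 1) := by
  rw [bfsCmd, WP_seq]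
  refine (clearCmd_spec wf ft hB).mono ?_
  rintro s₁ σ₁ ⟨hB₁, hclear, hs₁⟩
  simp only [WP_seq (p := set vQh (const 0)), WP_seq (p := set vQt (const 0)), WP_set]
  refine ⟨by simp, by simp, ?_⟩
  rw [WP_seq]
  have hI : BfsInv 𝒩 r f ((σ₁.setv vQh (Exp.eval σ₁ (const 0))).setv vQt
      (Exp.eval (σ₁.setv vQh (Exp.eval σ₁ (const 0))) (const 0))) := by
    obtain ⟨⟨h0, h1, hcol, hhd, hmate, hnxt, hfirst⟩, hr, hf⟩ := hB₁
    refine ⟨⟨?_, by simp [hr], by simp [hf]⟩, ?_⟩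
    · constructor <;> simp [h0, h1, hcol, hhd, hmate, hnxt, hfirst]
    · simpa using wf.bfs_start (fun v hv => (hclear v hv).1) (fun v hv => (hclear v hv).2)
  refine (seedCmd_spec wf ft hI (by simp)).mono ?_
  rintro s₂ σ₂ ⟨hI₂, hsink₂, hs₂⟩
  rw [WP_seq]
  have hc₂ := hI₂.bfs.card
  have hun₂ := Network.unscanned_le (𝒩 := 𝒩) (σ₂.a aCur)
  -- Initially the bracket is at most `2 M`: `M` for the unscanned arcs and `M` for unseen arcs and
  -- queue together.
  apply WP_whl (fun φ σ => BfsInv 𝒩 r f σ ∧ (∀ v, 𝒩.Vert v → 𝒩.col v = 2 → σ.a aD v = 1) ∧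
    φ = 12 * (𝒩.unscanned (σ.a aCur) + 𝒩.unseen (σ.a aD) + (σ.v vQt - σ.v vQh))) _
    ⟨hI₂, hsink₂, rfl⟩
  · simp
  · rintro φ σ ⟨hI, hsink, rfl⟩ hc
    refine (scanCmd_spec wf ft hI hsink (by simpa using hc)).mono ?_
    rintro s τ ⟨hI', hsink', hs, hle⟩
    exact ⟨_, ⟨hI', hsink', rfl⟩, by omega⟩
  · rintro ψ s τ ⟨hI, hsink, rfl⟩ hc hs
    have hle := hI.bfs.le
    have hB := hI.bfs
    have hq : τ.v vQh = τ.v vQt := by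
      simp at hc
      omega
    rw [hq] at hB
    refine (resetCmd_spec (d := τ.a aD) wf ft hI.base rfl).mono ?_
    rintro s' τ' ⟨hB', hd, hcur, hs'⟩
    rw [hd]
    exact ⟨hB', hB.valid wf, hB.supp hsink, fun v hv => hB.label_le hv, hcur, by omega⟩

end HappyEdges

/-! ### The phases -/

namespace HappyEdges

open ArrayLang ArrayLang.Exp ArrayLang.Cmd

/-- One phase: both searches. The flag tells whether a unit has reached a sink. -/
def phaseCmd : Cmd := .seq (set vF (const 0)) (.seq bfsCmd dfsCmd)

/-- All phases. -/
def flowCmd : Cmd := .seq (set vF (const 1)) (whl (.ne (var vF) (const 0)) phaseCmd)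

/-- The distance of the sinks from the sources is at least `k`. -/
def Far (𝒩 : Network) (r : ℕ → ℕ) (k : ℕ) : Prop :=
  ∀ e, 𝒩.Supp e r → ∀ v, 𝒩.Vert v → 𝒩.col v = 1 → e v ≠ 0 → k < e v

/-- `D` and `c` are such that a distance of at least `D` forces a cut of capacity at most `c`. -/
def CutBound (𝒩 : Network) (D c : ℕ) : Prop :=
  ∀ d r, 𝒩.Paired r → 𝒩.Valid d r → (∀ h, 𝒩.Arc h → 𝒩.col (𝒩.hd h) = 2 → d (𝒩.hd h) = 1) →
    (∀ h, 𝒩.Arc h → 𝒩.col (𝒩.hd h) = 1 → d (𝒩.hd h) ≠ 0 → D < d (𝒩.hd h)) →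
    ∃ U, 𝒩.Sep U ∧ 𝒩.cut r U ≤ c

/-- After `δ` units have reached the sinks, `r` are the residual capacities. -/
structure FlowInv (𝒩 : Network) (cap : (ℕ → Prop) → ℕ) (δ : ℕ) (σ : St) : Prop where
  holds : Holds 𝒩 σ
  paired : 𝒩.Paired (σ.a aR)
  cutEq : ∀ U, 𝒩.Sep U → 𝒩.cut (σ.a aR) U + δ = cap U

variable {𝒩 : Network} {N W : ℕ} {cap : (ℕ → Prop) → ℕ} {δ k : ℕ}

/-- Either nothing is delivered and the set of label 0 is a minimum cut, or `δ` grows. In the second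
case the labels at the start of the phase are kept as a witness for the distance, to be fed into
`CutBound`. -/
theorem phaseCmd_spec (wf : 𝒩.WF) (ft : Fits 𝒩 N W) {σ : St} {t : ℕ}
    (I : FlowInv 𝒩 cap δ σ) (hfar : Far 𝒩 (σ.a aR) k) :
    WP 11 N W phaseCmd σ t fun s τ => s ≤ t + 301 * (𝒩.M + 1) ∧ ∃ δ', FlowInv 𝒩 cap δ' τ ∧
      Far 𝒩 (τ.a aR) (k + 1) ∧
      (τ.v vF = 0 ∧ 𝒩.Sep (fun v => τ.a aD v = 0) ∧ 𝒩.cut (τ.a aR) (fun v => τ.a aD v = 0) = 0 ∨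
      τ.v vF = 1 ∧ δ < δ' ∧ ∃ d, 𝒩.Valid d (σ.a aR) ∧
        (∀ h, 𝒩.Arc h → 𝒩.col (𝒩.hd h) = 2 → d (𝒩.hd h) = 1) ∧
        (∀ h, 𝒩.Arc h → 𝒩.col (𝒩.hd h) = 1 → d (𝒩.hd h) ≠ 0 → k < d (𝒩.hd h))) := by
  have hfM := ft.M
  rw [phaseCmd, WP_seq, WP_set]
  refine ⟨by simp, ?_⟩
  have hB : Base 𝒩 (σ.a aR) 0 (σ.setv vF (Exp.eval σ (const 0))) := by
    obtain ⟨⟨h0, h1, hcol, hhd, hmate, hnxt, hfirst⟩, hp, hc⟩ := I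
    refine ⟨?_, by simp, by simp⟩
    constructor <;> simp [h0, h1, hcol, hhd, hmate, hnxt, hfirst]
  rw [WP_seq]
  refine (bfsCmd_spec wf ft hB).mono ?_
  rintro s₁ σ₁ ⟨hB₁, hvalid, hsupp, hlab, hcur, hs₁⟩
  set r := σ.a aR with hr
  set d := σ₁.a aD with hd
  have hsink : ∀ v, 𝒩.Vert v → (d v = 1 ↔ 𝒩.col v = 2) := by
    rintro v ⟨h, hh, rfl⟩
    exact hsupp.sink h hh
  have D₁ : DfsDone 𝒩 d r δ cap δ σ₁ := by
    refine ⟨hB₁.holds, rfl, ?_, Or.inl ⟨hB₁.flag, rfl⟩⟩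
    rw [hB₁.cap]
    refine ⟨I.paired, hvalid, by simpa using I.cutEq, le_rfl, by simp, ?_, ?_, ?_⟩
    · intro v hv h0
      rw [hcur v hv] at h0 ⊢
      exact ⟨⟨h0, wf.first_le v⟩, wf.first_tail v h0⟩
    · intro h hh hlt
      rw [hcur _ (wf.vert_tail hh)] at hlt
      have := wf.le_first h hh
      omega
    · intro v hv _
      rw [hcur v hv]
      obtain ⟨h, hh, rfl⟩ := hv
      have h₁ := wf.le_first _ (wf.mate_arc h hh)
      rw [wf.tail_mate hh] at h₁
      have h₂ := (wf.mate_arc h hh).1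
      omega
  refine (dfsCmd_spec wf ft hsink (fun v hv => by have := hlab v hv; omega) D₁).mono ?_
  rintro s₂ τ ⟨δ', ⟨hH, hD, H, hflag⟩, hdead, hs₂⟩
  refine ⟨by omega, δ', ⟨hH, H.paired, by simpa using H.cutEq⟩, ?_, ?_⟩
  · intro e he v hv hs h0
    obtain ⟨h₁, h₂, h₃⟩ := H.le_label hsink he hv h0
    have h₄ := hfar d hsupp v hv hs h₁
    have h₅ : d v ≠ e v := fun h => h₃ h (hdead v hv hs)
    omega
  · rcases hflag with ⟨hf, hδ⟩ | ⟨hf, hδ⟩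
    · left
      rw [hD]
      refine ⟨hf, ?_, ?_⟩
      · intro h hh
        constructor
        · intro hs
          -- A source with a label would still have unscanned arcs, but the search has exhausted all
          -- sources.
          by_contra h0
          exact H.unscanned_of_label (fun _ => id) hδ hsupp (Network.vert_hd hh) h0
            (hdead _ (Network.vert_hd hh) hs)
        · intro hs
          have := (hsupp.sink h hh).2 hs
          change ¬ d (𝒩.hd h) = 0
          omega
      -- By validity no residual arc leads from label 0, which is infinity, to a finite label.
      · rw [Network.cut, Network.weight]
        refine Finset.sum_eq_zero fun h hh => ?_
        have hh := Network.mem_Icc_iff_arc.1 hh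
        split_ifs with hU
        · have : τ.a aR h = 0 := by
            by_contra hr0
            exact (H.valid h hh hr0 hU.2).1 hU.1
          rw [this, mul_zero]
        · exact zero_mul _
    · right
      exact ⟨hf, hδ, d, hvalid, fun h hh => (hsupp.sink h hh).2,
        fun h hh hs h0 => hfar d hsupp _ (Network.vert_hd hh) hs h0⟩

theorem flowCmd_spec (wf : 𝒩.WF) (ft : Fits 𝒩 N W) {D c : ℕ} (hDc : CutBound 𝒩 D c)
    {σ : St} {t : ℕ} (I : FlowInv 𝒩 cap 0 σ) :
    WP 11 N W flowCmd σ t fun s τ => Holds 𝒩 τ ∧ 𝒩.Sep (fun v => τ.a aD v = 0) ∧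
      (∀ U, 𝒩.Sep U → cap (fun v => τ.a aD v = 0) ≤ cap U) ∧
      s ≤ t + 2 + 302 * (𝒩.M + 1) * (1 + D + c) := by
  obtain ⟨U₀, hU₀, hmin⟩ : ∃ U₀, 𝒩.Sep U₀ ∧ ∀ U, 𝒩.Sep U → cap U₀ ≤ cap U := by
    have hne : ∃ x, ∃ U, 𝒩.Sep U ∧ cap U = x :=
      -- Some separating set exists, so a minimum is attained.
      ⟨_, fun v => 𝒩.col v ≠ 2, fun h _ => ⟨fun e => by simp [e], fun e => by simp [e]⟩, rfl⟩
    classical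
    obtain ⟨U, hU, e⟩ := Nat.find_spec hne
    exact ⟨U, hU, fun U' hU' => e ▸ Nat.find_min' hne ⟨U', hU', rfl⟩⟩
  have hW := ft.W
  rw [flowCmd, WP_seq, WP_set]
  refine ⟨by simp; omega, ?_⟩
  -- At most `D` phases pass until the distance reaches `D`, and then at most `c` units are missing.
  -- The sum of both counts, with the missing units truncated at `c`, drops in every phase that
  -- delivers a unit; the summand 1 pays for the last phase.
  apply WP_whl (fun φ σ => ∃ δ k, FlowInv 𝒩 cap δ σ ∧ Far 𝒩 (σ.a aR) k ∧
    (σ.v vF = 1 ∧ φ = 302 * (𝒩.M + 1) * (1 + (D - k) + min c (cap U₀ - δ)) ∨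
    σ.v vF = 0 ∧ φ = 0 ∧ 𝒩.Sep (fun v => σ.a aD v = 0) ∧
      𝒩.cut (σ.a aR) (fun v => σ.a aD v = 0) = 0))
    (302 * (𝒩.M + 1) * (1 + (D - 0) + min c (cap U₀ - 0)))
  · obtain ⟨⟨h0, h1, hcol, hhd, hmate, hnxt, hfirst⟩, hp, hc⟩ := I
    refine ⟨0, 0, ⟨?_, by simpa using hp, by simpa using hc⟩,
      fun e _ v _ _ h => Nat.pos_of_ne_zero h, Or.inl ⟨by simp, rfl⟩⟩
    constructor <;> simp [h0, h1, hcol, hhd, hmate, hnxt, hfirst]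
  · simp
  · rintro φ σ ⟨δ, k, I, hfar, ⟨hf, rfl⟩ | ⟨hf, -⟩⟩ hc
    · refine (phaseCmd_spec wf ft I hfar).mono ?_
      rintro s τ ⟨hs, δ', I', hfar', ⟨hf', hsep, hcut⟩ | ⟨hf', hδ, d, hv, hsink, hsrc⟩⟩
      · refine ⟨0, ⟨δ', k + 1, I', hfar', Or.inr ⟨hf', rfl, hsep, hcut⟩⟩, ?_⟩
        have : 302 * (𝒩.M + 1) * 1 ≤
            302 * (𝒩.M + 1) * (1 + (D - k) + min c (cap U₀ - δ)) :=
          Nat.mul_le_mul_left _ (by omega)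
        omega
      · refine ⟨_, ⟨δ', k + 1, I', hfar', Or.inl ⟨hf', rfl⟩⟩, ?_⟩
        have hδ' : δ' ≤ cap U₀ := by
          have := I'.cutEq U₀ hU₀
          omega
        have hle : 1 + (D - (k + 1)) + min c (cap U₀ - δ') + 1 ≤
            1 + (D - k) + min c (cap U₀ - δ) := by
          -- For `k < D` the first count drops. Otherwise the small cut shows that at most `c` units
          -- were missing, so the truncation is inactive and the growth of `δ` lowers the second
          -- count.
          by_cases hk : k < D
          · omega
          · obtain ⟨U, hU, hcU⟩ := hDc d _ I.paired hv hsink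
              (fun h hh hs h0 => lt_of_le_of_lt (not_lt.1 hk) (hsrc h hh hs h0))
            have h₁ := I.cutEq U hU
            have h₂ := hmin U hU
            omega
        have := Nat.mul_le_mul_left (302 * (𝒩.M + 1)) hle
        rw [mul_add _ _ 1] at this
        omega
    · simp [hf] at hc
  · rintro ψ s τ ⟨δ, k, I, hfar, ⟨hf, rfl⟩ | ⟨hf, rfl, hsep, hcut⟩⟩ hc hs
    · simp [hf] at hc
    · refine ⟨I.holds, hsep, ?_, ?_⟩
      · intro U hU
        have h₁ := I.cutEq _ hsep
        have h₂ := I.cutEq U hU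
        omega
      · have : 302 * (𝒩.M + 1) * (1 + (D - 0) + min c (cap U₀ - 0)) ≤
            302 * (𝒩.M + 1) * (1 + D + c) := Nat.mul_le_mul_left _ (by omega)
        omega

end HappyEdges

/-! ### Construction of the network -/

namespace Network

/-- Add an edge between `u` and `w`, with the arcs `M + 1` and `M + 2`. -/
def addEdge (𝒩 : Network) (u w : ℕ) : Network where
  n := 𝒩.n
  M := 𝒩.M + 2
  hd := Function.update (Function.update 𝒩.hd (𝒩.M + 1) w) (𝒩.M + 2) u
  mate := Function.update (Function.update 𝒩.mate (𝒩.M + 1) (𝒩.M + 2)) (𝒩.M + 2) (𝒩.M + 1)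
  nxt := Function.update (Function.update 𝒩.nxt (𝒩.M + 1) (𝒩.first u)) (𝒩.M + 2) (𝒩.first w)
  first := Function.update (Function.update 𝒩.first u (𝒩.M + 1)) w (𝒩.M + 2)
  col := 𝒩.col

variable {𝒩 : Network} {u w : ℕ}

theorem addEdge_arc {h : ℕ} : (𝒩.addEdge u w).Arc h ↔ 𝒩.Arc h ∨ h = 𝒩.M + 1 ∨ h = 𝒩.M + 2 := by
  simp only [Arc, addEdge]
  omega

theorem addEdge_hd {h : ℕ} (hh : 𝒩.Arc h) : (𝒩.addEdge u w).hd h = 𝒩.hd h := by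
  have := hh.2
  simp only [addEdge]
  rw [Function.update_of_ne (by omega), Function.update_of_ne (by omega)]

theorem addEdge_mate {h : ℕ} (hh : 𝒩.Arc h) : (𝒩.addEdge u w).mate h = 𝒩.mate h := by
  have := hh.2
  simp only [addEdge]
  rw [Function.update_of_ne (by omega), Function.update_of_ne (by omega)]

theorem addEdge_nxt {h : ℕ} (hh : 𝒩.Arc h) : (𝒩.addEdge u w).nxt h = 𝒩.nxt h := by
  have := hh.2
  simp only [addEdge]
  rw [Function.update_of_ne (by omega), Function.update_of_ne (by omega)]

theorem WF.addEdge_tail (wf : 𝒩.WF) {h : ℕ} (hh : 𝒩.Arc h) :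
    (𝒩.addEdge u w).tail h = 𝒩.tail h := by
  rw [tail, addEdge_mate hh, addEdge_hd (wf.mate_arc h hh), tail]

theorem addEdge_values : (𝒩.addEdge u w).hd (𝒩.M + 1) = w ∧ (𝒩.addEdge u w).hd (𝒩.M + 2) = u ∧
    (𝒩.addEdge u w).mate (𝒩.M + 1) = 𝒩.M + 2 ∧ (𝒩.addEdge u w).mate (𝒩.M + 2) = 𝒩.M + 1 ∧
    (𝒩.addEdge u w).nxt (𝒩.M + 1) = 𝒩.first u ∧ (𝒩.addEdge u w).nxt (𝒩.M + 2) = 𝒩.first w ∧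
    (𝒩.addEdge u w).tail (𝒩.M + 1) = u ∧ (𝒩.addEdge u w).tail (𝒩.M + 2) = w := by
  simp [addEdge, tail]

/-- The new arcs have the largest numbers and go to the front of their lists, so the lists stay
decreasing. The last two hypotheses exclude parallel arcs. -/
theorem WF.addEdge (wf : 𝒩.WF) (hu : u < 𝒩.n) (hw : w < 𝒩.n) (huw : u ≠ w)
    (h₁ : ∀ h, 𝒩.Arc h → 𝒩.tail h = u → 𝒩.hd h ≠ w)
    (h₂ : ∀ h, 𝒩.Arc h → 𝒩.tail h = w → 𝒩.hd h ≠ u) : (𝒩.addEdge u w).WF := by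
  obtain ⟨v₁, v₂, v₃, v₄, v₅, v₆, v₇, v₈⟩ := addEdge_values (𝒩 := 𝒩) (u := u) (w := w)
  have hfirst : ∀ v, (𝒩.addEdge u w).first v =
      if v = w then 𝒩.M + 2 else if v = u then 𝒩.M + 1 else 𝒩.first v := by
    intro v
    simp only [Network.addEdge, Function.update_apply]
  have hfa : ∀ v, 𝒩.first v ≠ 0 → 𝒩.Arc (𝒩.first v) := fun v hv => ⟨hv, wf.first_le v⟩
  constructor
  · intro h hh
    rcases addEdge_arc.1 hh with hh | rfl | rfl
    · rw [addEdge_hd hh]; exact wf.hd_lt h hh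
    · rw [v₁]; exact hw
    · rw [v₂]; exact hu
  · intro h hh
    rw [addEdge_arc]
    rcases addEdge_arc.1 hh with hh | rfl | rfl
    · rw [addEdge_mate hh]; exact Or.inl (wf.mate_arc h hh)
    · exact Or.inr (Or.inr v₃)
    · exact Or.inr (Or.inl v₄)
  · intro h hh
    rcases addEdge_arc.1 hh with hh | rfl | rfl
    · rw [addEdge_mate hh, addEdge_mate (wf.mate_arc h hh)]; exact wf.mate_mate h hh
    · rw [v₃, v₄]
    · rw [v₄, v₃]
  · intro h hh
    rcases addEdge_arc.1 hh with hh | rfl | rfl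
    · rw [addEdge_mate hh]; exact wf.mate_ne h hh
    · rw [v₃]; omega
    · rw [v₄]; omega
  · intro h hh
    rcases addEdge_arc.1 hh with hh | rfl | rfl
    · rw [wf.addEdge_tail hh, addEdge_hd hh]; exact wf.tail_ne h hh
    · rw [v₇, v₁]; exact huw
    · rw [v₈, v₂]; exact huw.symm
  · intro h k hh hk et eh
    rcases addEdge_arc.1 hh with hh | rfl | rfl <;> rcases addEdge_arc.1 hk with hk | rfl | rfl
    · rw [wf.addEdge_tail hh, wf.addEdge_tail hk] at et
      rw [addEdge_hd hh, addEdge_hd hk] at eh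
      exact wf.inj h k hh hk et eh
    · rw [wf.addEdge_tail hh, v₇] at et
      rw [addEdge_hd hh, v₁] at eh
      exact absurd eh (h₁ h hh et)
    · rw [wf.addEdge_tail hh, v₈] at et
      rw [addEdge_hd hh, v₂] at eh
      exact absurd eh (h₂ h hh et)
    · rw [wf.addEdge_tail hk, v₇] at et
      rw [addEdge_hd hk, v₁] at eh
      exact absurd eh.symm (h₁ k hk et.symm)
    · rfl
    · rw [v₇, v₈] at et
      exact absurd et huw
    · rw [wf.addEdge_tail hk, v₈] at et
      rw [addEdge_hd hk, v₂] at eh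
      exact absurd eh.symm (h₂ k hk et.symm)
    · rw [v₇, v₈] at et
      exact absurd et.symm huw
    · rfl
  · intro v
    have := wf.first_le v
    rw [hfirst]
    change _ ≤ 𝒩.M + 2
    split_ifs <;> omega
  · intro v hv
    rw [hfirst] at hv ⊢
    split_ifs with e₁ e₂
    · rw [v₈, e₁]
    · rw [v₇, e₂]
    · rw [if_neg e₁, if_neg e₂] at hv
      rw [wf.addEdge_tail (hfa v hv)]
      exact wf.first_tail v hv
  · intro h hh
    rw [hfirst]
    rcases addEdge_arc.1 hh with hh | rfl | rfl
    · rw [wf.addEdge_tail hh]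
      have := wf.le_first h hh
      have := hh.2
      split_ifs <;> omega
    · rw [v₇, if_neg huw, if_pos rfl]
    · rw [v₈, if_pos rfl]
  · intro h hh
    rcases addEdge_arc.1 hh with hh | rfl | rfl
    · rw [addEdge_nxt hh]; exact wf.nxt_lt h hh
    · rw [v₅]; exact Nat.lt_succ_of_le (wf.first_le u)
    · rw [v₆]; exact Nat.lt_succ_of_le ((wf.first_le w).trans (Nat.le_succ _))
  · intro h hh h0
    rcases addEdge_arc.1 hh with hh | rfl | rfl
    · rw [addEdge_nxt hh] at h0 ⊢
      have h₃ := wf.nxt_lt h hh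
      have h₄ := hh.2
      rw [wf.addEdge_tail ⟨h0, by omega⟩, wf.addEdge_tail hh]
      exact wf.nxt_tail h hh h0
    · rw [v₅] at h0 ⊢
      rw [wf.addEdge_tail (hfa _ h0), v₇, wf.first_tail _ h0]
    · rw [v₆] at h0 ⊢
      rw [wf.addEdge_tail (hfa _ h0), v₈, wf.first_tail _ h0]
  · intro h k hh hk hlt et
    rcases addEdge_arc.1 hh with hh | rfl | rfl
    · have hk' : 𝒩.Arc k := ⟨hk.1, by have := hh.2; omega⟩
      rw [wf.addEdge_tail hh, wf.addEdge_tail hk'] at et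
      rw [addEdge_nxt hh]
      exact wf.le_nxt h k hh hk' hlt et
    · have hk' : 𝒩.Arc k := ⟨hk.1, by omega⟩
      rw [wf.addEdge_tail hk', v₇] at et
      rw [v₅, ← et]
      exact wf.le_first k hk'
    · rcases addEdge_arc.1 hk with hk' | rfl | rfl
      · rw [wf.addEdge_tail hk', v₈] at et
        rw [v₆, ← et]
        exact wf.le_first k hk'
      · rw [v₇, v₈] at et
        exact absurd et huw
      · omega

end Network

/-! ### Reading the adjacency lists into the network -/

namespace HappyEdges

open ArrayLang ArrayLang.Exp ArrayLang.Cmd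

/-- The array `a` holds a graph on the vertices below `n` with the adjacency lists `L`, of total
length `m₂`, where the list of `v` starts at the position `off v`, and the colours `col`. -/
structure IsInput (n m₂ : ℕ) (L : ℕ → List ℕ) (col off a : ℕ → ℕ) : Prop where
  zero : a 0 = n
  col : ∀ v < n, a (v + 2) = col v
  len : ∀ v < n, a (n + 2 + v) = (L v).length
  adj : ∀ v < n, ∀ j, (hj : j < (L v).length) → a (n + n + 2 + (off v + j)) = (L v)[j]
  off_zero : off 0 = 0
  off_succ : ∀ v < n, off (v + 1) = off v + (L v).length
  off_le : ∀ v ≤ n, off v ≤ m₂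
  nodup : ∀ v < n, (L v).Nodup
  lt : ∀ v < n, ∀ w ∈ L v, w < n
  card : ∀ (M : ℕ) (g : ℕ → ℕ × ℕ), (∀ h, h ≠ 0 → h ≤ M → (g h).1 < n ∧ (g h).2 < n ∧
    ((g h).2 ∈ L (g h).1 ∨ (g h).1 ∈ L (g h).2)) →
    (∀ h k, h ≠ 0 → h ≤ M → k ≠ 0 → k ≤ M → g h = g k → h = k) → M ≤ m₂

/-- The network in a state. -/
def netOf (n : ℕ) (σ : St) : Network where
  n := n
  M := σ.v vE
  hd := σ.a aHd
  mate := σ.a aMate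
  nxt := σ.a aNxt
  first := σ.a aFirst
  col := σ.a aCol

/-- The edge between `x` and `y` is found before the entry `j` of the list of `u`. -/
def Found (L : ℕ → List ℕ) (u j x y : ℕ) : Prop :=
  x < y ∧ (x < u ∧ y ∈ L x ∨ x = u ∧ y ∈ (L u).take j)

/-- The network consists of the edges found so far. -/
structure Build (L : ℕ → List ℕ) (u j : ℕ) (𝒩 : Network) (r : ℕ → ℕ) : Prop where
  wf : 𝒩.WF
  one : ∀ h, 𝒩.Arc h → r h = 1
  sound : ∀ h, 𝒩.Arc h → Found L u j (𝒩.tail h) (𝒩.hd h) ∨ Found L u j (𝒩.hd h) (𝒩.tail h)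
  complete : ∀ x y, Found L u j x y → ∃ h, 𝒩.Arc h ∧ 𝒩.tail h = x ∧ 𝒩.hd h = y

section

variable {n m₂ : ℕ} {L : ℕ → List ℕ} {col off a r : ℕ → ℕ} {u j : ℕ} {𝒩 : Network}

theorem Found.mem {x y : ℕ} (h : Found L u j x y) : y ∈ L x := by
  obtain ⟨-, ⟨-, h⟩ | ⟨rfl, h⟩⟩ := h
  · exact h
  · exact List.mem_of_mem_take h

theorem found_succ (hj : j < (L u).length) {x y : ℕ} :
    Found L u (j + 1) x y ↔ Found L u j x y ∨ u < (L u)[j] ∧ x = u ∧ y = (L u)[j] := by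
  have : ∀ y, y ∈ (L u).take (j + 1) ↔ y ∈ (L u).take j ∨ y = (L u)[j] := by
    intro y
    rw [List.take_succ_eq_append_getElem hj, List.mem_append, List.mem_singleton]
  rw [Found, Found, this]
  constructor
  · rintro ⟨h, h' | ⟨rfl, h' | rfl⟩⟩
    · exact Or.inl ⟨h, Or.inl h'⟩
    · exact Or.inl ⟨h, Or.inr ⟨rfl, h'⟩⟩
    · exact Or.inr ⟨h, rfl, rfl⟩
  · rintro (⟨h, h' | ⟨rfl, h'⟩⟩ | ⟨h, rfl, rfl⟩)
    · exact ⟨h, Or.inl h'⟩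
    · exact ⟨h, Or.inr ⟨rfl, Or.inl h'⟩⟩
    · exact ⟨h, Or.inr ⟨rfl, Or.inr rfl⟩⟩

theorem found_next {x y : ℕ} : Found L (u + 1) 0 x y ↔ Found L u (L u).length x y := by
  simp only [Found, List.take_zero, List.not_mem_nil, and_false, or_false, List.take_length,
    Nat.lt_succ_iff_lt_or_eq]
  constructor
  · rintro ⟨h, h' | rfl, h''⟩
    · exact ⟨h, Or.inl ⟨h', h''⟩⟩
    · exact ⟨h, Or.inr ⟨rfl, h''⟩⟩
  · rintro ⟨h, ⟨h', h''⟩ | ⟨rfl, h''⟩⟩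
    · exact ⟨h, Or.inl h', h''⟩
    · exact ⟨h, Or.inr rfl, h''⟩

theorem Build.congr {u' j' : ℕ} (B : Build L u j 𝒩 r)
    (h : ∀ x y, Found L u' j' x y ↔ Found L u j x y) : Build L u' j' 𝒩 r := by
  refine ⟨B.wf, B.one, ?_, ?_⟩
  · simpa only [h] using B.sound
  · simpa only [h] using B.complete

/-- Different arcs are different ordered pairs of adjacent vertices. This bound keeps arc numbers
within the arrays even before the construction is complete. -/
theorem Build.le (I : IsInput n m₂ L col off a) (B : Build L u j 𝒩 r) (hn : 𝒩.n = n) :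
    𝒩.M ≤ m₂ := by
  refine I.card 𝒩.M (fun h => (𝒩.tail h, 𝒩.hd h)) ?_ ?_
  · intro h h₀ h₁
    have hh : 𝒩.Arc h := ⟨h₀, h₁⟩
    refine ⟨hn ▸ B.wf.tail_lt hh, hn ▸ B.wf.hd_lt h hh, ?_⟩
    exact (B.sound h hh).imp Found.mem Found.mem
  · intro h k h₀ h₁ k₀ k₁ e
    simp only [Prod.mk.injEq] at e
    exact B.wf.inj h k ⟨h₀, h₁⟩ ⟨k₀, k₁⟩ e.1 e.2

theorem Build.addEdge (I : IsInput n m₂ L col off a) (B : Build L u j 𝒩 r) (hn : 𝒩.n = n)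
    (hu : u < n) (hj : j < (L u).length) (hlt : u < (L u)[j]) :
    Build L u (j + 1) (𝒩.addEdge u (L u)[j])
      (Function.update (Function.update r (𝒩.M + 1) 1) (𝒩.M + 2) 1) := by
  have wf := B.wf
  set w := (L u)[j] with hw
  have hwn : w < n := I.lt u hu w (List.getElem_mem hj)
  -- Lists have no repetitions, so the edge has not been found earlier in this list.
  have hnew : w ∉ (L u).take j := by
    intro h
    rw [List.mem_take_iff_getElem] at h
    obtain ⟨i, hi, e⟩ := h
    have := (I.nodup u hu).getElem_inj_iff.1 (e.trans hw)
    omega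
  have hnot₁ : ¬ Found L u j u w := by
    rintro ⟨-, ⟨h, -⟩ | ⟨-, h⟩⟩
    · omega
    · exact hnew h
  have hnot₂ : ¬ Found L u j w u := by
    rintro ⟨h, -⟩
    omega
  obtain ⟨v₁, v₂, v₃, v₄, v₅, v₆, v₇, v₈⟩ := Network.addEdge_values (𝒩 := 𝒩) (u := u) (w := w)
  refine ⟨wf.addEdge (hn ▸ hu) (hn ▸ hwn) hlt.ne ?_ ?_, ?_, ?_, ?_⟩
  · intro h hh et e
    have := B.sound h hh
    rw [et, e] at this
    exact this.elim hnot₁ hnot₂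
  · intro h hh et e
    have := B.sound h hh
    rw [et, e] at this
    exact this.elim hnot₂ hnot₁
  · intro h hh
    rcases Network.addEdge_arc.1 hh with hh | rfl | rfl
    · have := hh.2
      rw [Function.update_of_ne (by omega), Function.update_of_ne (by omega)]
      exact B.one h hh
    · simp
    · simp
  · intro h hh
    rcases Network.addEdge_arc.1 hh with hh | rfl | rfl
    · rw [wf.addEdge_tail hh, Network.addEdge_hd hh, found_succ hj, found_succ hj]
      exact (B.sound h hh).imp Or.inl Or.inl
    · rw [v₇, v₁, found_succ hj]
      exact Or.inl (Or.inr ⟨hlt, rfl, rfl⟩)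
    · rw [v₈, v₂, found_succ hj, found_succ hj]
      exact Or.inr (Or.inr ⟨hlt, rfl, rfl⟩)
  · intro x y hxy
    rcases (found_succ hj).1 hxy with hxy | ⟨-, rfl, rfl⟩
    · obtain ⟨h, hh, et, eh⟩ := B.complete x y hxy
      exact ⟨h, Network.addEdge_arc.2 (Or.inl hh), by rw [wf.addEdge_tail hh, et],
        by rw [Network.addEdge_hd hh, eh]⟩
    · exact ⟨𝒩.M + 1, Network.addEdge_arc.2 (Or.inr (Or.inl rfl)), v₇, v₁⟩

end

/-- Add the edge between `vU` and `vW` to the network. -/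
def edgeCmd : Cmd :=
  .seq (put aHd (add (var vE) (const 1)) (var vW)) <|
  .seq (put aHd (add (var vE) (const 2)) (var vU)) <|
  .seq (put aMate (add (var vE) (const 1)) (add (var vE) (const 2))) <|
  .seq (put aMate (add (var vE) (const 2)) (add (var vE) (const 1))) <|
  .seq (put aNxt (add (var vE) (const 1)) (arr aFirst (var vU))) <|
  .seq (put aNxt (add (var vE) (const 2)) (arr aFirst (var vW))) <|
  .seq (put aFirst (var vU) (add (var vE) (const 1))) <|
  .seq (put aFirst (var vW) (add (var vE) (const 2))) <|
  .seq (put aR (add (var vE) (const 1)) (const 1)) <|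
  .seq (put aR (add (var vE) (const 2)) (const 1)) <|
  set vE (add (var vE) (const 2))

/-- Process one entry of an adjacency list. -/
def entryCmd : Cmd :=
  .seq (set vW (arr aInOut (var vP))) <|
  .seq (ite (.lt (var vU) (var vW)) edgeCmd (set vW (var vW))) <|
  .seq (set vP (add (var vP) (const 1))) <|
  set vLeft (sub (var vLeft) (const 1))

/-- Process the adjacency list of a vertex. -/
def listCmd : Cmd :=
  .seq (set vLeft (arr aInOut (add (add (var vN) (const 2)) (var vU)))) <|
  .seq (whl (.ne (var vLeft) (const 0)) entryCmd) <|
  set vU (add (var vU) (const 1))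

/-- Copy the colours. -/
def colourCmd : Cmd :=
  .seq (set vI (const 0)) <| whl (.lt (var vI) (var vN)) <|
    .seq (put aCol (var vI) (arr aInOut (add (var vI) (const 2)))) <|
    set vI (add (var vI) (const 1))

/-- Construct the network. -/
def buildCmd : Cmd :=
  .seq (set vN (arr aInOut (const 0))) <|
  .seq colourCmd <|
  .seq (set vU (const 0)) <|
  .seq (set vE (const 0)) <|
  .seq (set vP (add (add (var vN) (var vN)) (const 2))) <|
  .seq (whl (.lt (var vU) (var vN)) listCmd) <|
  set vM (var vE)

end HappyEdges

/-! ### Correctness and cost of the construction -/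

namespace HappyEdges

open ArrayLang ArrayLang.Exp ArrayLang.Cmd

variable {n m₂ N W : ℕ} {L : ℕ → List ℕ} {col off a : ℕ → ℕ} {u j : ℕ}

/-- The invariant of the construction, before the entry `j` of the list of `u`. -/
structure BuildInv (n : ℕ) (L : ℕ → List ℕ) (col off a : ℕ → ℕ) (u j : ℕ) (σ : St) : Prop where
  vn : σ.v vN = n
  vu : σ.v vU = u
  vp : σ.v vP = n + n + 2 + (off u + j)
  io : σ.a aInOut = a
  colour : ∀ v < n, σ.a aCol v = col v
  build : Build L u j (netOf n σ) (σ.a aR)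

theorem entryCmd_spec (I : IsInput n m₂ L col off a) (hN : N = 2 * n + 2 + m₂) (hW : N + 3 ≤ W)
    (hu : u < n) (hj : j < (L u).length) {σ : St} (B : BuildInv n L col off a u j σ)
    (hl : σ.v vLeft = (L u).length - j) :
    WP 11 N W entryCmd σ 1 fun s τ => BuildInv n L col off a u (j + 1) τ ∧
      τ.v vLeft = (L u).length - (j + 1) ∧ s ≤ 20 := by
  obtain ⟨h0, hU, hp, hio, hcol, hb⟩ := B
  have hM := hb.le I rfl
  change σ.v vE ≤ m₂ at hM
  have hoff := I.off_le (u + 1) hu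
  rw [I.off_succ u hu] at hoff
  have hw := I.adj u hu j hj
  have hwn : (L u)[j] < n := I.lt u hu _ (List.getElem_mem hj)
  have hpN : n + n + 2 + (off u + j) < N := by omega
  have hpW : n + n + 2 + (off u + j) < W := by omega
  have huN : u < N := by omega
  have hwN : (L u)[j] < N := by omega
  have h1W : 1 ≤ W := by omega
  have h2W : 2 ≤ W := by omega
  have he₁ : σ.v vE + 1 < N := by omega
  have he₂ : σ.v vE + 2 < N := by omega
  have he₃ : σ.v vE < W := by omega
  have he₄ : σ.v vE + 2 ≤ W := by omega
  simp [entryCmd, edgeCmd, hio, hp, hw, hU, hpN, hpW, huN, hwN, h1W, h2W, he₁, he₂, he₃, he₄]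
  refine ⟨fun hlt => ⟨?_, by omega⟩, fun hlt => ⟨?_, by omega⟩⟩
  · refine ⟨by simp [h0], by simp [hU], by simp; omega, by simp [hio], by simpa using hcol, ?_⟩
    have B' := hb.addEdge I rfl hu hj hlt
    convert B' using 1
    · simp [netOf, Network.addEdge]
    · simp [netOf]
  · refine ⟨by simp [h0], by simp [hU], by simp; omega, by simp [hio], by simpa using hcol, ?_⟩
    -- Each edge is recorded only from its smaller end, so an entry that is not larger than `u` adds
    -- nothing.
    have B' := hb.congr (u' := u) (j' := j + 1) (fun x y => by
      rw [found_succ hj]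
      exact or_iff_left fun h => absurd h.1 (by omega))
    convert B' using 1 <;> simp [netOf]

theorem listCmd_spec (I : IsInput n m₂ L col off a) (hN : N = 2 * n + 2 + m₂) (hW : N + 3 ≤ W)
    (hu : u < n) {σ : St} (B : BuildInv n L col off a u 0 σ) :
    WP 11 N W listCmd σ 1 fun s τ => BuildInv n L col off a (u + 1) 0 τ ∧
      s ≤ 4 + 20 * (L u).length := by
  rw [listCmd, WP_seq, WP_set]
  refine ⟨?_, ?_⟩
  · simp [B.vn, B.vu]
    omega
  rw [WP_seq]
  apply WP_whl (fun φ σ => ∃ j ≤ (L u).length, BuildInv n L col off a u j σ ∧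
    σ.v vLeft = (L u).length - j ∧ φ = 20 * ((L u).length - j)) (20 * ((L u).length - 0))
  · refine ⟨0, by omega, ?_, ?_, rfl⟩
    · obtain ⟨h0, hU, hp, hio, hcol, hb⟩ := B
      refine ⟨by simp [h0], by simp [hU], by simp [hp], by simp [hio], by simpa using hcol, ?_⟩
      convert hb using 1 <;> simp [netOf]
    · simp [B.vn, B.vu, B.io, I.len u hu]
  · simp
  · rintro φ σ ⟨j, hj, B, hl, rfl⟩ hc
    have hj' : j < (L u).length := by
      have : σ.v vLeft ≠ 0 := by simpa using hc
      omega
    refine (entryCmd_spec I hN hW hu hj' B hl).mono ?_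
    rintro s τ ⟨B', hl', hs⟩
    exact ⟨_, ⟨j + 1, hj', B', hl', rfl⟩, by omega⟩
  · rintro ψ s τ ⟨j, hj, B, hl, rfl⟩ hc hs
    have hj' : j = (L u).length := by
      have : τ.v vLeft = 0 := by simpa using hc
      omega
    subst hj'
    obtain ⟨h0, hU, hp, hio, hcol, hb⟩ := B
    simp [hU]
    refine ⟨by omega, ⟨by simp [h0], by simp, ?_, by simp [hio], by simpa using hcol, ?_⟩, by omega⟩
    · simp [hp, I.off_succ u hu]
    · have := hb.congr (u' := u + 1) (j' := 0) (fun x y => found_next)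
      convert this using 1 <;> simp [netOf]

/-- The result of the construction. -/
structure Built (n : ℕ) (L : ℕ → List ℕ) (col : ℕ → ℕ) (𝒩 : Network) (r : ℕ → ℕ) : Prop where
  n_eq : 𝒩.n = n
  colour : ∀ v < n, 𝒩.col v = col v
  build : Build L n 0 𝒩 r

theorem buildCmd_spec (I : IsInput n m₂ L col off a) (hN : N = 2 * n + 2 + m₂) (hW : N + 3 ≤ W)
    {σ : St} {t : ℕ} (ha : σ.a aInOut = a) (hfirst : σ.a aFirst = fun _ => 0) :
    WP 11 N W buildCmd σ t fun s τ => ∃ 𝒩, Holds 𝒩 τ ∧ Built n L col 𝒩 (τ.a aR) ∧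
      s ≤ t + 50 * (n + m₂ + 1) := by
  have h1W : 1 ≤ W := by omega
  have h2W : 2 ≤ W := by omega
  rw [buildCmd, WP_seq, WP_set]
  refine ⟨by simp; omega, ?_⟩
  rw [WP_seq, colourCmd, WP_seq, WP_set]
  refine ⟨by simp, ?_⟩
  apply WP_whl (fun φ σ => σ.v vN = n ∧ σ.a aInOut = a ∧ σ.a aFirst = (fun _ => 0) ∧ σ.v vI ≤ n ∧
    (∀ v < σ.v vI, σ.a aCol v = col v) ∧ φ = 4 * (n - σ.v vI)) (4 * n)
  · simp [ha, hfirst, I.zero]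
  · simp
  · rintro φ σ ⟨h0, hio, hfi, hi, hcol, rfl⟩ hc
    have hi' : σ.v vI < n := by simpa [h0] using hc
    have hiN : σ.v vI < N := by omega
    have hiN2 : σ.v vI + 2 < N := by omega
    have hiW2 : σ.v vI + 2 ≤ W := by omega
    have hiW : σ.v vI < W := by omega
    simp [hiN, hiN2, hiW2, hiW, h1W, h2W, h0, hio, hfi, I.col _ hi']
    refine ⟨⟨by omega, ?_⟩, by omega⟩
    intro v hv
    by_cases hvi : v = σ.v vI
    · simp [hvi]
    · rw [Function.update_of_ne hvi]
      exact hcol v (by omega)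
  · rintro ψ s₁ σ₁ ⟨h0, hio, hfi, hi, hcol, rfl⟩ hc hs₁
    have hi' : σ₁.v vI = n := by
      have : ¬ σ₁.v vI < n := by simpa [h0] using hc
      omega
    rw [hi'] at hcol
    rw [WP_seq, WP_set]
    refine ⟨by simp, ?_⟩
    rw [WP_seq, WP_set]
    refine ⟨by simp, ?_⟩
    rw [WP_seq, WP_set]
    refine ⟨by simp [h0]; omega, ?_⟩
    rw [WP_seq]
    -- Each remaining list entry is charged 20 steps and each remaining vertex 5.
    apply WP_whl (fun φ σ => ∃ u ≤ n, BuildInv n L col off a u 0 σ ∧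
      φ = 5 * (n - u) + 20 * (m₂ - off u)) (5 * (n - 0) + 20 * (m₂ - off 0))
    · refine ⟨0, by omega, ⟨by simp [h0], by simp, by simp [h0, I.off_zero], by simp [hio],
        by simpa using hcol, ?_⟩, rfl⟩
      have harc : ∀ (𝒩 : Network) h, 𝒩.M = 0 → ¬ 𝒩.Arc h := by
        intro 𝒩 h hM hh
        have := hh.1
        have := hh.2
        omega
      have hno : ∀ h, ¬ (netOf n (((σ₁.setv vU (eval σ₁ (const 0))).setv vE
          (eval (σ₁.setv vU (eval σ₁ (const 0))) (const 0))).setv vP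
          (eval ((σ₁.setv vU (eval σ₁ (const 0))).setv vE
          (eval (σ₁.setv vU (eval σ₁ (const 0))) (const 0)))
            (((var vN).add (var vN)).add (const 2))))).Arc h :=
        fun h => harc _ h (by simp [netOf])
      refine ⟨?_, fun h hh => absurd hh (hno h), fun h hh => absurd hh (hno h), ?_⟩
      · constructor
        case first_le => intro v; simp [netOf, hfi]
        case first_tail => intro v hv; simp [netOf, hfi] at hv
        case inj => intro h _ hh; exact absurd hh (hno h)
        case le_nxt => intro h _ hh; exact absurd hh (hno h)
        all_goals intro h hh; exact absurd hh (hno h)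
      · rintro x y ⟨-, ⟨h, -⟩ | ⟨-, h⟩⟩
        · omega
        · simp at h
    · simp
    · rintro φ σ ⟨u, hu, B, rfl⟩ hc
      have hu' : u < n := by simpa [B.vn, B.vu] using hc
      have h₁ := I.off_le (u + 1) hu'
      have h₂ := I.off_succ u hu'
      refine (listCmd_spec I hN hW hu' B).mono ?_
      rintro s τ ⟨B', hs⟩
      refine ⟨_, ⟨u + 1, hu', B', rfl⟩, ?_⟩
      omega
    · rintro ψ s τ ⟨u, hu, B, rfl⟩ hc hs
      have hu' : u = n := by
        have : ¬ u < n := by simpa [B.vn, B.vu] using hc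
        omega
      subst hu'
      rw [WP_set]
      refine ⟨by simp, netOf u τ, ?_, ⟨rfl, B.colour, ?_⟩, by omega⟩
      · constructor <;> simp [netOf, B.vn]
      · simpa using B.build

end HappyEdges

/-! ### The whole program -/

namespace HappyEdges

open ArrayLang ArrayLang.Exp ArrayLang.Cmd

/-- Write the colours: the prescribed colour, or `1` for the vertices without a label and `2` for
the other vertices. -/
def outputCmd : Cmd :=
  .seq (set vI (const 0)) <| whl (.lt (var vI) (var vN)) <|
    .seq (ite (.eq (arr aCol (var vI)) (const 0))
      (ite (.eq (arr aD (var vI)) (const 0)) (put aInOut (var vI) (const 1))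
        (put aInOut (var vI) (const 2)))
      (put aInOut (var vI) (arr aCol (var vI)))) <|
    set vI (add (var vI) (const 1))

/-- The program on arrays for 2-MHE. -/
def mheCmd : Cmd := .seq buildCmd (.seq flowCmd outputCmd)

variable {n m₂ N W : ℕ} {L : ℕ → List ℕ} {col off a : ℕ → ℕ}

/-- The colour of a vertex in the output, for the labels `d`. -/
def outColour (col d : ℕ → ℕ) (v : ℕ) : ℕ :=
  if col v = 0 then if d v = 0 then 1 else 2 else col v

theorem outputCmd_spec (hN : n ≤ N) (hW : N + 3 ≤ W) {σ : St} {t : ℕ} (h0 : σ.v vN = n)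
    (hcol : ∀ v < n, σ.a aCol v = col v) :
    WP 11 N W outputCmd σ t fun s τ => (∀ v < n, τ.a aInOut v = outColour col (σ.a aD) v) ∧
      s ≤ t + 8 * (n + 1) := by
  have h1W : 1 ≤ W := by omega
  have h2W : 2 ≤ W := by omega
  rw [outputCmd, WP_seq, WP_set]
  refine ⟨by simp, ?_⟩
  apply WP_whl (fun φ τ => τ.v vN = n ∧ (∀ v < n, τ.a aCol v = col v) ∧ τ.a aD = σ.a aD ∧
    τ.v vI ≤ n ∧ (∀ v < τ.v vI, τ.a aInOut v = outColour col (σ.a aD) v) ∧ φ = 6 * (n - τ.v vI))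
    (6 * n)
  · simp [h0]
    exact hcol
  · simp
  · rintro φ τ ⟨h0, hcol, hD, hi, hout, rfl⟩ hc
    have hi' : τ.v vI < n := by simpa [h0] using hc
    have hiN : τ.v vI < N := by omega
    have hiW : τ.v vI < W := by omega
    have key : ∀ y, y = outColour col (σ.a aD) (τ.v vI) → ∀ v ≤ τ.v vI,
        Function.update (τ.a aInOut) (τ.v vI) y v = outColour col (σ.a aD) v := by
      rintro y rfl v hv
      by_cases hvi : v = τ.v vI
      · simp [hvi]
      · rw [Function.update_of_ne hvi]
        exact hout v (by omega)
    simp [hiN, hiW, h1W, h2W, h0, hD, hcol _ hi']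
    refine ⟨fun hc => ⟨fun hd => ?_, fun hd => ?_⟩, fun hc => ?_⟩
    · exact ⟨⟨hcol, by omega, key 1 (by rw [outColour, if_pos hc, if_pos hd])⟩, by omega⟩
    · exact ⟨⟨hcol, by omega, key 2 (by rw [outColour, if_pos hc, if_neg hd])⟩, by omega⟩
    · exact ⟨⟨hcol, by omega, key _ (by rw [outColour, if_neg hc])⟩, by omega⟩
  · rintro ψ s τ ⟨h0, hcol, hD, hi, hout, rfl⟩ hc hs
    have hi' : τ.v vI = n := by
      have : ¬ τ.v vI < n := by simpa [h0] using hc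
      omega
    rw [hi'] at hout
    exact ⟨hout, by omega⟩

/-- The program writes the colours that belong to a minimum cut. -/
theorem mheCmd_spec (I : IsInput n m₂ L col off a) (hN : N = 2 * n + 2 + m₂) (hW : N + 3 ≤ W)
    {D c : ℕ} (hDc : ∀ 𝒩 : Network, 𝒩.WF → 𝒩.n = n → 𝒩.M ≤ m₂ → CutBound 𝒩 D c)
    {σ : St} (ha : σ.a aInOut = a) (hfirst : σ.a aFirst = fun _ => 0) :
    WP 11 N W mheCmd σ 0 fun s τ => ∃ 𝒩 r d, Built n L col 𝒩 r ∧ 𝒩.Sep (fun v => d v = 0) ∧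
      (∀ U, 𝒩.Sep U → 𝒩.cut r (fun v => d v = 0) ≤ 𝒩.cut r U) ∧
      (∀ v < n, τ.a aInOut v = outColour col d v) ∧
      s ≤ 60 * (n + m₂ + 1) + 302 * (m₂ + 1) * (1 + D + c) := by
  rw [mheCmd, WP_seq]
  refine (buildCmd_spec I hN hW ha hfirst).mono ?_
  rintro s₁ σ₁ ⟨𝒩, hH, hB, hs₁⟩
  have wf := hB.build.wf
  have hM := hB.build.le I hB.n_eq
  have hn := hB.n_eq
  have ft : Fits 𝒩 N W := ⟨by omega, by omega, hW⟩
  rw [WP_seq]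
  -- All residual capacities are 1 at the start, so opposite ones have the sum 2, and `cap` is the
  -- initial cut.
  have hF : FlowInv 𝒩 (𝒩.cut (σ₁.a aR)) 0 σ₁ := by
    refine ⟨hH, ?_, fun _ _ => rfl⟩
    intro h hh
    rw [hB.build.one h hh, hB.build.one _ (wf.mate_arc h hh)]
  refine (flowCmd_spec wf ft (hDc 𝒩 wf hn hM) hF).mono ?_
  rintro s₂ σ₂ ⟨hH₂, hsep, hmin, hs₂⟩
  refine (outputCmd_spec (col := col) (by omega) hW (hH₂.n.trans hn) ?_).mono ?_
  · rw [hH₂.col]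
    exact hB.colour
  · rintro s τ ⟨hout, hs⟩
    refine ⟨𝒩, σ₁.a aR, σ₂.a aD, hB, hsep, hmin, hout, ?_⟩
    have : 302 * (𝒩.M + 1) * (1 + D + c) ≤ 302 * (m₂ + 1) * (1 + D + c) :=
      Nat.mul_le_mul_right _ (by omega)
    omega

end HappyEdges

/-! ### Instances as inputs -/

/-- Cut the concatenation in front of the list `i`: the position then falls into the head of the
remaining part. This locates adjacency list entries in the input. -/
theorem List.getElem?_flatten_take_add {α : Type*} {l : List (List α)} {i j : ℕ}
    (hi : i < l.length) (hj : j < l[i].length) :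
    l.flatten[(l.take i).flatten.length + j]? = some l[i][j] := by
  have e : l.flatten = (l.take i).flatten ++ (l.drop i).flatten := by
    rw [← List.flatten_append, List.take_append_drop]
  rw [e, List.getElem?_append_right (by omega), Nat.add_sub_cancel_left,
    List.drop_eq_getElem_cons hi, List.flatten_cons, List.getElem?_append_left hj,
    List.getElem?_eq_getElem hj]

namespace HappyEdges

variable {n : ℕ} {G : SimpleGraph (Fin n)} {c : Fin n → Option (Fin 2)}
  {adj : Fin n → List (Fin n)}

theorem card_dart_eq [Fintype G.Dart] : Fintype.card G.Dart = 2 * numEdges G := by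
  classical
  rw [Fintype.card_congr' rfl, numEdges, ← SimpleGraph.coe_edgeFinset, Set.ncard_coe_finset]
  convert G.dart_card_eq_twice_card_edges

theorem IsAdjacencyLists.length_eq [DecidableRel G.Adj] (h : IsAdjacencyLists G adj) (v : Fin n) :
    (adj v).length = G.degree v := by
  classical
  rw [← List.toFinset_card_of_nodup (h.nodup v), ← G.card_neighborFinset_eq_degree]
  congr 1
  ext w
  simp [h.mem_iff]

theorem IsAdjacencyLists.sum_length (h : IsAdjacencyLists G adj) :
    ∑ v, (adj v).length = 2 * numEdges G := by
  classical
  simp_rw [h.length_eq]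
  rw [G.sum_degrees_eq_twice_card_edges, numEdges, ← SimpleGraph.coe_edgeFinset,
    Set.ncard_coe_finset]

theorem IsAdjacencyLists.length_flatten (h : IsAdjacencyLists G adj) :
    (List.ofFn adj).flatten.length = 2 * numEdges G := by
  rw [List.length_flatten, List.map_ofFn, List.sum_ofFn]
  exact h.sum_length

theorem IsAdjacencyLists.length_encodeInstance (h : IsAdjacencyLists G adj) :
    (encodeInstance G c adj).length = 2 * (n + numEdges G) + 2 := by
  simp only [encodeInstance, List.length_cons, List.length_append, List.length_ofFn,
    List.length_map, h.length_flatten]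
  omega

/-- The adjacency list of a vertex, as a list of numbers. -/
def listOf (adj : Fin n → List (Fin n)) (v : ℕ) : List ℕ :=
  if h : v < n then (adj ⟨v, h⟩).map Fin.val else []

/-- The colour word of a vertex. -/
def colourOf (c : Fin n → Option (Fin 2)) (v : ℕ) : ℕ :=
  if h : v < n then colourWord (c ⟨v, h⟩) else 0

theorem IsAdjacencyLists.mem_listOf (h : IsAdjacencyLists G adj) {x y : ℕ} :
    y ∈ listOf adj x ↔ ∃ (hx : x < n) (hy : y < n), G.Adj ⟨x, hx⟩ ⟨y, hy⟩ := by
  rw [listOf]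
  split
  · rename_i hx
    simp only [List.mem_map, h.mem_iff]
    constructor
    · rintro ⟨w, hw, rfl⟩
      exact ⟨hx, w.isLt, hw⟩
    · rintro ⟨_, hy, hw⟩
      exact ⟨_, hw, rfl⟩
  · rename_i hx
    simp [hx]

theorem colourWord_le (i : Option (Fin 2)) : colourWord i ≤ 2 := by
  rcases i with _ | i
  · exact Nat.zero_le _
  · have := i.isLt
    simp only [colourWord]
    omega

theorem IsAdjacencyLists.encodeInstance_getD_le (h : IsAdjacencyLists G adj) (i : ℕ) :
    (encodeInstance G c adj).getD i 0 ≤ n + 2 * numEdges G + 2 := by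
  classical
  rcases lt_or_ge i (encodeInstance G c adj).length with hi | hi
  · rw [List.getD_eq_getElem _ _ hi]
    have : ∀ x ∈ encodeInstance G c adj, x ≤ n + 2 * numEdges G + 2 := by
      intro x hx
      simp only [encodeInstance, List.mem_cons, List.mem_append, List.mem_ofFn, List.mem_map] at hx
      rcases hx with rfl | rfl | (⟨v, rfl⟩ | ⟨v, rfl⟩) | ⟨v, -, rfl⟩
      · omega
      · omega
      · have := colourWord_le (c v)
        omega
      · have := Finset.single_le_sum (f := fun v => (adj v).length) (fun _ _ => Nat.zero_le _)
          (Finset.mem_univ v)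
        rw [h.sum_length] at this
        omega
      · omega
    exact this _ (List.getElem_mem hi)
  · rw [List.getD_eq_default _ _ hi]
    exact Nat.zero_le _

theorem IsAdjacencyLists.isInput (h : IsAdjacencyLists G adj) :
    IsInput n (2 * numEdges G) (listOf adj) (colourOf c)
      (fun v => ((List.ofFn adj).take v).flatten.length)
      (fun i => (encodeInstance G c adj).getD i 0) where
  zero := rfl
  col v hv := by
    simp [encodeInstance, colourOf, hv, List.getElem?_append_left]
  len v hv := by
    rw [show n + 2 + v = (n + v) + 2 by omega]
    simp [encodeInstance, listOf, hv, List.getElem?_append_left, List.getElem?_append_right]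
  adj v hv j hj := by
    have hj' : j < (adj ⟨v, hv⟩).length := by simpa [listOf, hv] using hj
    have := List.getElem?_flatten_take_add (l := List.ofFn adj) (i := v) (j := j) (by simpa using hv)
      (by simpa using hj')
    rw [show n + n + 2 + (((List.ofFn adj).take v).flatten.length + j) =
      n + (n + (((List.ofFn adj).take v).flatten.length + j)) + 2 by omega]
    simp only [encodeInstance, List.getD_eq_getElem?_getD, List.getElem?_cons_succ,
      List.append_assoc]
    rw [List.getElem?_append_right (by simp), List.length_ofFn, Nat.add_sub_cancel_left,
      List.getElem?_append_right (by simp), List.length_ofFn, Nat.add_sub_cancel_left,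
      List.getElem?_map, this]
    simp [listOf, hv]
  off_zero := by simp
  off_succ v hv := by
    rw [List.take_succ_eq_append_getElem (by simpa using hv), List.flatten_append,
      List.length_append]
    simp [listOf, hv]
  off_le v hv := by
    rw [← h.length_flatten]
    conv_rhs => rw [← List.take_append_drop v (List.ofFn adj), List.flatten_append,
      List.length_append]
    omega
  nodup v hv := by
    simp only [listOf, hv, dite_true]
    exact (h.nodup _).map Fin.val_injective
  lt v hv w hw := by
    obtain ⟨-, hy, -⟩ := h.mem_listOf.1 hw
    exact hy
  card M g hg hinj := by
    classical
    -- The numbered pairs, shifted to start at 0, become distinct darts, of which there are `2 m`.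
    have key : ∀ k : Fin M, ∃ (hx : (g (k + 1)).1 < n) (hy : (g (k + 1)).2 < n),
        G.Adj ⟨_, hx⟩ ⟨_, hy⟩ := by
      intro k
      obtain ⟨hx, hy, h₁ | h₁⟩ := hg (k + 1) (Nat.succ_ne_zero _) k.isLt
      · exact h.mem_listOf.1 h₁
      · obtain ⟨_, _, h₂⟩ := h.mem_listOf.1 h₁
        exact ⟨hx, hy, h₂.symm⟩
    choose hx hy hadj using key
    rw [← card_dart_eq (G := G), ← Fintype.card_fin M]
    apply Fintype.card_le_of_injective (fun k : Fin M => (⟨(_, _), hadj k⟩ : G.Dart))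
    intro k l hkl
    simp only [SimpleGraph.Dart.mk.injEq, Prod.mk.injEq, Fin.mk.injEq] at hkl
    have := hinj (k + 1) (l + 1) (Nat.succ_ne_zero _) k.isLt (Nat.succ_ne_zero _) l.isLt
      (Prod.ext hkl.1 hkl.2)
    exact Fin.ext (Nat.succ_injective this)

end HappyEdges

/-! ### Cuts and happy edges -/

namespace HappyEdges

variable {n : ℕ} {G : SimpleGraph (Fin n)} {c : Fin n → Option (Fin 2)}
  {adj : Fin n → List (Fin n)} {𝒩 : Network} {r : ℕ → ℕ}

theorem mk_mem_happyEdges {V C : Type*} {G : SimpleGraph V} {f : V → C} {x y : V} :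
    s(x, y) ∈ happyEdges G f ↔ G.Adj x y ∧ f x = f y := by
  simp only [happyEdges, Set.mem_ofPred_eq, SimpleGraph.mem_edgeSet, Sym2.mem_iff]
  refine and_congr_right fun _ => ⟨fun h => h x (Or.inl rfl) y (Or.inr rfl), ?_⟩
  rintro h u (rfl | rfl) v (rfl | rfl) <;> simp [h]

theorem Built.edge_of_arc (hB : Built n (listOf adj) (colourOf c) 𝒩 r) (h : IsAdjacencyLists G adj) {k : ℕ}
    (hk : 𝒩.Arc k) : ∃ (hx : 𝒩.tail k < n) (hy : 𝒩.hd k < n), G.Adj ⟨_, hx⟩ ⟨_, hy⟩ := by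
  rcases hB.build.sound k hk with h₁ | h₁
  · exact h.mem_listOf.1 h₁.mem
  · obtain ⟨hx, hy, h₂⟩ := h.mem_listOf.1 h₁.mem
    exact ⟨hy, hx, h₂.symm⟩

theorem Built.exists_arc (hB : Built n (listOf adj) (colourOf c) 𝒩 r) (h : IsAdjacencyLists G adj)
    {x y : Fin n} (hxy : G.Adj x y) : ∃ k, 𝒩.Arc k ∧ 𝒩.tail k = x ∧ 𝒩.hd k = y := by
  have hne : x.val ≠ y.val := fun e => hxy.ne (Fin.ext e)
  rcases Nat.lt_or_gt_of_ne hne with hlt | hlt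
  · exact hB.build.complete x y
      ⟨hlt, Or.inl ⟨x.isLt, h.mem_listOf.2 ⟨x.isLt, y.isLt, hxy⟩⟩⟩
  · obtain ⟨k, hk, ht, hh⟩ := hB.build.complete y x
      ⟨hlt, Or.inl ⟨y.isLt, h.mem_listOf.2 ⟨y.isLt, x.isLt, hxy.symm⟩⟩⟩
    exact ⟨_, hB.build.wf.mate_arc k hk, (hB.build.wf.tail_mate hk).trans hh, ht⟩

/-- Every edge is either happy or cut. -/
theorem Built.ncard_add_cut (hB : Built n (listOf adj) (colourOf c) 𝒩 r)
    (h : IsAdjacencyLists G adj) {g : Fin n → Fin 2} {U : ℕ → Prop}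
    (hU : ∀ k, 𝒩.Arc k → ∀ hv : 𝒩.hd k < n, U (𝒩.hd k) ↔ g ⟨_, hv⟩ = 0) :
    (happyEdges G g).ncard + 𝒩.cut r U = numEdges G := by
  classical
  have wf := hB.build.wf
  have hU' : ∀ k, 𝒩.Arc k → ∀ hv : 𝒩.tail k < n, U (𝒩.tail k) ↔ g ⟨_, hv⟩ = 0 :=
    fun k hk => hU _ (wf.mate_arc k hk)
  have h01 : ∀ i j : Fin 2, i = 0 → ¬ j = 0 → i ≠ j := by decide
  have h10 : ∀ i j : Fin 2, i ≠ j → i = 0 ∧ ¬ j = 0 ∨ j = 0 ∧ ¬ i = 0 := by decide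
  let S : Finset ℕ := {k ∈ Finset.Icc 1 𝒩.M | U (𝒩.tail k) ∧ ¬ U (𝒩.hd k)}
  have hcut : 𝒩.cut r U = S.card := by
    rw [Network.cut, Network.weight, Finset.card_filter]
    refine Finset.sum_congr rfl fun k hk => ?_
    rw [hB.build.one k (Network.mem_Icc_iff_arc.1 hk), mul_one]
  have hS : ∀ k, k ∈ (S : Set ℕ) ↔ 𝒩.Arc k ∧ U (𝒩.tail k) ∧ ¬ U (𝒩.hd k) := by
    intro k
    simp only [S, Finset.mem_coe, Finset.mem_filter, Network.mem_Icc_iff_arc]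
  have hcard : (S : Set ℕ).ncard = (G.edgeSet \ happyEdges G g).ncard := by
    -- An unhappy edge has exactly one of its two arcs leaving `U`, so arcs in the cut and unhappy
    -- edges are in bijection.
    refine Set.ncard_congr (fun k hk => s(⟨𝒩.tail k, (hB.edge_of_arc h ((hS k).1 hk).1).1⟩,
      ⟨𝒩.hd k, (hB.edge_of_arc h ((hS k).1 hk).1).2.1⟩)) ?_ ?_ ?_
    · intro k hk
      obtain ⟨ha, hu, hv⟩ := (hS k).1 hk
      obtain ⟨hx, hy, hadj⟩ := hB.edge_of_arc h ha
      refine ⟨hadj, fun hm => ?_⟩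
      rw [hU' k ha hx] at hu
      rw [hU k ha hy] at hv
      exact h01 _ _ hu hv (mk_mem_happyEdges.1 hm).2
    · intro k l hk hl e
      obtain ⟨ha, hu, hv⟩ := (hS k).1 hk
      obtain ⟨hb, hu', hv'⟩ := (hS l).1 hl
      simp only [Sym2.eq_iff, Fin.mk.injEq] at e
      rcases e with ⟨e₁, e₂⟩ | ⟨e₁, e₂⟩
      · exact wf.inj k l ha hb e₁ e₂
      -- Opposite arcs cannot both leave `U`.
      · rw [e₁] at hu
        exact absurd hu hv'
    · intro e he
      induction e with | _ x y
      have hadj : G.Adj x y := he.1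
      have hne : g x ≠ g y := fun e => he.2 (mk_mem_happyEdges.2 ⟨hadj, e⟩)
      have key : ∀ x y, G.Adj x y → g x = 0 → ¬ g y = 0 →
          ∃ k, ∃ hk : k ∈ (S : Set ℕ), s((⟨𝒩.tail k, (hB.edge_of_arc h ((hS k).1 hk).1).1⟩ : Fin n),
            ⟨𝒩.hd k, (hB.edge_of_arc h ((hS k).1 hk).1).2.1⟩) = s(x, y) := by
        intro x y hadj hx hy
        obtain ⟨k, ha, ht, hh⟩ := hB.exists_arc h hadj
        refine ⟨k, (hS k).2 ⟨ha, ?_, ?_⟩, ?_⟩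
        · rw [hU' k ha (by rw [ht]; exact x.isLt)]
          simpa only [ht] using hx
        · rw [hU k ha (by rw [hh]; exact y.isLt)]
          simpa only [hh] using hy
        · simp only [ht, hh]
      rcases h10 _ _ hne with ⟨hx, hy⟩ | ⟨hy, hx⟩
      · exact key x y hadj hx hy
      · rw [Sym2.eq_swap]
        exact key y x hadj.symm hy hx
  have hsub : happyEdges G g ⊆ G.edgeSet := fun e he => he.1
  rw [hcut, ← Set.ncard_coe_finset, hcard, numEdges, add_comm]
  exact Set.ncard_sdiff_add_ncard_of_subset hsub (Set.toFinite _)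

/-- The colouring that belongs to the labels `d`. -/
def colouring (c : Fin n → Option (Fin 2)) (d : ℕ → ℕ) (v : Fin n) : Fin 2 :=
  match c v with
  | some i => i
  | none => if d v = 0 then 0 else 1

theorem outColour_eq (c : Fin n → Option (Fin 2)) (d : ℕ → ℕ) (v : Fin n) :
    outColour (colourOf c) d v = colourWord (some (colouring c d v)) := by
  simp only [outColour, colourOf, v.isLt, dite_true, colouring]
  rcases hc : c v with _ | i
  · simp only [colourWord, if_true]
    split <;> rfl
  · simp [colourWord]

theorem Built.isMHESolution (hB : Built n (listOf adj) (colourOf c) 𝒩 r)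
    (h : IsAdjacencyLists G adj) {d : ℕ → ℕ} (hsep : 𝒩.Sep fun v => d v = 0)
    (hmin : ∀ U, 𝒩.Sep U → 𝒩.cut r (fun v => d v = 0) ≤ 𝒩.cut r U) :
    IsMHESolution G c (colouring c d) := by
  have hcol : ∀ k, 𝒩.Arc k → ∀ hv : 𝒩.hd k < n, 𝒩.col (𝒩.hd k) = colourWord (c ⟨_, hv⟩) := by
    intro k hk hv
    rw [hB.colour _ hv, colourOf, dif_pos hv]
  refine ⟨fun v i hv => by simp [colouring, hv], fun g hg => ?_⟩
  -- At uncoloured vertices the colouring follows the labels by definition; at precoloured ones the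
  -- two agree because the set separates. Isolated vertices, where they may differ, are not heads of
  -- arcs.
  have h₁ := hB.ncard_add_cut h (g := colouring c d) (U := fun v => d v = 0) (by
    intro k hk hv
    have hc := hcol k hk hv
    obtain ⟨s₁, s₂⟩ := hsep k hk
    rcases hcv : c ⟨_, hv⟩ with _ | i
    · simp [colouring, hcv]
    · rw [hcv] at hc
      fin_cases i
      · simpa [colouring, hcv] using s₁ hc
      · simpa [colouring, hcv] using s₂ hc)
  -- A competitor `g` is compared through its class of the first colour, which separates as `g`
  -- extends `c`.
  have h₂ := hB.ncard_add_cut h (g := g) (U := fun x => ∃ hx : x < n, g ⟨x, hx⟩ = 0) (by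
    intro k hk hv
    simp [hv])
  have h₃ := hmin (fun x => ∃ hx : x < n, g ⟨x, hx⟩ = 0) (by
    intro k hk
    obtain ⟨-, hv, -⟩ := hB.edge_of_arc h hk
    have hc := hcol k hk hv
    rcases hcv : c ⟨_, hv⟩ with _ | i
    · rw [hcv] at hc
      simp [hc, colourWord]
    · have := hg _ _ hcv
      rw [hcv] at hc
      rw [hc]
      fin_cases i <;> simp [this, hv, colourWord])
  omega

end HappyEdges

/-! ### The running time -/

namespace HappyEdges

open WordRAM ArrayLang

theorem timeBound_nonneg (n m : ℕ) : 0 ≤ timeBound n m := by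
  rw [timeBound]
  positivity

/-- The time bound in terms of bounds for the number of augmentations. -/
theorem exists_timeBound_eq {n m : ℕ} (hn : n ≠ 0) (hm : m ≠ 0) :
    ∃ x : ℝ, 1 ≤ x ∧ timeBound n m = x * m ∧ (x ^ 2 = m ∨ x ^ 3 = (n : ℝ) ^ 2) := by
  have hn1 : (1 : ℝ) ≤ n := by exact_mod_cast Nat.one_le_iff_ne_zero.2 hn
  have hm1 : (1 : ℝ) ≤ m := by exact_mod_cast Nat.one_le_iff_ne_zero.2 hm
  rcases min_choice ((n : ℝ) ^ (2 / 3 : ℝ) * (m : ℝ)) ((m : ℝ) ^ (3 / 2 : ℝ)) with h | h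
  · refine ⟨(n : ℝ) ^ (2 / 3 : ℝ), Real.one_le_rpow hn1 (by norm_num), h, Or.inr ?_⟩
    rw [← Real.rpow_natCast, ← Real.rpow_mul (by positivity), ← Real.rpow_natCast (n : ℝ) 2]
    norm_num
  · refine ⟨(m : ℝ) ^ (1 / 2 : ℝ), Real.one_le_rpow hm1 (by norm_num), ?_, Or.inl ?_⟩
    · rw [timeBound, h]
      conv_rhs => rw [← Real.rpow_one (m : ℝ), ← Real.rpow_mul (by positivity),
        ← Real.rpow_add (by positivity)]
      norm_num
    · rw [← Real.rpow_natCast, ← Real.rpow_mul (by positivity)]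
      norm_num

/-- The factor of `m` in the time bound is at least 1. This absorbs the linear costs outside the
phases. -/
theorem le_timeBound {n m : ℕ} (h : m ≠ 0 → n ≠ 0) : (m : ℝ) ≤ timeBound n m := by
  by_cases hm : m = 0
  · simpa [hm] using timeBound_nonneg n 0
  · obtain ⟨x, hx, e, -⟩ := exists_timeBound_eq (h hm) hm
    rw [e]
    exact le_mul_of_one_le_left (Nat.cast_nonneg m) hx

/-- The best choice of the distance up to which the layers are counted. -/
theorem exists_cutBound {n m : ℕ} (hnm : m ≠ 0 → n ≠ 0) :
    ∃ D c : ℕ, (∀ 𝒩 : Network, 𝒩.WF → 𝒩.n = n → 𝒩.M ≤ 2 * m → CutBound 𝒩 D c) ∧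
      (302 * (2 * m + 1) * (1 + D + c) : ℝ) ≤ 9966 * timeBound n m + 604 := by
  by_cases hm : m = 0
  -- Without edges every cut is 0, and `302 * 1 * (1 + 1 + 0) = 604`.
  · refine ⟨1, 0, fun 𝒩 _ _ hM d r hr hv hs ht => ?_, ?_⟩
    · obtain ⟨U, hU, hle⟩ := Network.exists_cut_le_arcs hr hv le_rfl hs ht
      exact ⟨U, hU, by omega⟩
    · have := timeBound_nonneg n m
      rw [hm] at this ⊢
      norm_num
      linarith
  · obtain ⟨x, hx, e, hx'⟩ := exists_timeBound_eq (hnm hm) hm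
    have hx0 : 0 < x := by linarith
    have hDx : x ≤ (⌈x⌉₊ : ℝ) := Nat.le_ceil x
    have hD1 : 1 ≤ ⌈x⌉₊ := Nat.one_le_ceil_iff.2 hx0
    have hDle : (⌈x⌉₊ : ℝ) ≤ 2 * x := by
      have := (Nat.ceil_lt_add_one hx0.le).le
      linarith
    have hD0 : (0 : ℝ) < (⌈x⌉₊ : ℝ) := by linarith
    have hm1 : (1 : ℝ) ≤ m := by exact_mod_cast Nat.one_le_iff_ne_zero.2 hm
    -- With `D = ⌈x⌉` and at most `2 m` arcs, the arc bound `4 m / D` is at most `4 x` if `x ^ 2 =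
    -- m`, and the vertex bound `8 n ^ 2 / D ^ 2` is at most `8 x` if `x ^ 3 = n ^ 2`.
    obtain ⟨c, hc, hcx⟩ : ∃ c : ℕ, (∀ 𝒩 : Network, 𝒩.WF → 𝒩.n = n → 𝒩.M ≤ 2 * m →
        CutBound 𝒩 ⌈x⌉₊ c) ∧ (c : ℝ) ≤ 8 * x := by
      rcases hx' with h₂ | h₃
      · refine ⟨4 * m / ⌈x⌉₊, fun 𝒩 _ _ hM d r hr hv hs ht => ?_, ?_⟩
        · obtain ⟨U, hU, hle⟩ := Network.exists_cut_le_arcs hr hv hD1 hs ht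
          refine ⟨U, hU, (Nat.le_div_iff_mul_le hD1).2 ?_⟩
          rw [mul_comm]
          omega
        · refine Nat.cast_div_le.trans ?_
          rw [div_le_iff₀ hD0]
          push_cast
          rw [← h₂]
          nlinarith
      · refine ⟨8 * n ^ 2 / ⌈x⌉₊ ^ 2, fun 𝒩 wf hn _ d r hr hv hs ht => ?_, ?_⟩
        · obtain ⟨U, hU, hle⟩ := Network.exists_cut_le_vertices wf hr hv hD1 hs ht
          refine ⟨U, hU, (Nat.le_div_iff_mul_le (by positivity)).2 ?_⟩
          rw [mul_comm, ← hn]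
          exact hle
        · refine Nat.cast_div_le.trans ?_
          push_cast
          rw [div_le_iff₀ (by positivity), ← h₃]
          have : x ^ 2 ≤ (⌈x⌉₊ : ℝ) ^ 2 := pow_le_pow_left₀ hx0.le hDx 2
          nlinarith
    refine ⟨⌈x⌉₊, c, hc, ?_⟩
    rw [e]
    -- `1 ≤ x`, `D ≤ 2 x` and `c ≤ 8 x` add up to `11 x`, and `302 * 3 * 11 = 9966`.
    have h₁ : (2 * m + 1 : ℝ) ≤ 3 * m := by linarith
    have h₂ : (1 + ⌈x⌉₊ + c : ℝ) ≤ 11 * x := by linarith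
    have := mul_le_mul h₁ h₂ (by positivity) (by positivity)
    linarith

theorem IsAdjacencyLists.ne_zero {n : ℕ} {G : SimpleGraph (Fin n)} {adj : Fin n → List (Fin n)}
    (h : IsAdjacencyLists G adj) (hm : numEdges G ≠ 0) : n ≠ 0 := by
  rintro rfl
  have := h.sum_length
  simp only [Finset.univ_eq_empty, Finset.sum_empty] at this
  omega

theorem IsAdjacencyLists.le_two_mul_numEdges {n : ℕ} {G : SimpleGraph (Fin n)}
    {adj : Fin n → List (Fin n)} (h : IsAdjacencyLists G adj) (hG : ∀ v, ∃ w, G.Adj v w) :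
    n ≤ 2 * numEdges G := by
  rw [← h.sum_length]
  have : ∑ _v : Fin n, 1 ≤ ∑ v, (adj v).length := by
    refine Finset.sum_le_sum fun v _ => ?_
    obtain ⟨w, hw⟩ := hG v
    exact List.length_pos_of_mem ((h.mem_iff v w).2 hw)
  simpa using this

/-- The word RAM program for 2-MHE. -/
def mheProg : Prog := .seq (setup 10) mheCmd.compile

theorem IsAdjacencyLists.mheProg_runs {n : ℕ} {G : SimpleGraph (Fin n)}
    {c : Fin n → Option (Fin 2)} {adj : Fin n → List (Fin n)} (h : IsAdjacencyLists G adj) :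
    ∃ (t : ℕ) (τ : State) (f : Fin n → Fin 2),
      Runs (22 * (n + numEdges G + 1)) mheProg (initialState (encodeInstance G c adj)) t τ ∧
      OutputsColouring τ f ∧ IsMHESolution G c f ∧
      (t : ℝ) ≤ (19 + 10086 * mheCmd.width) * (n + 1 + timeBound n (numEdges G)) := by
  obtain ⟨D, b, hDb, hT⟩ := exists_cutBound (n := n) (m := numEdges G) h.ne_zero
  -- Eleven arrays, each as long as the input, occupy exactly `22 (n + m + 1)` cells; this fixes the
  -- word size.
  have hW : (10 + 1) * (2 * (n + numEdges G) + 2) ≤ 22 * (n + numEdges G + 1) := by omega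
  obtain ⟨s₁, r₁, S₁⟩ := setup_runs (input := encodeInstance G c adj) rfl rfl
    h.length_encodeInstance.le
    (fun i => (h.encodeInstance_getD_le i).trans (by omega)) hW
  obtain ⟨s, σ, hE, 𝒩, r, d, hB, hsep, hmin, hout, hs⟩ := mheCmd_spec (h.isInput (c := c))
    (N := 2 * (n + numEdges G) + 2) (W := 22 * (n + numEdges G + 1)) (by omega) (by omega) hDb
    (σ := inputState (encodeInstance G c adj)) rfl rfl
  obtain ⟨s₂, t, r₂, S₂, ht⟩ := hE.compile_runs hW le_rfl s₁ S₁
  refine ⟨_, s₂, colouring c d, Runs.seq r₁ r₂, fun v => ?_, hB.isMHESolution h hsep hmin, ?_⟩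
  -- The output is in array 0, which starts at address 0.
  · have := S₂.arr 0 (by omega) v (by omega)
    rw [zero_mul, zero_add] at this
    rw [this, hout v v.isLt, outColour_eq]
  · have hs' : (s : ℝ) ≤ 60 * (n + 2 * numEdges G + 1) +
        302 * (2 * numEdges G + 1) * (1 + D + b) := by
      rw [zero_add] at hs
      exact_mod_cast hs
    have ht' : (t : ℝ) ≤ mheCmd.width * s := by exact_mod_cast ht
    have hm := le_timeBound h.ne_zero
    have hn : (0 : ℝ) ≤ n := Nat.cast_nonneg n
    have h₀ := timeBound_nonneg n (numEdges G)
    -- Here `10086 = 9966 + 2 * 60`, as the `120 m` steps outside the phases are absorbed by the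
    -- time bound. The 19 in the total are the steps of `setup 10`.
    have hs'' : (s : ℝ) ≤ 10086 * (n + 1 + timeBound n (numEdges G)) := by linarith
    have := mul_le_mul_of_nonneg_left hs'' (Nat.cast_nonneg (α := ℝ) mheCmd.width)
    push_cast
    linarith

end HappyEdges

/-- One program solves every instance of 2-MHE, on words of `log (n + m + 1) + O(1)` bits. On graphs
without isolated vertices it takes `O(min {n^(2/3) m, m^(3/2)})` steps. On arbitrary graphs, where
already the output of the `n` colours needs `n` steps, it takes
`O(n + 1 + min {n^(2/3) m, m^(3/2)})` steps. -/
theorem mainTheorem5 :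
    ∃ (p : WordRAM.Prog) (K : ℕ) (A : ℝ),
      ∀ (n : ℕ) (G : SimpleGraph (Fin n)) (c : Fin n → Option (Fin 2))
        (adj : Fin n → List (Fin n)), HappyEdges.IsAdjacencyLists G adj →
        ∃ (t : ℕ) (τ : WordRAM.State) (f : Fin n → Fin 2),
          WordRAM.Runs (K * (n + HappyEdges.numEdges G + 1)) p
            (WordRAM.initialState (HappyEdges.encodeInstance G c adj)) t τ ∧
          HappyEdges.OutputsColouring τ f ∧
          HappyEdges.IsMHESolution G c f ∧
          (0 < n → (∀ v, ∃ w, G.Adj v w) →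
            (t : ℝ) ≤ A * HappyEdges.timeBound n (HappyEdges.numEdges G)) ∧
          (t : ℝ) ≤ A * ((n : ℝ) + 1 + HappyEdges.timeBound n (HappyEdges.numEdges G)) := by
  refine ⟨HappyEdges.mheProg, 22, 4 * (19 + 10086 * HappyEdges.mheCmd.width),
    fun n G c adj h => ?_⟩
  obtain ⟨t, τ, f, hr, ho, hf, ht⟩ := h.mheProg_runs (c := c)
  have h₀ := HappyEdges.timeBound_nonneg n (HappyEdges.numEdges G)
  have hn : (0 : ℝ) ≤ n := Nat.cast_nonneg n
  have hB : (0 : ℝ) ≤ 19 + 10086 * HappyEdges.mheCmd.width := by positivity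
  refine ⟨t, τ, f, hr, ho, hf, fun hpos hG => ?_, ?_⟩
  -- Without isolated vertices `n ≤ 2 m`, and `1 ≤ m` as the graph is non-empty. So `n + 1` is at
  -- most three times the time bound, which explains the factor 4.
  · have h₁ := h.le_two_mul_numEdges hG
    have h₂ : (n : ℝ) ≤ 2 * HappyEdges.numEdges G := by exact_mod_cast h₁
    have h₃ : (1 : ℝ) ≤ HappyEdges.numEdges G := by
      exact_mod_cast (by omega : 1 ≤ HappyEdges.numEdges G)
    have h₄ := HappyEdges.le_timeBound h.ne_zero
    have := mul_le_mul_of_nonneg_left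
      (by linarith : (n : ℝ) + 1 + HappyEdges.timeBound n (HappyEdges.numEdges G) ≤
        4 * HappyEdges.timeBound n (HappyEdges.numEdges G)) hB
    linarith
  · have : 0 ≤ (19 + 10086 * (HappyEdges.mheCmd.width : ℝ)) *
        (n + 1 + HappyEdges.timeBound n (HappyEdges.numEdges G)) := by positivity
    linarith
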